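/- Let $s\in(0,1)$ and $n\ge 1$. Write points of $\mathbb R^{n+1}$ as $x=(x'',x_n,x_{n+1})$ with $x''\in\mathbb R^{n-1}$, put $\rho=|(x_n,x_{n+1})|=\sqrt{x_n^2+x_{n+1}^2}$, and let $\mathbb R^{n+1}_+=\{x_{n+1}\ge 0\}$. A *solution* is a function $u:\mathbb R^{n+1}_+\to\mathbb R$ that is continuous on $\mathbb R^{n+1}_+$ and $C^2$ in $\{x_{n+1}>0\}$ and satisfies pointwise $$\nabla\cdot x_{n+1}^{1-2s}\nabla u=0 \text{ in }\{x_{n+1}>0\},\qquad u=0\text{ on }\{x_{n+1}=0,\ x_n\le 0\},\qquad \lim_{x_{n+1}\to0+}x_{n+1}^{1-2s}\partial_{n+1}u=0\text{ on }\{x_{n+1}=0,\ x_n>0\}.$$ It is $\kappa$-homogeneous if $u(\lambda x)=\lambda^\kappa u(x)$ for all $\lambda>0$ and $x\in\mathbb R^{n+1}_+$. For $m\in\mathbb N=\{0,1,2,\dots\}$ let $$u_m(x)=\rho^m\Big(\frac{\rho+x_n}{2}\Big)^s F\Big(-m,m+1,1+s;\frac{x_n/\rho+1}{2}\Big)$$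 (extended by $0$ to $\rho=0$), where $F={}_2F_1$ is the hypergeometric function, and let $w_{0,s}(x_n,x_{n+1})=(\rho+x_n)^s$. 1. If $\kappa\ge0$ and $u\not\equiv0$ is a $\kappa$-homogeneous solution, then $\kappa=s+\ell$ for some $\ell\in\mathbb N$. 2. Let $\ell\in\mathbb N$. A function $u:\mathbb R^{n+1}_+\to\mathbb R$ is an $(s+\ell)$-homogeneous solution if and only if $$u(x)=\sum_{m=0}^{\ell}\ \sum_{0\le 2k\le \ell-m}\rho^{2k}\,P_{m,k}(x'')\,u_m(x)\qquad\text{on }\mathbb R^{n+1}_+,$$ where $P_{m,k}$ is a homogeneous polynomial in $x''$ of degree $\ell-m-2k$ (possibly $0$) and $\Delta''P_{m,k}+(2k+2)(2m+2k+3)P_{m,k+1}=0$ whenever $m+2k+2\le\ell$. Here $\Delta''$ is the Laplacian in $x''$. 3. There are polynomials $p_m(X,R)$, $m\in\mathbb N$, homogeneous of degree $m$, with $u_m(x)=w_{0,s}(x_n,x_{n+1})\,p_m(x_n,\rho)$ on $\mathbb R^{n+1}_+$. With them, every $(s+\ell)$-homogeneous solution has the form $$u(x)=\sum_{k+d=\ell}\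 \sum_{0\le 2j\le k} w_{0,s}(x_n,x_{n+1})\,\big(\rho^{2j}p_{k-2j}(x_n,\rho)\big)\,R_{k,j}(x''),$$ where $R_{k,j}$ is a homogeneous polynomial in $x''$ of degree $d=\ell-k$ (possibly $0$). In particular $u$ is a finite sum of terms $w_{0,s}(x_n,x_{n+1})\,P_k(x_n,\rho)\,P_d(x'')$ with $P_k$, $P_d$ homogeneous of degrees $k$, $d$ and $k+d=\ell$. -/

import Mathlib

open Filter Topology

noncomputable section

namespace MixedDN

/-- Points `x = (x'', x_n, x_{n+1})` of `ℝ^{n+1}`, where `n = d + 1`, so that `x'' ∈ ℝ^d = ℝ^{n-1}`.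
The first `d` coordinates form `x''`, the coordinate with index `d` is `x_n`, and the last one, with
index `d + 1`, is `x_{n+1}`. No norm of this space is used. -/
abbrev Pt (d : ℕ) : Type := Fin (d + 2) → ℝ

/-- The tangential coordinates `x'' ∈ ℝ^{n-1}`. -/
def tang {d : ℕ} (x : Pt d) : Fin d → ℝ := fun i => x i.castSucc.castSucc

/-- The coordinate `x_n`. -/
def xn {d : ℕ} (x : Pt d) : ℝ := x (Fin.last d).castSucc

/-- The coordinate `x_{n+1}`. -/
def xlast {d : ℕ} (x : Pt d) : ℝ := x (Fin.last (d + 1))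

/-- `|(x_n, x_{n+1})|`, the Euclidean distance to the edge `{x_n = x_{n+1} = 0}`. -/
def rad {d : ℕ} (x : Pt d) : ℝ := Real.sqrt (xn x ^ 2 + xlast x ^ 2)

/-- The closed upper half-space `{x_{n+1} ≥ 0}`. -/
def closedHalf (d : ℕ) : Set (Pt d) := {x | 0 ≤ xlast x}

/-- The open upper half-space `{x_{n+1} > 0}`. -/
def openHalf (d : ℕ) : Set (Pt d) := {x | 0 < xlast x}

/-- The partial derivative `∂_i f`. -/
def pd {d : ℕ} (i : Fin (d + 2)) (f : Pt d → ℝ) (x : Pt d) : ℝ :=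
  fderiv ℝ f x (Pi.single i 1)

/-- The operator `L_s u = ∇ · (x_{n+1}^{1-2s} ∇ u)`. -/
def Ls {d : ℕ} (s : ℝ) (u : Pt d → ℝ) (x : Pt d) : ℝ :=
  ∑ i : Fin (d + 2), pd i (fun z => xlast z ^ (1 - 2 * s) * pd i u z) x

/-- `u` solves the mixed Dirichlet-Neumann problem in the upper half-space: it is `C^2` in the open
half-space, continuous up to the boundary, satisfies `L_s u = 0`, vanishes at the boundary points
with `x_n ≤ 0`, and has vanishing weighted normal derivative at the boundary points with `x_n > 0`.
Only the values of `u` on the closed half-space matter. -/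
structure IsMixedSolution {d : ℕ} (s : ℝ) (u : Pt d → ℝ) : Prop where
  continuousOn : ContinuousOn u (closedHalf d)
  contDiffOn : ContDiffOn ℝ 2 u (openHalf d)
  equation : ∀ x ∈ openHalf d, Ls s u x = 0
  dirichlet : ∀ x : Pt d, xlast x = 0 → xn x ≤ 0 → u x = 0
  neumann : ∀ x : Pt d, xlast x = 0 → 0 < xn x →
    Tendsto (fun t : ℝ => t ^ (1 - 2 * s) *
        pd (Fin.last (d + 1)) u (Function.update x (Fin.last (d + 1)) t))
      (𝓝[>] 0) (𝓝 0)

/-- `u` is a `κ`-homogeneous function on the closed half-space. -/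
def IsHomogeneousHalf {d : ℕ} (κ : ℝ) (u : Pt d → ℝ) : Prop :=
  ∀ x ∈ closedHalf d, ∀ c : ℝ, 0 < c → u (c • x) = c ^ κ * u x

/-- The model function `w_{0,s}(x_n, x_{n+1}) = (|(x_n, x_{n+1})| + x_n)^s`. -/
def w0 {d : ℕ} (s : ℝ) (x : Pt d) : ℝ := (rad x + xn x) ^ s

/-- The two-dimensional homogeneous solution of order `m + s`,
`u_m = ρ^m ((ρ + x_n) / 2)^s F(-m, m + 1, 1 + s; (x_n / ρ + 1) / 2)` with `ρ = |(x_n, x_{n+1})|`. -/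
def um {d : ℕ} (s : ℝ) (m : ℕ) (x : Pt d) : ℝ :=
  rad x ^ m * ((rad x + xn x) / 2) ^ s *
    ordinaryHypergeometric (-(m : ℝ)) ((m : ℝ) + 1) (1 + s) ((xn x / rad x + 1) / 2)

/-- The Laplacian of a polynomial in the variables `x''`. -/
def polyLaplacian {d : ℕ} (P : MvPolynomial (Fin d) ℝ) : MvPolynomial (Fin d) ℝ :=
  ∑ i : Fin d, MvPolynomial.pderiv i (MvPolynomial.pderiv i P)

end MixedDN

end

namespace MixedDN

variable {d : ℕ}

/-! The problem is invariant under tangential translations, so a tangential difference of a solution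
is again a solution. A reflection argument with an explicit barrier (`tang_lipschitz`) shows that at
scale `R` such a difference is smaller than the solution by a factor of order `1 / R`. Enough
differences of a homogeneous solution therefore grow like a negative power of `R` and vanish, and a
continuous function with this property is polynomial in `x''`. This Liouville step
(`exists_tangential_expansion`) rests on the maximum principle alone.

Thus `u = ∑ x''^β c_β(x_n, x_{n+1})`. The `c_β` inherit the boundary conditions and are homogeneous
of order `κ - |β|`. The equation couples `c_β` only to coefficients of degree `|β| + 2`, so the
nonzero ones of top degree are planar homogeneous solutions. In polar form these are `ρ^μ G(z)` with
`z = (x_n / ρ + 1) / 2`, where `G` solves an equation of hypergeometric type with parameter `μ (μ +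
1 - 2s)`. Testing it against `z^(s+j)` gives a two-term recursion for the moments of `G`
(`IsAngular.moment_rec`). All moments vanish, and so does `G` by the Weierstrass theorem, unless the
parameter is `(s + m)(m + 1 - s)` for some `m`; in that case `G` is a multiple of the angular part
of `u_m`. Hence `μ = s + m` (`planar_classification`), which restricts `κ` to `s + ℓ`.

For the shape of `u`, the identity `Lop (ρ^(2k+2) u_m) = (2k+2)(2m+2k+3) ρ^(2k) u_m`
(`Lop_blk_succ`) lets any homogeneous polynomial `T(x'')` be completed by lower-degree terms to a
solution with leading term `T u_m`. Subtracting such solutions lowers the tangential degree, and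
induction finishes (`exists_family_of_degree_lt`). Conversely, the recursion makes the explicit sums
telescope under `Lop` (`Lop_stack`). -/

/-- The operator `u ↦ Δ u + (1 - 2s) / x_{n+1} ∂_{n+1} u`. -/
noncomputable def Lop (s : ℝ) (u : Pt d → ℝ) (x : Pt d) : ℝ :=
  ∑ i : Fin (d + 2), pd i (pd i u) x + (1 - 2 * s) / xlast x * pd (Fin.last (d + 1)) u x

/-- The inner product of the gradients of two functions. -/
noncomputable def grd (f g : Pt d → ℝ) (x : Pt d) : ℝ :=
  ∑ i : Fin (d + 2), pd i f x * pd i g x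

/-! ### First derivatives -/

lemma pd_congr {f g : Pt d → ℝ} {x : Pt d} (h : f =ᶠ[𝓝 x] g) (i : Fin (d + 2)) :
    pd i f x = pd i g x := by
  simp only [pd, h.fderiv_eq]

lemma pd_congr_eventually {f g : Pt d → ℝ} {x : Pt d} (h : f =ᶠ[𝓝 x] g) (i : Fin (d + 2)) :
    pd i f =ᶠ[𝓝 x] pd i g := by
  filter_upwards [h.eventuallyEq_nhds] with y hy using pd_congr hy i

lemma pd_const (c : ℝ) (i : Fin (d + 2)) (x : Pt d) : pd i (fun _ => c) x = 0 := by
  simp [pd]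

lemma pd_add {f g : Pt d → ℝ} {x : Pt d} (hf : DifferentiableAt ℝ f x)
    (hg : DifferentiableAt ℝ g x) (i : Fin (d + 2)) :
    pd i (fun z => f z + g z) x = pd i f x + pd i g x := by
  simp [pd, fderiv_fun_add hf hg]

lemma pd_mul {f g : Pt d → ℝ} {x : Pt d} (hf : DifferentiableAt ℝ f x)
    (hg : DifferentiableAt ℝ g x) (i : Fin (d + 2)) :
    pd i (fun z => f z * g z) x = f x * pd i g x + g x * pd i f x := by
  simp [pd, fderiv_fun_mul hf hg]

lemma pd_const_mul {f : Pt d → ℝ} {x : Pt d} (hf : DifferentiableAt ℝ f x) (c : ℝ)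
    (i : Fin (d + 2)) : pd i (fun z => c * f z) x = c * pd i f x := by
  rw [pd_mul (differentiableAt_const c) hf, pd_const]; ring

lemma pd_comp {G : ℝ → ℝ} {f : Pt d → ℝ} {x : Pt d} (hG : DifferentiableAt ℝ G (f x))
    (hf : DifferentiableAt ℝ f x) (i : Fin (d + 2)) :
    pd i (fun z => G (f z)) x = deriv G (f x) * pd i f x := by
  have h := hG.hasDerivAt.comp_hasFDerivAt x hf.hasFDerivAt
  have h2 : fderiv ℝ (fun z => G (f z)) x = deriv G (f x) • fderiv ℝ f x := h.fderiv
  simp [pd, h2]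

lemma pd_coord (i j : Fin (d + 2)) (x : Pt d) :
    pd i (fun z : Pt d => z j) x = if i = j then 1 else 0 := by
  have h : HasFDerivAt (fun z : Pt d => z j) (ContinuousLinearMap.proj (R := ℝ) j) x :=
    (ContinuousLinearMap.proj (R := ℝ) (φ := fun _ : Fin (d + 2) => ℝ) j).hasFDerivAt
  simp [pd, h.fderiv, Pi.single_apply, eq_comm]

lemma contDiffAt_pd {f : Pt d → ℝ} {x : Pt d} (hf : ContDiffAt ℝ 2 f x) (i : Fin (d + 2)) :
    ContDiffAt ℝ 1 (pd i f) x :=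
  (hf.fderiv_right (m := 1) (by norm_num)).clm_apply contDiffAt_const

lemma differentiableAt_pd {f : Pt d → ℝ} {x : Pt d} (hf : ContDiffAt ℝ 2 f x)
    (i : Fin (d + 2)) : DifferentiableAt ℝ (pd i f) x :=
  (contDiffAt_pd hf i).differentiableAt (by norm_num)

lemma eventually_contDiffAt {f : Pt d → ℝ} {x : Pt d} (hf : ContDiffAt ℝ 2 f x) :
    ∀ᶠ z in 𝓝 x, ContDiffAt ℝ 2 f z := hf.eventually (by simp)

lemma eventually_differentiableAt {f : Pt d → ℝ} {x : Pt d} (hf : ContDiffAt ℝ 2 f x) :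
    ∀ᶠ z in 𝓝 x, DifferentiableAt ℝ f z := by
  filter_upwards [eventually_contDiffAt hf] with z hz using hz.differentiableAt (by norm_num)

lemma differentiableAt_of_contDiffAt {f : Pt d → ℝ} {x : Pt d} (hf : ContDiffAt ℝ 2 f x) :
    DifferentiableAt ℝ f x := hf.differentiableAt (by norm_num)

/-! ### Second derivatives -/

lemma pd_pd_add {f g : Pt d → ℝ} {x : Pt d} (hf : ContDiffAt ℝ 2 f x)
    (hg : ContDiffAt ℝ 2 g x) (i : Fin (d + 2)) :
    pd i (pd i (fun z => f z + g z)) x = pd i (pd i f) x + pd i (pd i g) x := by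
  have h : pd i (fun z => f z + g z) =ᶠ[𝓝 x] fun z => pd i f z + pd i g z := by
    filter_upwards [eventually_differentiableAt hf, eventually_differentiableAt hg] with z h1 h2
      using pd_add h1 h2 i
  rw [pd_congr h, pd_add (differentiableAt_pd hf i) (differentiableAt_pd hg i)]

lemma pd_pd_mul {f g : Pt d → ℝ} {x : Pt d} (hf : ContDiffAt ℝ 2 f x)
    (hg : ContDiffAt ℝ 2 g x) (i : Fin (d + 2)) :
    pd i (pd i (fun z => f z * g z)) x =
      f x * pd i (pd i g) x + g x * pd i (pd i f) x + 2 * (pd i f x * pd i g x) := by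
  have h : pd i (fun z => f z * g z) =ᶠ[𝓝 x] fun z => f z * pd i g z + g z * pd i f z := by
    filter_upwards [eventually_differentiableAt hf, eventually_differentiableAt hg] with z h1 h2
      using pd_mul h1 h2 i
  have hf' := differentiableAt_of_contDiffAt hf
  have hg' := differentiableAt_of_contDiffAt hg
  have hpf := differentiableAt_pd hf i
  have hpg := differentiableAt_pd hg i
  rw [pd_congr h, pd_add (hf'.fun_mul hpg) (hg'.fun_mul hpf), pd_mul hf' hpg, pd_mul hg' hpf]
  ring

lemma pd_pd_comp {G : ℝ → ℝ} {f : Pt d → ℝ} {x : Pt d} (hG : ContDiffAt ℝ 2 G (f x))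
    (hf : ContDiffAt ℝ 2 f x) (i : Fin (d + 2)) :
    pd i (pd i (fun z => G (f z))) x =
      deriv (deriv G) (f x) * (pd i f x * pd i f x) + deriv G (f x) * pd i (pd i f) x := by
  have hf' := differentiableAt_of_contDiffAt hf
  have hev : ∀ᶠ r in 𝓝 (f x), DifferentiableAt ℝ G r := by
    filter_upwards [hG.eventually (by simp)] with r hr using hr.differentiableAt (by norm_num)
  have h : pd i (fun z => G (f z)) =ᶠ[𝓝 x] fun z => deriv G (f z) * pd i f z := by
    filter_upwards [hf'.continuousAt.eventually hev, eventually_differentiableAt hf] with z h1 h2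
      using pd_comp h1 h2 i
  have hdG : DifferentiableAt ℝ (deriv G) (f x) := by
    have h1 : ContDiffAt ℝ 1 (fun r => fderiv ℝ G r 1) (f x) :=
      (hG.fderiv_right (m := 1) (by norm_num)).clm_apply contDiffAt_const
    simp only [fderiv_apply_one_eq_deriv] at h1
    exact h1.differentiableAt (by norm_num)
  have hc : DifferentiableAt ℝ (fun z => deriv G (f z)) x := hdG.comp x hf'
  rw [pd_congr h, pd_mul hc (differentiableAt_pd hf i), pd_comp hdG hf']
  ring

/-! ### The operator `Lop` -/

lemma Lop_congr {s : ℝ} {f g : Pt d → ℝ} {x : Pt d} (h : f =ᶠ[𝓝 x] g) :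
    Lop s f x = Lop s g x := by
  simp only [Lop, pd_congr h, pd_congr (pd_congr_eventually h _)]

lemma Lop_const (s c : ℝ) (x : Pt d) : Lop s (fun _ => c) x = 0 := by
  have h : ∀ i, pd i (fun _ : Pt d => c) = fun _ => 0 := fun i => funext fun z => pd_const c i z
  simp [Lop, h, pd_const]

lemma Lop_add {s : ℝ} {f g : Pt d → ℝ} {x : Pt d} (hf : ContDiffAt ℝ 2 f x)
    (hg : ContDiffAt ℝ 2 g x) :
    Lop s (fun z => f z + g z) x = Lop s f x + Lop s g x := by
  simp only [Lop, pd_pd_add hf hg, Finset.sum_add_distrib,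
    pd_add (differentiableAt_of_contDiffAt hf) (differentiableAt_of_contDiffAt hg)]
  ring

lemma Lop_mul {s : ℝ} {f g : Pt d → ℝ} {x : Pt d} (hf : ContDiffAt ℝ 2 f x)
    (hg : ContDiffAt ℝ 2 g x) :
    Lop s (fun z => f z * g z) x = f x * Lop s g x + g x * Lop s f x + 2 * grd f g x := by
  simp only [Lop, grd, pd_pd_mul hf hg, Finset.sum_add_distrib, ← Finset.mul_sum,
    pd_mul (differentiableAt_of_contDiffAt hf) (differentiableAt_of_contDiffAt hg)]
  ring

lemma grd_const_left (c : ℝ) (g : Pt d → ℝ) (x : Pt d) : grd (fun _ => c) g x = 0 := by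
  simp [grd, pd_const]

lemma Lop_const_mul {s : ℝ} {f : Pt d → ℝ} {x : Pt d} (hf : ContDiffAt ℝ 2 f x) (c : ℝ) :
    Lop s (fun z => c * f z) x = c * Lop s f x := by
  rw [Lop_mul contDiffAt_const hf, Lop_const, grd_const_left]; ring

lemma Lop_sub {s : ℝ} {f g : Pt d → ℝ} {x : Pt d} (hf : ContDiffAt ℝ 2 f x)
    (hg : ContDiffAt ℝ 2 g x) :
    Lop s (fun z => f z - g z) x = Lop s f x - Lop s g x := by
  have h : (fun z => f z - g z) = fun z => f z + (-1) * g z := by funext z; ring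
  rw [h, Lop_add hf (contDiffAt_const.mul hg), Lop_const_mul hg]; ring

lemma Lop_sum {ι : Type*} {s : ℝ} (S : Finset ι) {f : ι → Pt d → ℝ} {x : Pt d}
    (hf : ∀ i ∈ S, ContDiffAt ℝ 2 (f i) x) :
    Lop s (fun z => ∑ i ∈ S, f i z) x = ∑ i ∈ S, Lop s (f i) x := by
  classical
  induction S using Finset.induction_on with
  | empty => simp [Lop_const]
  | insert a S ha ih =>
    simp only [Finset.sum_insert ha]
    rw [Lop_add (hf a (by simp)) (ContDiffAt.sum fun i hi => hf i (by simp [hi])),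
      ih fun i hi => hf i (by simp [hi])]

lemma Lop_comp {s : ℝ} {G : ℝ → ℝ} {f : Pt d → ℝ} {x : Pt d} (hG : ContDiffAt ℝ 2 G (f x))
    (hf : ContDiffAt ℝ 2 f x) :
    Lop s (fun z => G (f z)) x = deriv (deriv G) (f x) * grd f f x + deriv G (f x) * Lop s f x := by
  simp only [Lop, grd, pd_pd_comp hG hf, Finset.sum_add_distrib, ← Finset.mul_sum,
    pd_comp (hG.differentiableAt (by norm_num)) (differentiableAt_of_contDiffAt hf)]
  ring

/-! ### Products of gradients -/

lemma grd_comm (f g : Pt d → ℝ) (x : Pt d) : grd f g x = grd g f x := by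
  simp only [grd, mul_comm]

lemma grd_mul_left {f g h : Pt d → ℝ} {x : Pt d} (hf : DifferentiableAt ℝ f x)
    (hg : DifferentiableAt ℝ g x) :
    grd (fun z => f z * g z) h x = f x * grd g h x + g x * grd f h x := by
  simp only [grd, pd_mul hf hg, Finset.mul_sum, ← Finset.sum_add_distrib]
  exact Finset.sum_congr rfl fun i _ => by ring

lemma grd_add_left {f g h : Pt d → ℝ} {x : Pt d} (hf : DifferentiableAt ℝ f x)
    (hg : DifferentiableAt ℝ g x) :
    grd (fun z => f z + g z) h x = grd f h x + grd g h x := by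
  simp only [grd, pd_add hf hg, ← Finset.sum_add_distrib]
  exact Finset.sum_congr rfl fun i _ => by ring

lemma grd_comp_left {G : ℝ → ℝ} {f h : Pt d → ℝ} {x : Pt d} (hG : DifferentiableAt ℝ G (f x))
    (hf : DifferentiableAt ℝ f x) :
    grd (fun z => G (f z)) h x = deriv G (f x) * grd f h x := by
  simp only [grd, pd_comp hG hf, Finset.mul_sum]
  exact Finset.sum_congr rfl fun i _ => by ring

lemma grd_coord (i j : Fin (d + 2)) (x : Pt d) :
    grd (fun z => z i) (fun z => z j) x = if i = j then 1 else 0 := by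
  simp [grd, pd_coord, eq_comm]

lemma Lop_coord (s : ℝ) (j : Fin (d + 2)) (x : Pt d) :
    Lop s (fun z => z j) x = if Fin.last (d + 1) = j then (1 - 2 * s) / xlast x else 0 := by
  have h : ∀ i, pd i (fun z : Pt d => z j) = fun _ => if i = j then 1 else 0 :=
    fun i => funext fun z => pd_coord i j z
  simp [Lop, h, pd_const]

/-! ### The half-spaces and the passage from `Ls` to `Lop`. -/

lemma isOpen_openHalf : IsOpen (openHalf d) :=
  isOpen_lt continuous_const (continuous_apply _)

lemma openHalf_subset_closedHalf : openHalf d ⊆ closedHalf d :=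
  fun x (hx : 0 < xlast x) => hx.le

lemma contDiff_coord (j : Fin (d + 2)) : ContDiff ℝ 2 (fun z : Pt d => z j) := contDiff_apply ℝ ℝ j

/-- The weight depends on `x_{n+1}` alone, so differentiating it only adds the first-order term in
that direction. Since the weight is positive in the open half-space, the equation may be studied in
the non-divergence form `Lop`. -/
lemma Ls_eq {s : ℝ} {u : Pt d → ℝ} {x : Pt d} (hx : x ∈ openHalf d) (hu : ContDiffAt ℝ 2 u x) :
    Ls s u x = xlast x ^ (1 - 2 * s) * Lop s u x := by
  have hx0 : 0 < xlast x := hx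
  have hd : HasDerivAt (fun r : ℝ => r ^ (1 - 2 * s))
      ((1 - 2 * s) * xlast x ^ (1 - 2 * s - 1)) (xlast x) :=
    Real.hasDerivAt_rpow_const (Or.inl hx0.ne')
  have hl : DifferentiableAt ℝ (xlast : Pt d → ℝ) x :=
    (contDiff_coord (Fin.last (d + 1))).differentiable (by norm_num) x
  have hp : ∀ i, pd i (fun z : Pt d => xlast z ^ (1 - 2 * s)) x =
      (1 - 2 * s) * xlast x ^ (1 - 2 * s - 1) * if i = Fin.last (d + 1) then 1 else 0 := by
    intro i
    rw [pd_comp (G := fun r : ℝ => r ^ (1 - 2 * s)) hd.differentiableAt hl, hd.deriv]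
    congr 1
    exact pd_coord i _ x
  have hw : DifferentiableAt ℝ (fun z : Pt d => xlast z ^ (1 - 2 * s)) x :=
    DifferentiableAt.comp (g := fun r : ℝ => r ^ (1 - 2 * s)) x hd.differentiableAt hl
  simp only [Ls, pd_mul hw (differentiableAt_pd hu _), hp, Finset.sum_add_distrib,
    ← Finset.mul_sum, Lop]
  simp only [mul_ite, mul_one, mul_zero, Finset.sum_ite_eq', Finset.mem_univ, if_true]
  rw [Real.rpow_sub_one hx0.ne']
  field_simp

/-! ### Coordinates -/

/-- The point with coordinates `x'' = a`, `x_n = p`, `x_{n+1} = q`. -/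
noncomputable def mkPt (a : Fin d → ℝ) (p q : ℝ) : Pt d :=
  Fin.snoc (α := fun _ => ℝ) (Fin.snoc (α := fun _ => ℝ) a p) q

@[simp] lemma tang_mkPt (a : Fin d → ℝ) (p q : ℝ) : tang (mkPt a p q) = a := by
  funext i; simp [tang, mkPt]

@[simp] lemma xn_mkPt (a : Fin d → ℝ) (p q : ℝ) : xn (mkPt a p q) = p := by
  simp [xn, mkPt]

@[simp] lemma xlast_mkPt (a : Fin d → ℝ) (p q : ℝ) : xlast (mkPt a p q) = q := by
  simp [xlast, mkPt]

lemma pt_ext {x y : Pt d} (h1 : tang x = tang y) (h2 : xn x = xn y) (h3 : xlast x = xlast y) :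
    x = y := by
  funext j
  refine Fin.lastCases h3 (fun j => ?_) j
  exact Fin.lastCases h2 (fun j => congrFun h1 j) j

@[simp] lemma tang_smul (c : ℝ) (x : Pt d) : tang (c • x) = c • tang x := rfl
@[simp] lemma xn_smul (c : ℝ) (x : Pt d) : xn (c • x) = c * xn x := rfl
@[simp] lemma xlast_smul (c : ℝ) (x : Pt d) : xlast (c • x) = c * xlast x := rfl

@[simp] lemma tang_update_last (x : Pt d) (t : ℝ) :
    tang (Function.update x (Fin.last (d + 1)) t) = tang x := by
  funext i; simp [tang]

@[simp] lemma xn_update_last (x : Pt d) (t : ℝ) :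
    xn (Function.update x (Fin.last (d + 1)) t) = xn x := by
  simp [xn]

@[simp] lemma xlast_update_last (x : Pt d) (t : ℝ) :
    xlast (Function.update x (Fin.last (d + 1)) t) = t := by
  simp [xlast]

lemma rad_smul {c : ℝ} (hc : 0 ≤ c) (x : Pt d) : rad (c • x) = c * rad x := by
  rw [rad, rad, xn_smul, xlast_smul, ← Real.sqrt_sq hc, ← Real.sqrt_mul (sq_nonneg c),
    Real.sqrt_sq hc]
  ring_nf

lemma rad_nonneg (x : Pt d) : 0 ≤ rad x := Real.sqrt_nonneg _

lemma rad_sq (x : Pt d) : rad x ^ 2 = xn x ^ 2 + xlast x ^ 2 := Real.sq_sqrt (by positivity)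

lemma rad_pos {x : Pt d} (hx : x ∈ openHalf d) : 0 < rad x :=
  Real.sqrt_pos.2 (by have : 0 < xlast x := hx; positivity)

lemma neg_xn_le_rad (x : Pt d) : -xn x ≤ rad x :=
  Real.le_sqrt_of_sq_le (by nlinarith [sq_nonneg (xlast x)])

lemma xn_le_rad (x : Pt d) : xn x ≤ rad x :=
  Real.le_sqrt_of_sq_le (by nlinarith [sq_nonneg (xlast x)])

lemma continuous_xn : Continuous (xn : Pt d → ℝ) := continuous_apply _

lemma continuous_xlast : Continuous (xlast : Pt d → ℝ) := continuous_apply _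

lemma continuous_rad : Continuous (rad : Pt d → ℝ) :=
  ((continuous_xn.pow 2).add (continuous_xlast.pow 2)).sqrt

lemma contDiff_xn : ContDiff ℝ 2 (xn : Pt d → ℝ) := contDiff_coord _

lemma contDiff_xlast : ContDiff ℝ 2 (xlast : Pt d → ℝ) := contDiff_coord _

lemma contDiffAt_rad {x : Pt d} (hx : 0 < rad x) : ContDiffAt ℝ 2 (rad : Pt d → ℝ) x :=
  ((contDiff_xn.pow 2).add (contDiff_xlast.pow 2)).contDiffAt.sqrt (Real.sqrt_pos.1 hx).ne'

lemma sum_coord (f : Fin (d + 2) → ℝ) :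
    ∑ i, f i = ∑ i : Fin d, f i.castSucc.castSucc + f (Fin.last d).castSucc +
      f (Fin.last (d + 1)) := by
  rw [Fin.sum_univ_castSucc, Fin.sum_univ_castSucc]

/-! ### Tangential affine maps -/

/-- The map `x_i ↦ e_i x_i + c_i` in the tangential coordinates. -/
noncomputable def diag (e c : Fin d → ℝ) (x : Pt d) : Pt d := mkPt e 1 1 * x + mkPt c 0 0

lemma tang_diag (e c : Fin d → ℝ) (x : Pt d) : tang (diag e c x) = fun i => e i * tang x i + c i := by
  funext i
  have h1 := congrFun (tang_mkPt e 1 1) i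
  have h2 := congrFun (tang_mkPt c 0 0) i
  simp only [tang] at h1 h2
  simp [diag, tang, h1, h2]

@[simp] lemma xn_diag (e c : Fin d → ℝ) (x : Pt d) : xn (diag e c x) = xn x := by
  have h1 := xn_mkPt e 1 1
  have h2 := xn_mkPt c 0 0
  simp only [xn] at h1 h2
  simp [diag, xn, h1, h2]

@[simp] lemma xlast_diag (e c : Fin d → ℝ) (x : Pt d) : xlast (diag e c x) = xlast x := by
  have h1 := xlast_mkPt e 1 1
  have h2 := xlast_mkPt c 0 0
  simp only [xlast] at h1 h2
  simp [diag, xlast, h1, h2]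

lemma diag_mem_openHalf {e c : Fin d → ℝ} {x : Pt d} (hx : x ∈ openHalf d) :
    diag e c x ∈ openHalf d := by
  change 0 < xlast _
  rw [xlast_diag]; exact hx

lemma diag_mem_closedHalf {e c : Fin d → ℝ} {x : Pt d} (hx : x ∈ closedHalf d) :
    diag e c x ∈ closedHalf d := by
  change 0 ≤ xlast _
  rw [xlast_diag]; exact hx

lemma contDiff_diag (e c : Fin d → ℝ) : ContDiff ℝ 2 (diag e c) :=
  (contDiff_const.mul contDiff_id).add contDiff_const

lemma diag_update_last (e c : Fin d → ℝ) (x : Pt d) (t : ℝ) :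
    diag e c (Function.update x (Fin.last (d + 1)) t) =
      Function.update (diag e c x) (Fin.last (d + 1)) t := by
  apply pt_ext <;> simp [tang_diag]

lemma pd_diag {u : Pt d → ℝ} {e c : Fin d → ℝ} {x : Pt d}
    (hu : DifferentiableAt ℝ u (diag e c x)) (j : Fin (d + 2)) :
    pd j (fun z => u (diag e c z)) x = mkPt e 1 1 j * pd j u (diag e c x) := by
  have hA : HasFDerivAt (diag e c) (ContinuousLinearMap.mul ℝ (Pt d) (mkPt e 1 1)) x :=
    (ContinuousLinearMap.mul ℝ (Pt d) (mkPt e 1 1)).hasFDerivAt.add_const _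
  have h : fderiv ℝ (fun z => u (diag e c z)) x = _ := (hu.hasFDerivAt.comp x hA).fderiv
  have h2 : mkPt e 1 1 * Pi.single j 1 = mkPt e 1 1 j • (Pi.single j 1 : Pt d) := by
    funext k
    by_cases hk : k = j
    · subst hk; simp
    · simp [hk]
  simp [pd, h, h2]

lemma pd_pd_diag {u : Pt d → ℝ} {e c : Fin d → ℝ} {x : Pt d}
    (hu : ContDiffAt ℝ 2 u (diag e c x)) (j : Fin (d + 2)) :
    pd j (pd j (fun z => u (diag e c z))) x =
      mkPt e 1 1 j ^ 2 * pd j (pd j u) (diag e c x) := by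
  have h : pd j (fun z => u (diag e c z)) =ᶠ[𝓝 x]
      fun z => mkPt e 1 1 j * pd j u (diag e c z) := by
    filter_upwards [(contDiff_diag e c).continuous.continuousAt.eventually
      (eventually_differentiableAt hu)] with z hz using pd_diag hz j
  have hd := differentiableAt_pd hu j
  have hd' : DifferentiableAt ℝ (fun z => pd j u (diag e c z)) x :=
    hd.comp x ((contDiff_diag e c).differentiable (by norm_num) x)
  rw [pd_congr h, pd_const_mul hd', pd_diag hd]
  ring

/-- Second tangential derivatives see only `e_i ^ 2`, and the last two coordinates are untouched.
Translations and coordinate reflections in `x''` therefore preserve the equation. -/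
lemma Lop_diag {s : ℝ} {u : Pt d → ℝ} {e c : Fin d → ℝ} (he : ∀ i, e i ^ 2 = 1) {x : Pt d}
    (hu : ContDiffAt ℝ 2 u (diag e c x)) :
    Lop s (fun z => u (diag e c z)) x = Lop s u (diag e c x) := by
  have h : ∀ j, mkPt e 1 1 j ^ 2 = 1 := by
    intro j
    refine Fin.lastCases ?_ (fun j => ?_) j
    · exact (congrArg (· ^ 2) (xlast_mkPt e 1 1)).trans (one_pow 2)
    · refine Fin.lastCases ?_ (fun j => ?_) j
      · exact (congrArg (· ^ 2) (xn_mkPt e 1 1)).trans (one_pow 2)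
      · exact (congrArg (· ^ 2) (congrFun (tang_mkPt e 1 1) j)).trans (he j)
  have h1 : mkPt e 1 1 (Fin.last (d + 1)) = 1 := xlast_mkPt e 1 1
  simp only [Lop, pd_pd_diag hu, pd_diag (differentiableAt_of_contDiffAt hu), h, h1, xlast_diag,
    one_mul]

/-- `f` does not depend on the tangential variables. -/
def TangIndep (f : Pt d → ℝ) : Prop := ∀ x y : Pt d, xn x = xn y → xlast x = xlast y → f x = f y

/-- Such an `f` equals its composition with the map freezing `x''`, that is `diag` with `e = 0`, and
the chain rule then produces the factor `0`. -/
lemma TangIndep.pd_eq_zero {f : Pt d → ℝ} (hf : TangIndep f) {x : Pt d}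
    (hd : DifferentiableAt ℝ f x) (i : Fin d) : pd i.castSucc.castSucc f x = 0 := by
  have h : f = fun z => f (diag 0 (tang x) z) := by
    funext z; exact hf _ _ (by simp) (by simp)
  have hx : diag 0 (tang x) x = x := pt_ext (by simp [tang_diag]) (by simp) (by simp)
  rw [h, pd_diag (by rwa [hx])]
  have h1 : mkPt (0 : Fin d → ℝ) 1 1 i.castSucc.castSucc = 0 := congrFun (tang_mkPt 0 1 1) i
  rw [h1, zero_mul]

/-! ### Polynomials in the tangential variables -/

lemma contDiff_tang_eval (P : MvPolynomial (Fin d) ℝ) :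
    ContDiff ℝ 2 fun x : Pt d => MvPolynomial.eval (tang x) P := by
  induction P using MvPolynomial.induction_on with
  | C a => simpa using contDiff_const
  | add p q hp hq => simpa using hp.add hq
  | mul_X p i hp => simpa [tang] using hp.mul (contDiff_coord i.castSucc.castSucc)

lemma continuous_tang_eval (P : MvPolynomial (Fin d) ℝ) :
    Continuous fun x : Pt d => MvPolynomial.eval (tang x) P := (contDiff_tang_eval P).continuous

lemma differentiable_tang_eval (P : MvPolynomial (Fin d) ℝ) :
    Differentiable ℝ fun x : Pt d => MvPolynomial.eval (tang x) P :=
  (contDiff_tang_eval P).differentiable (by norm_num)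

lemma pd_tang_eval (P : MvPolynomial (Fin d) ℝ) (i : Fin d) (x : Pt d) :
    pd i.castSucc.castSucc (fun z : Pt d => MvPolynomial.eval (tang z) P) x =
      MvPolynomial.eval (tang x) (MvPolynomial.pderiv i P) := by
  induction P using MvPolynomial.induction_on with
  | C a => simpa using pd_const _ _ _
  | add p q hp hq =>
    simp only [map_add, ← hp, ← hq]
    exact pd_add (differentiable_tang_eval p x) (differentiable_tang_eval q x) _
  | mul_X p j hp =>
    have h := pd_mul (differentiable_tang_eval p x)
      ((contDiff_coord j.castSucc.castSucc).differentiable (by norm_num) x) i.castSucc.castSucc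
    have h2 : (fun z : Pt d => MvPolynomial.eval (tang z) (p * MvPolynomial.X j)) =
        fun z => MvPolynomial.eval (tang z) p * z j.castSucc.castSucc := by
      funext z; simp [tang]
    rw [h2, h, hp, pd_coord]
    simp only [Derivation.leibniz, MvPolynomial.pderiv_X, smul_eq_mul, map_add, map_mul,
      MvPolynomial.eval_X]
    by_cases hij : i = j
    · subst hij; simp [tang]
    · simp [hij, tang, eq_comm]

lemma pd_tang_eval_of_ne (P : MvPolynomial (Fin d) ℝ) {j : Fin (d + 2)}
    (hj : ∀ i : Fin d, j ≠ i.castSucc.castSucc) (x : Pt d) :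
    pd j (fun z : Pt d => MvPolynomial.eval (tang z) P) x = 0 := by
  induction P using MvPolynomial.induction_on with
  | C a => simpa using pd_const _ _ _
  | add p q hp hq =>
    have h := pd_add (differentiable_tang_eval p x) (differentiable_tang_eval q x) j
    rw [hp, hq] at h
    simpa using h
  | mul_X p i hp =>
    have h := pd_mul (differentiable_tang_eval p x)
      ((contDiff_coord i.castSucc.castSucc).differentiable (by norm_num) x) j
    rw [hp, pd_coord, if_neg (hj i)] at h
    simpa [tang] using h

lemma pd_last_tang_eval (P : MvPolynomial (Fin d) ℝ) (x : Pt d) :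
    pd (Fin.last (d + 1)) (fun z : Pt d => MvPolynomial.eval (tang z) P) x = 0 :=
  pd_tang_eval_of_ne P (fun _ => (Fin.castSucc_lt_last _).ne') x

lemma pd_xn_tang_eval (P : MvPolynomial (Fin d) ℝ) (x : Pt d) :
    pd (Fin.last d).castSucc (fun z : Pt d => MvPolynomial.eval (tang z) P) x = 0 :=
  pd_tang_eval_of_ne P (fun i h => (Fin.castSucc_lt_last i).ne'
    (Fin.castSucc_injective _ h)) x

lemma Lop_tang_eval (s : ℝ) (P : MvPolynomial (Fin d) ℝ) (x : Pt d) :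
    Lop s (fun z : Pt d => MvPolynomial.eval (tang z) P) x =
      MvPolynomial.eval (tang x) (polyLaplacian P) := by
  have h1 : ∀ i : Fin d, pd i.castSucc.castSucc (fun z : Pt d => MvPolynomial.eval (tang z) P) =
      fun z => MvPolynomial.eval (tang z) (MvPolynomial.pderiv i P) :=
    fun i => funext fun z => pd_tang_eval P i z
  have h2 : pd (Fin.last (d + 1)) (fun z : Pt d => MvPolynomial.eval (tang z) P) = fun _ => 0 :=
    funext fun z => pd_last_tang_eval P z
  have h3 : pd (Fin.last d).castSucc (fun z : Pt d => MvPolynomial.eval (tang z) P) = fun _ => 0 :=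
    funext fun z => pd_xn_tang_eval P z
  rw [Lop, sum_coord, h2, h3]
  simp only [h1, pd_tang_eval, pd_const, polyLaplacian, map_sum]
  ring

/-- The two factors depend on complementary sets of variables, so their gradients are orthogonal and
the product rule has no cross term. -/
lemma Lop_tang_mul {s : ℝ} (P : MvPolynomial (Fin d) ℝ) {f : Pt d → ℝ} (hf : TangIndep f)
    {x : Pt d} (hd : ContDiffAt ℝ 2 f x) :
    Lop s (fun z => MvPolynomial.eval (tang z) P * f z) x =
      MvPolynomial.eval (tang x) P * Lop s f x +
        MvPolynomial.eval (tang x) (polyLaplacian P) * f x := by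
  have hg : grd (fun z : Pt d => MvPolynomial.eval (tang z) P) f x = 0 := by
    rw [grd, sum_coord, pd_last_tang_eval, pd_xn_tang_eval]
    simp [hf.pd_eq_zero (differentiableAt_of_contDiffAt hd)]
  rw [Lop_mul (contDiff_tang_eval P).contDiffAt hd, hg, Lop_tang_eval]
  ring

/-! ### Admissible functions -/

/-- The regularity and boundary conditions of a solution, without the equation. -/
structure IsAdmissible (s : ℝ) (u : Pt d → ℝ) : Prop where
  continuousOn : ContinuousOn u (closedHalf d)
  contDiffOn : ContDiffOn ℝ 2 u (openHalf d)
  dirichlet : ∀ x : Pt d, xlast x = 0 → xn x ≤ 0 → u x = 0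
  neumann : ∀ x : Pt d, xlast x = 0 → 0 < xn x →
    Tendsto (fun t : ℝ => t ^ (1 - 2 * s) *
        pd (Fin.last (d + 1)) u (Function.update x (Fin.last (d + 1)) t))
      (𝓝[>] 0) (𝓝 0)

lemma IsAdmissible.contDiffAt {s : ℝ} {u : Pt d → ℝ} (h : IsAdmissible s u) {x : Pt d}
    (hx : x ∈ openHalf d) : ContDiffAt ℝ 2 u x :=
  h.contDiffOn.contDiffAt (isOpen_openHalf.mem_nhds hx)

lemma isMixedSolution_iff {s : ℝ} {u : Pt d → ℝ} :
    IsMixedSolution s u ↔ IsAdmissible s u ∧ ∀ x ∈ openHalf d, Lop s u x = 0 := by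
  constructor
  · intro h
    have ha : IsAdmissible s u := ⟨h.continuousOn, h.contDiffOn, h.dirichlet, h.neumann⟩
    refine ⟨ha, fun x hx => ?_⟩
    have h1 := h.equation x hx
    rw [Ls_eq hx (ha.contDiffAt hx)] at h1
    exact (mul_eq_zero.1 h1).resolve_left (Real.rpow_pos_of_pos hx _).ne'
  · rintro ⟨h, he⟩
    exact ⟨h.continuousOn, h.contDiffOn,
      fun x hx => by rw [Ls_eq hx (h.contDiffAt hx), he x hx, mul_zero], h.dirichlet, h.neumann⟩

lemma update_last_mem_openHalf (x : Pt d) {t : ℝ} (ht : 0 < t) :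
    Function.update x (Fin.last (d + 1)) t ∈ openHalf d := by
  change 0 < xlast _
  rwa [xlast_update_last]

lemma IsAdmissible.congr {s : ℝ} {u v : Pt d → ℝ} (h : IsAdmissible s u)
    (huv : ∀ x ∈ closedHalf d, v x = u x) : IsAdmissible s v where
  continuousOn := h.continuousOn.congr huv
  contDiffOn := h.contDiffOn.congr fun x hx => huv x (openHalf_subset_closedHalf hx)
  dirichlet x hx hx' := (huv x hx.ge).trans (h.dirichlet x hx hx')
  neumann x hx hx' := by
    refine (h.neumann x hx hx').congr' ?_
    filter_upwards [self_mem_nhdsWithin] with t ht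
    congr 1
    refine pd_congr ?_ _
    filter_upwards [isOpen_openHalf.mem_nhds (update_last_mem_openHalf x ht)] with z hz
    exact (huv z (openHalf_subset_closedHalf hz)).symm

lemma IsAdmissible.zero (s : ℝ) : IsAdmissible s (fun _ : Pt d => (0 : ℝ)) where
  continuousOn := continuousOn_const
  contDiffOn := contDiffOn_const
  dirichlet _ _ _ := rfl
  neumann x _ _ := by simp [pd_const]

lemma IsAdmissible.add {s : ℝ} {u v : Pt d → ℝ} (hu : IsAdmissible s u) (hv : IsAdmissible s v) :
    IsAdmissible s (fun x => u x + v x) where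
  continuousOn := hu.continuousOn.add hv.continuousOn
  contDiffOn := hu.contDiffOn.add hv.contDiffOn
  dirichlet x h1 h2 := by rw [hu.dirichlet x h1 h2, hv.dirichlet x h1 h2, add_zero]
  neumann x h1 h2 := by
    have h := (hu.neumann x h1 h2).add (hv.neumann x h1 h2)
    rw [add_zero] at h
    refine h.congr' ?_
    filter_upwards [self_mem_nhdsWithin] with t ht
    have hm := update_last_mem_openHalf x ht
    rw [pd_add (differentiableAt_of_contDiffAt (hu.contDiffAt hm))
      (differentiableAt_of_contDiffAt (hv.contDiffAt hm)), mul_add]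

/-- The boundary conditions survive multiplication by polynomials in `x''`, while the equation does
not. This is the reason for separating `IsAdmissible` from the equation: individual terms of an
expansion are admissible before anything is known about their `Lop`. -/
lemma IsAdmissible.tang_mul {s : ℝ} {u : Pt d → ℝ} (hu : IsAdmissible s u)
    (P : MvPolynomial (Fin d) ℝ) : IsAdmissible s (fun x => MvPolynomial.eval (tang x) P * u x) where
  continuousOn := (continuous_tang_eval P).continuousOn.mul hu.continuousOn
  contDiffOn := (contDiff_tang_eval P).contDiffOn.mul hu.contDiffOn
  dirichlet x h1 h2 := by rw [hu.dirichlet x h1 h2, mul_zero]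
  neumann x h1 h2 := by
    have h := (hu.neumann x h1 h2).const_mul (MvPolynomial.eval (tang x) P)
    rw [mul_zero] at h
    refine h.congr' ?_
    filter_upwards [self_mem_nhdsWithin] with t ht
    have hm := update_last_mem_openHalf x ht
    rw [pd_mul (differentiable_tang_eval P _) (differentiableAt_of_contDiffAt (hu.contDiffAt hm)),
      pd_last_tang_eval, tang_update_last]
    ring

lemma IsAdmissible.const_mul {s : ℝ} {u : Pt d → ℝ} (hu : IsAdmissible s u) (c : ℝ) :
    IsAdmissible s (fun x => c * u x) := by
  simpa using hu.tang_mul (MvPolynomial.C c)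

lemma IsAdmissible.sub {s : ℝ} {u v : Pt d → ℝ} (hu : IsAdmissible s u) (hv : IsAdmissible s v) :
    IsAdmissible s (fun x => u x - v x) := by
  have h := hu.add (hv.const_mul (-1))
  simpa [sub_eq_add_neg] using h

lemma IsAdmissible.sum {ι : Type*} {s : ℝ} (S : Finset ι) {u : ι → Pt d → ℝ}
    (hu : ∀ i ∈ S, IsAdmissible s (u i)) : IsAdmissible s (fun x => ∑ i ∈ S, u i x) := by
  classical
  induction S using Finset.induction_on with
  | empty => simpa using IsAdmissible.zero s
  | insert a S ha ih =>
    simp only [Finset.sum_insert ha]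
    exact (hu a (by simp)).add (ih fun i hi => hu i (by simp [hi]))

lemma IsAdmissible.diag {s : ℝ} {u : Pt d → ℝ} (hu : IsAdmissible s u) (e c : Fin d → ℝ) :
    IsAdmissible s (fun x => u (diag e c x)) where
  continuousOn := hu.continuousOn.comp (contDiff_diag e c).continuous.continuousOn
    fun _ hx => diag_mem_closedHalf hx
  contDiffOn := hu.contDiffOn.comp (contDiff_diag e c).contDiffOn fun _ hx => diag_mem_openHalf hx
  dirichlet x h1 h2 := hu.dirichlet _ (by simpa) (by simpa)
  neumann x h1 h2 := by
    refine (hu.neumann (MixedDN.diag e c x) (by simpa) (by simpa)).congr' ?_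
    filter_upwards [self_mem_nhdsWithin] with t ht
    have hm := update_last_mem_openHalf x ht
    have h1 : mkPt e 1 1 (Fin.last (d + 1)) = 1 := xlast_mkPt e 1 1
    rw [pd_diag (differentiableAt_of_contDiffAt (hu.contDiffAt (diag_mem_openHalf hm))), h1,
      one_mul, diag_update_last]

lemma IsMixedSolution.isAdmissible {s : ℝ} {u : Pt d → ℝ} (h : IsMixedSolution s u) :
    IsAdmissible s u := (isMixedSolution_iff.1 h).1

lemma IsMixedSolution.Lop_eq_zero {s : ℝ} {u : Pt d → ℝ} (h : IsMixedSolution s u) {x : Pt d}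
    (hx : x ∈ openHalf d) : Lop s u x = 0 := (isMixedSolution_iff.1 h).2 x hx

lemma IsMixedSolution.sub {s : ℝ} {u v : Pt d → ℝ} (hu : IsMixedSolution s u)
    (hv : IsMixedSolution s v) : IsMixedSolution s (fun x => u x - v x) :=
  isMixedSolution_iff.2 ⟨hu.isAdmissible.sub hv.isAdmissible, fun x hx => by
    rw [Lop_sub (hu.isAdmissible.contDiffAt hx) (hv.isAdmissible.contDiffAt hx),
      hu.Lop_eq_zero hx, hv.Lop_eq_zero hx, sub_zero]⟩

lemma IsMixedSolution.diag {s : ℝ} {u : Pt d → ℝ} (hu : IsMixedSolution s u) {e : Fin d → ℝ}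
    (he : ∀ i, e i ^ 2 = 1) (c : Fin d → ℝ) : IsMixedSolution s (fun x => u (diag e c x)) :=
  isMixedSolution_iff.2 ⟨hu.isAdmissible.diag e c, fun x hx => by
    rw [Lop_diag he (hu.isAdmissible.contDiffAt (diag_mem_openHalf hx)),
      hu.Lop_eq_zero (diag_mem_openHalf hx)]⟩

/-! ### The operator in polar coordinates -/

/-- The function `(x_n / ρ + 1) / 2` of the angle. -/
noncomputable def ang (x : Pt d) : ℝ := (xn x / rad x + 1) / 2

lemma ang_smul {c : ℝ} (hc : 0 < c) (x : Pt d) : ang (c • x) = ang x := by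
  rw [ang, ang, rad_smul hc.le, xn_smul, mul_div_mul_left _ _ hc.ne']

lemma contDiffAt_ang {x : Pt d} (hx : 0 < rad x) : ContDiffAt ℝ 2 (ang : Pt d → ℝ) x :=
  ((contDiff_xn.contDiffAt.div (contDiffAt_rad hx) hx.ne').add contDiffAt_const).div_const 2

lemma ang_mem_Ioo {x : Pt d} (hx : x ∈ openHalf d) : ang x ∈ Set.Ioo (0 : ℝ) 1 := by
  have hr := rad_pos hx
  have hy : 0 < xlast x := hx
  have h : |xn x| < rad x := by
    rw [← Real.sqrt_sq_eq_abs]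
    exact Real.sqrt_lt_sqrt (sq_nonneg _) (by nlinarith)
  rw [abs_lt] at h
  have h1 : -1 < xn x / rad x := by rw [lt_div_iff₀ hr]; linarith
  have h2 : xn x / rad x < 1 := by rw [div_lt_iff₀ hr]; linarith
  constructor <;> simp only [ang] <;> linarith

lemma grd_xn_xn (x : Pt d) : grd xn xn x = 1 := (grd_coord _ _ x).trans (if_pos rfl)

lemma Lop_xn (s : ℝ) (x : Pt d) : Lop s xn x = 0 :=
  (Lop_coord s _ x).trans (if_neg (Fin.castSucc_lt_last _).ne')

lemma Lop_xlast (s : ℝ) (x : Pt d) : Lop s xlast x = (1 - 2 * s) / xlast x :=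
  (Lop_coord s _ x).trans (if_pos rfl)

lemma grd_xlast_xlast (x : Pt d) : grd xlast xlast x = 1 := (grd_coord _ _ x).trans (if_pos rfl)

lemma grd_xlast_xn (x : Pt d) : grd xlast xn x = 0 :=
  (grd_coord _ _ x).trans (if_neg (Fin.castSucc_lt_last _).ne')

/-- The product rule applied to this identity yields the gradient products and `Lop` of `rad`
without differentiating a square root. -/
lemma rad_mul_rad : (fun z : Pt d => rad z * rad z) = fun z => xn z * xn z + xlast z * xlast z := by
  funext z; nlinarith [rad_sq z]

lemma grd_rad_xn {x : Pt d} (hx : 0 < rad x) : grd rad xn x = xn x / rad x := by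
  have hr := differentiableAt_of_contDiffAt (contDiffAt_rad hx)
  have h1 : DifferentiableAt ℝ xn x := differentiableAt_of_contDiffAt contDiff_xn.contDiffAt
  have h2 : DifferentiableAt ℝ xlast x := differentiableAt_of_contDiffAt contDiff_xlast.contDiffAt
  have h := grd_mul_left (h := xn) hr hr
  rw [rad_mul_rad, grd_add_left (h1.fun_mul h1) (h2.fun_mul h2), grd_mul_left h1 h1,
    grd_mul_left h2 h2, grd_xn_xn, grd_xlast_xn] at h
  field_simp
  linarith

lemma grd_rad_xlast {x : Pt d} (hx : 0 < rad x) : grd rad xlast x = xlast x / rad x := by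
  have hr := differentiableAt_of_contDiffAt (contDiffAt_rad hx)
  have h1 : DifferentiableAt ℝ xn x := differentiableAt_of_contDiffAt contDiff_xn.contDiffAt
  have h2 : DifferentiableAt ℝ xlast x := differentiableAt_of_contDiffAt contDiff_xlast.contDiffAt
  have h := grd_mul_left (h := xlast) hr hr
  rw [rad_mul_rad, grd_add_left (h1.fun_mul h1) (h2.fun_mul h2), grd_mul_left h1 h1,
    grd_mul_left h2 h2, grd_xlast_xlast, grd_comm, grd_xlast_xn] at h
  field_simp
  linarith

lemma grd_rad_rad {x : Pt d} (hx : 0 < rad x) : grd rad rad x = 1 := by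
  have hr := differentiableAt_of_contDiffAt (contDiffAt_rad hx)
  have h1 : DifferentiableAt ℝ xn x := differentiableAt_of_contDiffAt contDiff_xn.contDiffAt
  have h2 : DifferentiableAt ℝ xlast x := differentiableAt_of_contDiffAt contDiff_xlast.contDiffAt
  have h := grd_mul_left (h := rad) hr hr
  rw [rad_mul_rad, grd_add_left (h1.fun_mul h1) (h2.fun_mul h2), grd_mul_left h1 h1,
    grd_mul_left h2 h2, grd_comm xn, grd_comm xlast, grd_rad_xn hx, grd_rad_xlast hx] at h
  have h3 := rad_sq x
  field_simp at h
  rw [← h3] at h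
  exact mul_left_cancel₀ (pow_pos hx 2).ne' (by linarith)

lemma Lop_rad {s : ℝ} {x : Pt d} (hx : x ∈ openHalf d) :
    Lop s rad x = (2 - 2 * s) / rad x := by
  have hr := rad_pos hx
  have hy : 0 < xlast x := hx
  have h1 : ContDiffAt ℝ 2 xn x := contDiff_xn.contDiffAt
  have h2 : ContDiffAt ℝ 2 xlast x := contDiff_xlast.contDiffAt
  have h := Lop_mul (s := s) (contDiffAt_rad hr) (contDiffAt_rad hr)
  rw [rad_mul_rad, Lop_add (h1.mul h1) (h2.mul h2), Lop_mul h1 h1, Lop_mul h2 h2, grd_rad_rad hr,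
    grd_xn_xn, grd_xlast_xlast, Lop_xn, Lop_xlast] at h
  field_simp at h ⊢
  linarith

/-- The gradient identities for the angular variable. -/
lemma ang_identities {s : ℝ} {x : Pt d} (hx : x ∈ openHalf d) :
    grd ang rad x = 0 ∧ grd ang ang x = ang x * (1 - ang x) / rad x ^ 2 ∧
      Lop s ang x = (1 - s) * (1 - 2 * ang x) / rad x ^ 2 := by
  have hr := rad_pos hx
  have hrc := contDiffAt_rad hr
  have hac := contDiffAt_ang hr
  have hrd := differentiableAt_of_contDiffAt hrc
  have had := differentiableAt_of_contDiffAt hac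
  have hbc : ContDiffAt ℝ 2 (fun z : Pt d => 2 * ang z + (-1)) x :=
    (contDiffAt_const.mul hac).add contDiffAt_const
  have hbd := differentiableAt_of_contDiffAt hbc
  have hcd : DifferentiableAt ℝ (fun z : Pt d => 2 * ang z) x := had.const_mul 2
  have hb : ∀ h : Pt d → ℝ, grd (fun z : Pt d => 2 * ang z + (-1)) h x = 2 * grd ang h x := by
    intro h
    rw [grd_add_left hcd (differentiableAt_const _), grd_const_left,
      grd_mul_left (differentiableAt_const _) had, grd_const_left]
    ring
  have hLb : Lop s (fun z : Pt d => 2 * ang z + (-1)) x = 2 * Lop s ang x := by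
    rw [Lop_add (contDiffAt_const.mul hac) contDiffAt_const, Lop_const, Lop_const_mul hac]
    ring
  -- Again an implicit differentiation: `x_n = ρ (2 ang - 1)`, and pairing both sides with `rad`,
  -- `xn` and `ang` in turn, then applying `Lop`, gives equations that are solved for the unknown
  -- quantities of `ang`.
  have hxn : (xn : Pt d → ℝ) =ᶠ[𝓝 x] fun z => rad z * (2 * ang z + (-1)) := by
    filter_upwards [isOpen_openHalf.mem_nhds hx] with z hz
    have := rad_pos hz
    simp only [ang]; field_simp; ring
  have hg : ∀ h : Pt d → ℝ, grd xn h x =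
      rad x * (2 * grd ang h x) + (2 * ang x + (-1)) * grd rad h x := by
    intro h
    rw [← hb, ← grd_mul_left hrd hbd]
    simp only [grd, pd_congr hxn]
  have e0 : xn x = rad x * (2 * ang x + (-1)) := hxn.self_of_nhds
  have e1 : grd ang rad x = 0 := by
    have h := hg rad
    rw [grd_comm, grd_rad_xn hr, grd_rad_rad hr, e0] at h
    field_simp at h
    have h' : rad x * grd ang rad x = 0 := by linarith
    exact (mul_eq_zero.1 h').resolve_left hr.ne'
  have e2 : grd ang xn x = 2 * (ang x * (1 - ang x)) / rad x := by
    have h := hg xn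
    rw [grd_xn_xn, grd_rad_xn hr, e0] at h
    field_simp at h ⊢
    nlinarith
  have e3 : grd ang ang x = ang x * (1 - ang x) / rad x ^ 2 := by
    have h := hg ang
    rw [grd_comm rad, e1, grd_comm, e2] at h
    field_simp at h ⊢
    nlinarith
  refine ⟨e1, e3, ?_⟩
  have h := Lop_congr (s := s) hxn
  rw [Lop_xn, Lop_mul hrc hbc, grd_comm, hb, e1, hLb, Lop_rad hx] at h
  field_simp at h ⊢
  linarith

/-- The operator `Lop` on functions in separated polar form. -/
lemma Lop_polar {s μ : ℝ} {G : ℝ → ℝ} {x : Pt d} (hx : x ∈ openHalf d)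
    (hG : ContDiffAt ℝ 2 G (ang x)) :
    Lop s (fun z => rad z ^ μ * G (ang z)) x = rad x ^ (μ - 2) *
      (ang x * (1 - ang x) * deriv (deriv G) (ang x) +
        (1 - s) * (1 - 2 * ang x) * deriv G (ang x) + μ * (μ + 1 - 2 * s) * G (ang x)) := by
  have hr := rad_pos hx
  have hrc := contDiffAt_rad hr
  have hac := contDiffAt_ang hr
  have hrd := differentiableAt_of_contDiffAt hrc
  have had := differentiableAt_of_contDiffAt hac
  obtain ⟨e1, e2, e3⟩ := ang_identities (s := s) hx
  have hpc : ContDiffAt ℝ 2 (fun r : ℝ => r ^ μ) (rad x) :=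
    Real.contDiffAt_rpow_const_of_ne hr.ne'
  have hpd : deriv (fun r : ℝ => r ^ μ) =ᶠ[𝓝 (rad x)] fun r => μ * r ^ (μ - 1) := by
    filter_upwards [isOpen_Ioi.mem_nhds hr] with r hr'
    exact (Real.hasDerivAt_rpow_const (Or.inl (ne_of_gt hr'))).deriv
  have hpdd : deriv (deriv (fun r : ℝ => r ^ μ)) (rad x) =
      μ * ((μ - 1) * rad x ^ (μ - 1 - 1)) := by
    rw [hpd.deriv_eq]
    exact ((Real.hasDerivAt_rpow_const (Or.inl hr.ne')).const_mul μ).deriv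
  have hpd0 : deriv (fun r : ℝ => r ^ μ) (rad x) = μ * rad x ^ (μ - 1) := hpd.self_of_nhds
  have hf : ContDiffAt ℝ 2 (fun z : Pt d => rad z ^ μ) x :=
    ContDiffAt.comp (g := fun r : ℝ => r ^ μ) x hpc hrc
  have hh : ContDiffAt ℝ 2 (fun z : Pt d => G (ang z)) x := hG.comp x hac
  -- The cross term vanishes because `ang` and `rad` have orthogonal gradients. The radial factor
  -- contributes `μ (μ - 1) + (2 - 2s) μ = μ (μ + 1 - 2s)`.
  rw [Lop_mul hf hh, Lop_comp (G := fun r : ℝ => r ^ μ) hpc hrc, Lop_comp hG hac,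
    grd_comp_left (G := fun r : ℝ => r ^ μ) (hpc.differentiableAt (by norm_num)) hrd,
    grd_comm rad (fun z => G (ang z)),
    grd_comp_left (hG.differentiableAt (by norm_num)) had, hpdd, hpd0, e1, e2, e3,
    Lop_rad hx, grd_rad_rad hr]
  have p1 : rad x ^ (μ - 1) = rad x ^ (μ - 2) * rad x := by
    rw [← Real.rpow_add_one hr.ne']; ring_nf
  have p2 : rad x ^ μ = rad x ^ (μ - 2) * rad x ^ 2 := by
    rw [← Real.rpow_add_natCast hr.ne']; norm_num
  have p3 : rad x ^ (μ - 1 - 1) = rad x ^ (μ - 2) := by ring_nf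
  rw [p1, p2, p3]
  field_simp
  ring

/-! ### The hypergeometric polynomial -/

/-- The hypergeometric polynomial `F(-m, m + 1, 1 + s; ·)`. -/
noncomputable def hyperPoly (s : ℝ) (m : ℕ) : Polynomial ℝ :=
  ∑ j ∈ Finset.range (m + 1), Polynomial.monomial j
    (ordinaryHypergeometricCoefficient (-(m : ℝ)) ((m : ℝ) + 1) (1 + s) j)

lemma hyperCoeff_eq_zero (s : ℝ) {m j : ℕ} (h : m < j) :
    ordinaryHypergeometricCoefficient (-(m : ℝ)) ((m : ℝ) + 1) (1 + s) j = 0 := by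
  have : (ascPochhammer ℝ j).eval (-(m : ℝ)) = 0 := ascPochhammer_eval_neg_coe_nat_of_lt h
  simp [ordinaryHypergeometricCoefficient, this]

lemma hyperPoly_coeff (s : ℝ) (m j : ℕ) :
    (hyperPoly s m).coeff j =
      ordinaryHypergeometricCoefficient (-(m : ℝ)) ((m : ℝ) + 1) (1 + s) j := by
  simp only [hyperPoly, Polynomial.finsetSum_coeff, Polynomial.coeff_monomial,
    Finset.sum_ite_eq', Finset.mem_range]
  split_ifs with h
  · rfl
  · exact (hyperCoeff_eq_zero s (by omega)).symm

/-- The ratio of consecutive hypergeometric coefficients has numerator `(j - m)(j + m + 1) = j (j +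
1) - m (m + 1)`. -/
lemma hyperPoly_coeff_succ {s : ℝ} (hs : 0 < s) (m j : ℕ) :
    ((j : ℝ) + 1) * (j + 1 + s) * (hyperPoly s m).coeff (j + 1) =
      ((j : ℝ) * (j + 1) - m * (m + 1)) * (hyperPoly s m).coeff j := by
  have h1 : (ascPochhammer ℝ j).eval (1 + s) ≠ 0 := (ascPochhammer_pos j _ (by linarith)).ne'
  have h2 : (1 + s + (j : ℝ)) ≠ 0 := by positivity
  have h3 : ((j.factorial : ℕ) : ℝ) ≠ 0 := by positivity
  have h4 : ((j : ℝ) + 1) ≠ 0 := by positivity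
  simp only [hyperPoly_coeff, ordinaryHypergeometricCoefficient, ascPochhammer_succ_eval,
    Nat.factorial_succ]
  push_cast
  field_simp
  ring

lemma hyperPoly_eval_zero (s : ℝ) (m : ℕ) : (hyperPoly s m).eval 0 = 1 := by
  rw [← Polynomial.coeff_zero_eq_eval_zero, hyperPoly_coeff]
  simp [ordinaryHypergeometricCoefficient]

lemma hyperPoly_ode {s : ℝ} (hs : 0 < s) (m : ℕ) (z : ℝ) :
    z * (1 - z) * (hyperPoly s m).derivative.derivative.eval z +
      (1 + s - 2 * z) * (hyperPoly s m).derivative.eval z +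
      m * (m + 1) * (hyperPoly s m).eval z = 0 := by
  open Polynomial in
  have h : X * (hyperPoly s m).derivative.derivative
      - X * (X * (hyperPoly s m).derivative.derivative)
      + C (1 + s) * (hyperPoly s m).derivative - C 2 * (X * (hyperPoly s m).derivative)
      + C ((m : ℝ) * (m + 1)) * hyperPoly s m = 0 := by
    -- Coefficientwise the equation is `hyperPoly_coeff_succ`. Degrees 0 and 1 are separate because
    -- the factors `X` shift the index by up to two.
    ext j
    have hrec := hyperPoly_coeff_succ hs m j
    rcases j with _ | _ | j
    · simp only [coeff_add, coeff_sub, coeff_C_mul, coeff_X_mul_zero, coeff_derivative,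
        coeff_zero]
      push_cast at hrec ⊢
      linarith
    · simp only [coeff_add, coeff_sub, coeff_C_mul, coeff_X_mul, coeff_X_mul_zero,
        coeff_derivative, coeff_zero]
      push_cast at hrec ⊢
      norm_num at hrec ⊢
      linarith
    · simp only [coeff_add, coeff_sub, coeff_C_mul, coeff_X_mul,
        coeff_derivative, coeff_zero]
      push_cast at hrec ⊢
      linarith
  have h2 := congrArg (Polynomial.eval z) h
  simp at h2
  linarith

lemma contDiff_polynomial_eval (p : Polynomial ℝ) : ContDiff ℝ 2 fun z => p.eval z := by
  simpa using p.contDiff_aeval (𝕜 := ℝ) 2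

/-- The angular part of `u_m`. -/
noncomputable def angFun (s : ℝ) (m : ℕ) (z : ℝ) : ℝ := z ^ s * (hyperPoly s m).eval z

lemma hasDerivAt_angFun (s : ℝ) (m : ℕ) {z : ℝ} (hz : 0 < z) :
    HasDerivAt (angFun s m) (z ^ (s - 1) *
      (s * (hyperPoly s m).eval z + z * (hyperPoly s m).derivative.eval z)) z := by
  have h := (Real.hasDerivAt_rpow_const (p := s) (Or.inl hz.ne')).mul
    ((hyperPoly s m).hasDerivAt z)
  refine h.congr_deriv ?_
  have : z ^ s = z ^ (s - 1) * z := by rw [← Real.rpow_add_one hz.ne']; ring_nf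
  rw [this]; ring

lemma contDiffAt_angFun (s : ℝ) (m : ℕ) {z : ℝ} (hz : 0 < z) :
    ContDiffAt ℝ 2 (angFun s m) z :=
  (Real.contDiffAt_rpow_const_of_ne hz.ne').mul (contDiff_polynomial_eval (hyperPoly s m)).contDiffAt

/-- The substitution `G = z^s F` turns the hypergeometric equation for `F` into the angular one: `s`
is a root of the indicial equation at `0`, so the most singular terms cancel. The parameter is `μ (μ
+ 1 - 2s)` at `μ = s + m`. -/
lemma angFun_ode {s : ℝ} (hs : 0 < s) (m : ℕ) {z : ℝ} (hz : 0 < z) :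
    z * (1 - z) * deriv (deriv (angFun s m)) z + (1 - s) * (1 - 2 * z) * deriv (angFun s m) z +
      (s + m) * (m + 1 - s) * angFun s m z = 0 := by
  have h1 : deriv (angFun s m) =ᶠ[𝓝 z] fun z => z ^ (s - 1) *
      (s * (hyperPoly s m).eval z + z * (hyperPoly s m).derivative.eval z) := by
    filter_upwards [isOpen_Ioi.mem_nhds hz] with w hw using (hasDerivAt_angFun s m hw).deriv
  have h2 := (Real.hasDerivAt_rpow_const (p := s - 1) (Or.inl hz.ne')).fun_mul
    ((((hyperPoly s m).hasDerivAt z).const_mul s).fun_add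
      ((hasDerivAt_id' z).fun_mul ((hyperPoly s m).derivative.hasDerivAt z)))
  rw [h1.deriv_eq, h1.self_of_nhds, h2.deriv]
  have e1 : z ^ s = z ^ (s - 1 - 1) * z ^ 2 := by
    rw [← Real.rpow_add_natCast hz.ne']; congr 1; push_cast; ring
  have e2 : z ^ (s - 1) = z ^ (s - 1 - 1) * z := by rw [← Real.rpow_add_one hz.ne']; ring_nf
  have h3 := hyperPoly_ode hs m z
  simp only [angFun, e1, e2]
  linear_combination z ^ (s - 1 - 1) * z ^ 2 * h3

/-! ### The functions `u_m` -/

lemma um_eq (s : ℝ) (m : ℕ) (x : Pt d) :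
    um s m x = rad x ^ m * ((rad x + xn x) / 2) ^ s * (hyperPoly s m).eval (ang x) := by
  have h : ordinaryHypergeometric (-(m : ℝ)) ((m : ℝ) + 1) (1 + s) ((xn x / rad x + 1) / 2) =
      (hyperPoly s m).eval (ang x) := by
    rw [ordinaryHypergeometric_eq_tsum]
    beta_reduce
    rw [tsum_eq_sum (s := Finset.range (m + 1)), hyperPoly,
      Polynomial.eval_finsetSum]
    · simp [ang]
    · intro j hj
      have h0 := hyperCoeff_eq_zero s (m := m) (j := j) (by simpa using hj)
      rw [ordinaryHypergeometricCoefficient] at h0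
      rw [h0, zero_smul]
  rw [um, h]

lemma um_polar (s : ℝ) (m : ℕ) {x : Pt d} (hx : 0 < rad x) :
    um s m x = rad x ^ ((m : ℝ) + s) * angFun s m (ang x) := by
  have h1 : (rad x + xn x) / 2 = rad x * ang x := by
    simp only [ang]; field_simp; ring
  have h2 : 0 ≤ ang x := by
    have := neg_xn_le_rad x
    have h3 : -1 ≤ xn x / rad x := by rw [le_div_iff₀ hx]; linarith
    simp only [ang]; linarith
  rw [um_eq, h1, Real.mul_rpow hx.le h2, Real.rpow_add hx, Real.rpow_natCast, angFun]
  ring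

/-- The polynomials `p_m` with `u_m = w_{0,s} p_m(x_n, ρ)`. -/
noncomputable def profPoly (s : ℝ) (m : ℕ) : MvPolynomial (Fin 2) ℝ :=
  ∑ j ∈ Finset.range (m + 1),
    MvPolynomial.C ((1 / 2) ^ s * ((1 / 2) ^ j * (hyperPoly s m).coeff j)) *
      ((MvPolynomial.X 0 + MvPolynomial.X 1) ^ j * MvPolynomial.X 1 ^ (m - j))

lemma profPoly_isHomogeneous (s : ℝ) (m : ℕ) : (profPoly s m).IsHomogeneous m := by
  refine MvPolynomial.IsHomogeneous.sum _ _ _ fun j hj => ?_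
  have h1 := ((MvPolynomial.isHomogeneous_X ℝ (0 : Fin 2)).add
    (MvPolynomial.isHomogeneous_X ℝ (1 : Fin 2))).pow j
  have h2 := (MvPolynomial.isHomogeneous_X ℝ (1 : Fin 2)).pow (m - j)
  have h3 := (MvPolynomial.isHomogeneous_C (Fin 2)
    ((1 / 2) ^ s * ((1 / 2) ^ j * (hyperPoly s m).coeff j))).mul (h1.mul h2)
  convert h3 using 1
  have : j ≤ m := by simpa [Nat.lt_succ_iff] using hj
  omega

lemma eval_profPoly (s : ℝ) (m : ℕ) (a r : ℝ) :
    MvPolynomial.eval ![a, r] (profPoly s m) = ∑ j ∈ Finset.range (m + 1),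
      (1 / 2) ^ s * ((1 / 2) ^ j * (hyperPoly s m).coeff j) * ((a + r) ^ j * r ^ (m - j)) := by
  simp [profPoly]

/-- The argument of the hypergeometric polynomial is `(x_n + ρ) / (2ρ)` and its degree is at most
`m`, so `ρ^m` clears all denominators. On the edge `ρ = 0` both sides vanish because of the exponent
`s > 0`. -/
lemma um_eq_w0_mul {s : ℝ} (hs : 0 < s) (m : ℕ) (x : Pt d) :
    um s m x = w0 s x * MvPolynomial.eval ![xn x, rad x] (profPoly s m) := by
  rcases (rad_nonneg x).eq_or_lt with h | h
  · have hx : xn x = 0 := by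
      have h1 := xn_le_rad x
      have h2 := neg_xn_le_rad x
      linarith
    rw [um_eq, w0, ← h, hx]
    simp [Real.zero_rpow hs.ne']
  · have h0 : 0 ≤ rad x + xn x := by linarith [neg_xn_le_rad x]
    have hdiv : ((rad x + xn x) / 2) ^ s = (rad x + xn x) ^ s * (1 / 2 : ℝ) ^ s := by
      rw [← Real.mul_rpow h0 (by norm_num)]; ring_nf
    have hang : ang x = (xn x + rad x) * (1 / 2) / rad x := by
      simp only [ang]; field_simp
    rw [um_eq, eval_profPoly, w0, hdiv,
      Polynomial.eval_eq_sum_range' (n := m + 1) (Nat.lt_succ_of_le ?_), Finset.mul_sum,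
      Finset.mul_sum]
    · refine Finset.sum_congr rfl fun j hj => ?_
      have hj' : j ≤ m := by simpa [Nat.lt_succ_iff] using hj
      have hp : rad x ^ m = rad x ^ (m - j) * rad x ^ j := by rw [← pow_add]; congr 1; omega
      rw [hang, hp, div_pow, mul_pow]
      field_simp
    · rw [Polynomial.natDegree_le_iff_coeff_eq_zero]
      intro j hj
      rw [hyperPoly_coeff, hyperCoeff_eq_zero s hj]

lemma um_smul (s : ℝ) (m : ℕ) {c : ℝ} (hc : 0 < c) (x : Pt d) :
    um s m (c • x) = c ^ (s + m) * um s m x := by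
  have h0 : 0 ≤ (rad x + xn x) / 2 := by linarith [neg_xn_le_rad x]
  rw [um_eq, um_eq, ang_smul hc, rad_smul hc.le, xn_smul, ← mul_add, mul_div_assoc,
    Real.mul_rpow hc.le h0, Real.rpow_add hc, Real.rpow_natCast]
  ring

lemma tangIndep_rad : TangIndep (rad : Pt d → ℝ) := fun x y h1 h2 => by
  rw [rad, rad, h1, h2]

lemma tangIndep_um (s : ℝ) (m : ℕ) : TangIndep (um s m : Pt d → ℝ) := fun x y h1 h2 => by
  rw [um, um, tangIndep_rad x y h1 h2, h1]

/-- The building blocks `ρ^{2k} u_m`. -/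
noncomputable def blk (s : ℝ) (m k : ℕ) (x : Pt d) : ℝ := rad x ^ (2 * k) * um s m x

lemma tangIndep_blk (s : ℝ) (m k : ℕ) : TangIndep (blk s m k : Pt d → ℝ) := fun x y h1 h2 => by
  rw [blk, blk, tangIndep_rad x y h1 h2, tangIndep_um s m x y h1 h2]

lemma blk_smul (s : ℝ) (m k : ℕ) {c : ℝ} (hc : 0 < c) (x : Pt d) :
    blk s m k (c • x) = c ^ (s + m + 2 * k) * blk s m k x := by
  have h : c ^ (s + m + 2 * k) = c ^ (s + m) * c ^ (2 * k) := by
    rw [Real.rpow_add hc, ← Real.rpow_natCast c (2 * k)]; push_cast; rfl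
  rw [blk, blk, um_smul s m hc, rad_smul hc.le, h]
  ring

lemma hasDerivAt_slice {f : Pt d → ℝ} {x : Pt d} {j : Fin (d + 2)} {t : ℝ}
    (hf : DifferentiableAt ℝ f (Function.update x j t)) :
    HasDerivAt (fun r => f (Function.update x j r)) (pd j f (Function.update x j t)) t :=
  hf.hasFDerivAt.comp_hasDerivAt t (hasDerivAt_update x j t)

lemma contDiffAt_eval_pair (p : MvPolynomial (Fin 2) ℝ) {f g : ℝ → ℝ} {r : ℝ}
    (hf : ContDiffAt ℝ 2 f r) (hg : ContDiffAt ℝ 2 g r) :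
    ContDiffAt ℝ 2 (fun t => MvPolynomial.eval ![f t, g t] p) r := by
  induction p using MvPolynomial.induction_on with
  | C a => simpa using contDiffAt_const
  | add p q hp hq => simpa using hp.add hq
  | mul_X p i hp =>
    fin_cases i
    · simpa using hp.mul hf
    · simpa using hp.mul hg

lemma continuous_um {s : ℝ} (hs : 0 < s) (m : ℕ) : Continuous (um s m : Pt d → ℝ) := by
  have h : (um s m : Pt d → ℝ) = fun x => w0 s x *
      ∑ j ∈ Finset.range (m + 1), (1 / 2) ^ s * ((1 / 2) ^ j * (hyperPoly s m).coeff j) *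
        ((xn x + rad x) ^ j * rad x ^ (m - j)) := by
    funext x; rw [um_eq_w0_mul hs, eval_profPoly]
  rw [h]
  have hw : Continuous (w0 s : Pt d → ℝ) :=
    (continuous_rad.add continuous_xn).rpow_const fun _ => Or.inr hs.le
  have hn := continuous_xn (d := d)
  have hr := continuous_rad (d := d)
  fun_prop

lemma contDiffAt_angFun_ang (s : ℝ) (m : ℕ) {x : Pt d} (hx : x ∈ openHalf d) :
    ContDiffAt ℝ 2 (angFun s m) (ang x) := contDiffAt_angFun s m (ang_mem_Ioo hx).1

lemma blk_polar (s : ℝ) (m k : ℕ) {x : Pt d} (hx : 0 < rad x) :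
    blk s m k x = rad x ^ (s + m + 2 * k) * angFun s m (ang x) := by
  have h : rad x ^ (s + m + 2 * k) = rad x ^ (m + s) * rad x ^ (2 * k) := by
    rw [Real.rpow_add hx, ← Real.rpow_natCast (rad x) (2 * k), add_comm s]; push_cast; rfl
  rw [blk, um_polar s m hx, h]; ring

lemma blk_eventuallyEq (s : ℝ) (m k : ℕ) {x : Pt d} (hx : x ∈ openHalf d) :
    blk s m k =ᶠ[𝓝 x] fun z => rad z ^ (s + m + 2 * k) * angFun s m (ang z) := by
  filter_upwards [isOpen_openHalf.mem_nhds hx] with z hz using blk_polar s m k (rad_pos hz)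

lemma contDiffAt_blk (s : ℝ) (m k : ℕ) {x : Pt d} (hx : x ∈ openHalf d) :
    ContDiffAt ℝ 2 (blk s m k) x := by
  refine ContDiffAt.congr_of_eventuallyEq ?_ (blk_eventuallyEq s m k hx)
  exact ((contDiffAt_rad (rad_pos hx)).rpow_const_of_ne (rad_pos hx).ne').mul
    ((contDiffAt_angFun_ang s m hx).comp x (contDiffAt_ang (rad_pos hx)))

/-- The angular equation for `u_m` cancels everything except the excess `μ (μ + 1 - 2s) - (s + m)(m
+ 1 - s) = 2k (2m + 2k + 1)` at `μ = s + m + 2k`. -/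
lemma Lop_blk {s : ℝ} (hs : 0 < s) (m k : ℕ) {x : Pt d} (hx : x ∈ openHalf d) :
    Lop s (blk s m k) x = 2 * k * (2 * m + 2 * k + 1) *
      (rad x ^ (s + m + 2 * k - 2) * angFun s m (ang x)) := by
  rw [Lop_congr (blk_eventuallyEq s m k hx), Lop_polar hx (contDiffAt_angFun_ang s m hx)]
  have h := angFun_ode hs m (ang_mem_Ioo hx).1
  linear_combination rad x ^ (s + m + 2 * k - 2) * h

lemma Lop_blk_zero {s : ℝ} (hs : 0 < s) (m : ℕ) {x : Pt d} (hx : x ∈ openHalf d) :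
    Lop s (blk s m 0) x = 0 := by
  rw [Lop_blk hs m 0 hx]; simp

lemma Lop_blk_succ {s : ℝ} (hs : 0 < s) (m k : ℕ) {x : Pt d} (hx : x ∈ openHalf d) :
    Lop s (blk s m (k + 1)) x = ((2 * k + 2) * (2 * m + 2 * k + 3) : ℕ) * blk s m k x := by
  rw [Lop_blk hs m _ hx, blk_polar s m k (rad_pos hx)]
  push_cast
  have : s + m + 2 * ((k : ℝ) + 1) - 2 = s + m + 2 * k := by ring
  rw [this]; ring

lemma isAdmissible_blk {s : ℝ} (hs0 : 0 < s) (hs1 : s < 1) (m k : ℕ) :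
    IsAdmissible s (blk s m k : Pt d → ℝ) where
  continuousOn := ((continuous_rad.pow _).mul (continuous_um hs0 m)).continuousOn
  contDiffOn := fun x hx => (contDiffAt_blk s m k hx).contDiffWithinAt
  dirichlet x h1 h2 := by
    have hr : rad x = -xn x := by
      rw [rad, h1]; simp [Real.sqrt_sq_eq_abs, abs_of_nonpos h2]
    rw [blk, um_eq_w0_mul hs0, w0, hr]
    simp [Real.zero_rpow hs0.ne']
  neumann x h1 h2 := by
    -- On the vertical line over `x_n = a > 0` the function is `φ(ρ)` with `φ` of class `C^2` on
    -- positive radii and `ρ = √(a² + t²)`. Since `dρ/dt = t / ρ`, the weighted derivative is of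
    -- order `t ^ (2 - 2s)`.
    set a := xn x with ha
    set φ : ℝ → ℝ := fun r => r ^ (2 * k) * ((r + a) ^ s *
      MvPolynomial.eval ![a, r] (profPoly s m)) with hφ
    set ψ : ℝ → ℝ := fun t => Real.sqrt (a ^ 2 + t ^ 2) with hψ
    have hφc : ∀ r : ℝ, 0 < r → ContDiffAt ℝ 2 φ r := fun r hr =>
      (contDiffAt_id.pow _).mul (((contDiffAt_id.add contDiffAt_const).rpow_const_of_ne
        (add_pos hr h2).ne').mul (contDiffAt_eval_pair _ contDiffAt_const contDiffAt_id))
    have hf : ∀ t, blk s m k (Function.update x (Fin.last (d + 1)) t) = φ (ψ t) := by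
      intro t
      have hr : rad (Function.update x (Fin.last (d + 1)) t) = ψ t := by simp [rad, hψ, ha]
      simp only [blk, um_eq_w0_mul hs0, w0, hr, xn_update_last, hφ, ← ha]
    have hψpos : ∀ t, 0 < ψ t := fun t => Real.sqrt_pos.2 (by positivity)
    have hψd : ∀ t, HasDerivAt ψ (t / ψ t) t := by
      intro t
      have h := (((hasDerivAt_id t).pow 2).const_add (a ^ 2)).sqrt
        (by simp only [Pi.pow_apply, id]; positivity)
      refine h.congr_deriv ?_
      simp only [hψ, Pi.pow_apply, id]
      have := (hψpos t).ne'
      simp only [hψ] at this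
      field_simp
      norm_num
    have hpd : ∀ t : ℝ, 0 < t →
        pd (Fin.last (d + 1)) (blk s m k) (Function.update x (Fin.last (d + 1)) t) =
          deriv φ (ψ t) * (t / ψ t) := by
      intro t ht
      have e1 := hasDerivAt_slice (differentiableAt_of_contDiffAt
        (contDiffAt_blk s m k (update_last_mem_openHalf x ht)))
      have e2 := ((hφc _ (hψpos t)).differentiableAt (by norm_num)).hasDerivAt.comp t (hψd t)
      have e3 : (fun t => blk s m k (Function.update x (Fin.last (d + 1)) t)) = φ ∘ ψ := funext hf
      rw [e3] at e1
      exact e1.unique e2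
    have hψc : ContinuousAt ψ 0 := (hψd 0).continuousAt
    have hdφ : ContinuousAt (deriv φ) (ψ 0) := by
      have h1 : ContDiffAt ℝ 1 (fun r => fderiv ℝ φ r 1) (ψ 0) :=
        ((hφc _ (hψpos 0)).fderiv_right (m := 1) (by norm_num)).clm_apply contDiffAt_const
      simp only [fderiv_apply_one_eq_deriv] at h1
      exact h1.continuousAt
    have hq : ContinuousAt (fun t => deriv φ (ψ t) / ψ t) 0 :=
      (hdφ.comp hψc).div hψc (hψpos 0).ne'
    have hp : Tendsto (fun t : ℝ => t ^ (2 - 2 * s)) (𝓝 0) (𝓝 0) := by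
      have := (Real.continuousAt_rpow_const (0 : ℝ) (2 - 2 * s) (Or.inr (by linarith))).tendsto
      rwa [Real.zero_rpow (by linarith)] at this
    have h := (hp.mul hq.tendsto).mono_left (nhdsWithin_le_nhds (s := Set.Ioi (0 : ℝ)))
    rw [zero_mul] at h
    refine h.congr' ?_
    filter_upwards [self_mem_nhdsWithin] with t ht
    have ht' : (0 : ℝ) < t := ht
    rw [hpd t ht', show 2 - 2 * s = 1 - 2 * s + 1 by ring, Real.rpow_add_one ht'.ne']
    ring

/-! ### The explicit solutions -/

/-- The function `∑ ρ^{2k} P_{m,k}(x'') u_m` for fixed `m`. -/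
noncomputable def stack (s : ℝ) (m N : ℕ) (P : ℕ → MvPolynomial (Fin d) ℝ) (x : Pt d) : ℝ :=
  ∑ k ∈ Finset.range (N + 1), MvPolynomial.eval (tang x) (P k) * blk s m k x

lemma isAdmissible_stack {s : ℝ} (hs0 : 0 < s) (hs1 : s < 1) (m N : ℕ)
    (P : ℕ → MvPolynomial (Fin d) ℝ) : IsAdmissible s (stack s m N P) :=
  IsAdmissible.sum _ fun k _ => (isAdmissible_blk hs0 hs1 m k).tang_mul (P k)

/-- Applying `Lop` to the term `k + 1` produces a multiple of `blk s m k`, which the recursion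
cancels against `Δ'' P_k`. The sum telescopes and only the last Laplacian remains. -/
lemma Lop_stack {s : ℝ} (hs : 0 < s) (m N : ℕ) (P : ℕ → MvPolynomial (Fin d) ℝ)
    (hP : ∀ k < N, polyLaplacian (P k) +
      MvPolynomial.C (((2 * k + 2) * (2 * m + 2 * k + 3) : ℕ) : ℝ) * P (k + 1) = 0)
    {x : Pt d} (hx : x ∈ openHalf d) :
    Lop s (stack s m N P) x = MvPolynomial.eval (tang x) (polyLaplacian (P N)) * blk s m N x := by
  have hc : ∀ k, ContDiffAt ℝ 2 (fun z : Pt d => MvPolynomial.eval (tang z) (P k) * blk s m k z) x :=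
    fun k => (contDiff_tang_eval (P k)).contDiffAt.mul (contDiffAt_blk s m k hx)
  induction N with
  | zero =>
    have h : stack s m 0 P = fun z => MvPolynomial.eval (tang z) (P 0) * blk s m 0 z := by
      funext z; simp [stack]
    rw [h, Lop_tang_mul _ (tangIndep_blk s m 0) (contDiffAt_blk s m 0 hx), Lop_blk_zero hs m hx]
    ring
  | succ N ih =>
    have h : stack s m (N + 1) P = fun z => stack s m N P z +
        MvPolynomial.eval (tang z) (P (N + 1)) * blk s m (N + 1) z := by
      funext z; simp only [stack]; rw [Finset.sum_range_succ]
    have hs' : ContDiffAt ℝ 2 (stack s m N P) x := ContDiffAt.sum fun k _ => hc k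
    have h2 := congrArg (MvPolynomial.eval (tang x)) (hP N (by omega))
    simp only [map_add, map_mul, MvPolynomial.eval_C, map_zero] at h2
    rw [h, Lop_add hs' (hc _), ih fun k hk => hP k (by omega),
      Lop_tang_mul _ (tangIndep_blk s m _) (contDiffAt_blk s m _ hx), Lop_blk_succ hs m N hx]
    linear_combination blk s m N x * h2

lemma polyLaplacian_isHomogeneous {P : MvPolynomial (Fin d) ℝ} {n : ℕ} (h : P.IsHomogeneous n) :
    (polyLaplacian P).IsHomogeneous (n - 2) :=
  MvPolynomial.IsHomogeneous.sum _ _ _ fun _ _ => h.pderiv.pderiv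

lemma polyLaplacian_eq_zero {P : MvPolynomial (Fin d) ℝ} {n : ℕ} (h : P.IsHomogeneous n)
    (hn : n < 2) : polyLaplacian P = 0 := by
  refine Finset.sum_eq_zero fun i _ => ?_
  have h1 : (MvPolynomial.pderiv i P).IsHomogeneous 0 := by
    have := h.pderiv (i := i)
    rwa [show n - 1 = 0 by omega] at this
  rw [MvPolynomial.totalDegree_eq_zero_iff_eq_C.1 (Nat.le_zero.1 h1.totalDegree_le)]
  simp

lemma eval_smul_of_isHomogeneous {P : MvPolynomial (Fin d) ℝ} {n : ℕ} (h : P.IsHomogeneous n)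
    (c : ℝ) (a : Fin d → ℝ) :
    MvPolynomial.eval (c • a) P = c ^ n * MvPolynomial.eval a P := by
  simp only [MvPolynomial.eval_eq, Finset.mul_sum]
  refine Finset.sum_congr rfl fun e he => ?_
  simp only [Pi.smul_apply, smul_eq_mul, mul_pow, Finset.prod_mul_distrib,
    Finset.prod_pow_eq_pow_sum]
  rw [h.degree_eq_sum_deg_support he]
  ring

/-- With `N = (l - m) / 2` the last polynomial has degree `l - m - 2N < 2`, so the leftover
Laplacian in `Lop_stack` is zero. -/
lemma isMixedSolution_stack {s : ℝ} (hs0 : 0 < s) (hs1 : s < 1) {m l : ℕ} (hm : m ≤ l)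
    (P : ℕ → MvPolynomial (Fin d) ℝ)
    (hhom : ∀ k, m + 2 * k ≤ l → (P k).IsHomogeneous (l - m - 2 * k))
    (hP : ∀ k, m + 2 * (k + 1) ≤ l → polyLaplacian (P k) +
      MvPolynomial.C (((2 * k + 2) * (2 * m + 2 * k + 3) : ℕ) : ℝ) * P (k + 1) = 0) :
    IsMixedSolution s (stack s m ((l - m) / 2) P) := by
  refine isMixedSolution_iff.2 ⟨isAdmissible_stack hs0 hs1 _ _ _, fun x hx => ?_⟩
  rw [Lop_stack hs0 m _ P (fun k hk => hP k (by omega)) hx,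
    polyLaplacian_eq_zero (hhom _ (by omega)) (by omega)]
  simp

lemma isHomogeneousHalf_stack {s : ℝ} {m l : ℕ} (hm : m ≤ l)
    (P : ℕ → MvPolynomial (Fin d) ℝ)
    (hhom : ∀ k, m + 2 * k ≤ l → (P k).IsHomogeneous (l - m - 2 * k)) :
    IsHomogeneousHalf (s + l) (stack s m ((l - m) / 2) P) := by
  intro x _ c hc
  simp only [stack, Finset.mul_sum]
  refine Finset.sum_congr rfl fun k hk => ?_
  have hk' : m + 2 * k ≤ l := by have := Finset.mem_range.1 hk; omega
  have h1 : MvPolynomial.eval (tang (c • x)) (P k) =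
      c ^ (l - m - 2 * k) * MvPolynomial.eval (tang x) (P k) := by
    rw [tang_smul]
    exact eval_smul_of_isHomogeneous (hhom k hk') c _
  have h2 : c ^ (s + l) = c ^ (s + m + 2 * k) * c ^ (l - m - 2 * k) := by
    rw [← Real.rpow_natCast, ← Real.rpow_add hc]
    congr 1
    rw [Nat.sub_sub, Nat.cast_sub hk']
    push_cast; ring
  rw [h1, blk_smul s m k hc, h2]
  ring

/-! ### The maximum principle -/

/-- If the second derivative were positive, the second derivative test would make the point a local
minimum of the slice as well. The slice would then be locally constant, with vanishing second
derivative. -/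
lemma pd_pd_nonpos_of_isLocalMax {f : Pt d → ℝ} {x : Pt d} (hf : ContDiffAt ℝ 2 f x)
    (hmax : IsLocalMax f x) (j : Fin (d + 2)) : pd j (pd j f) x ≤ 0 := by
  have hx : Function.update x j (x j) = x := Function.update_eq_self j x
  have hcont : ContinuousAt (fun t => Function.update x j t) (x j) :=
    (hasDerivAt_update x j (x j)).continuousAt
  have htend : Tendsto (fun t => Function.update x j t) (𝓝 (x j)) (𝓝 x) := by
    have := hcont.tendsto; rwa [hx] at this
  set g : ℝ → ℝ := fun t => f (Function.update x j t) with hg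
  have hd1 : deriv g =ᶠ[𝓝 (x j)] fun t => pd j f (Function.update x j t) := by
    filter_upwards [htend.eventually (eventually_differentiableAt hf)] with t ht
      using (hasDerivAt_slice ht).deriv
  have hd2 : deriv (deriv g) (x j) = pd j (pd j f) x := by
    have h := hasDerivAt_slice (f := pd j f) (x := x) (j := j) (t := x j)
      (by rw [hx]; exact differentiableAt_pd hf j)
    rw [hd1.deriv_eq, h.deriv, hx]
  have hgmax : IsLocalMax g (x j) := by
    have h : ∀ᶠ z in 𝓝 x, f z ≤ f x := hmax
    filter_upwards [htend.eventually h] with t ht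
    simpa [hg] using ht
  by_contra hcon
  rw [not_le, ← hd2] at hcon
  have hgc : ContinuousAt g (x j) :=
    (hasDerivAt_slice (by rw [hx]; exact differentiableAt_of_contDiffAt hf)).continuousAt
  have hgmin := isLocalMin_of_deriv_deriv_pos hcon hgmax.deriv_eq_zero hgc
  have hconst : g =ᶠ[𝓝 (x j)] fun _ => g (x j) := by
    filter_upwards [hgmin, hgmax] with t h1 h2 using le_antisymm h2 h1
  have : deriv (deriv g) (x j) = 0 := by
    rw [hconst.deriv.deriv_eq]; simp
  linarith

lemma Lop_nonpos_of_isLocalMax {s : ℝ} {f : Pt d → ℝ} {x : Pt d} (hf : ContDiffAt ℝ 2 f x)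
    (hmax : IsLocalMax f x) : Lop s f x ≤ 0 := by
  have h : pd (Fin.last (d + 1)) f x = 0 := by simp [pd, hmax.fderiv_eq_zero]
  rw [Lop, h, mul_zero, add_zero]
  exact Finset.sum_nonpos fun j _ => pd_pd_nonpos_of_isLocalMax hf hmax j

lemma Lop_coord_comp {s : ℝ} {G G' G'' : ℝ → ℝ} {x : Pt d} {j : Fin (d + 2)}
    (hc : ContDiffAt ℝ 2 G (x j)) (h1 : ∀ᶠ r in 𝓝 (x j), HasDerivAt G (G' r) r)
    (h2 : HasDerivAt G' (G'' (x j)) (x j)) :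
    Lop s (fun z : Pt d => G (z j)) x =
      G'' (x j) + G' (x j) * if Fin.last (d + 1) = j then (1 - 2 * s) / xlast x else 0 := by
  have e : deriv G =ᶠ[𝓝 (x j)] G' := h1.mono fun r hr => hr.deriv
  rw [Lop_comp (f := fun z : Pt d => z j) hc (contDiff_coord j).contDiffAt, Lop_coord, grd_coord,
    e.deriv_eq, h2.deriv, e.self_of_nhds]
  simp

/-- The second homogeneous profile in `x_{n+1}`: it solves the equation but has weighted normal
derivative `2s > 0`. A small multiple of it excludes maxima at Neumann boundary points in the
comparison below. -/
lemma Lop_xlast_rpow {s : ℝ} {x : Pt d} (hx : x ∈ openHalf d) :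
    Lop s (fun z : Pt d => xlast z ^ (2 * s)) x = 0 := by
  have hy : 0 < xlast x := hx
  have h := Lop_coord_comp (s := s) (G := fun r => r ^ (2 * s))
    (G' := fun r => 2 * s * r ^ (2 * s - 1))
    (G'' := fun r => 2 * s * ((2 * s - 1) * r ^ (2 * s - 1 - 1))) (x := x) (j := Fin.last (d + 1))
    (Real.contDiffAt_rpow_const_of_ne hy.ne')
    (by
      filter_upwards [isOpen_Ioi.mem_nhds hy] with r hr
        using Real.hasDerivAt_rpow_const (Or.inl (ne_of_gt hr)))
    ((Real.hasDerivAt_rpow_const (Or.inl hy.ne')).const_mul _)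
  refine h.trans ?_
  change 2 * s * ((2 * s - 1) * xlast x ^ (2 * s - 1 - 1)) + 2 * s * xlast x ^ (2 * s - 1) * _ = 0
  rw [if_pos rfl, Real.rpow_sub_one hy.ne' (2 * s - 1)]
  field_simp
  ring

/-- Comparison of a solution with a strict supersolution on a compact set, where the pointwise
Neumann condition is used at the boundary points with `x_n > 0`. -/
theorem le_of_supersolution {s : ℝ} (hs0 : 0 < s) (hs1 : s < 1) {V Ψ : Pt d → ℝ} {K : Set (Pt d)}
    (hV : IsMixedSolution s V) (hK : IsCompact K) (hKsub : K ⊆ closedHalf d)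
    (hΨ : ContDiff ℝ 2 Ψ) (hΨ0 : ∀ z ∈ K, 0 ≤ Ψ z)
    (hL : ∀ z ∈ K, z ∈ openHalf d → Lop s Ψ z < 0)
    (hN : ∀ z : Pt d, ∃ C : ℝ, ∀ᶠ t in 𝓝[>] (0 : ℝ),
      pd (Fin.last (d + 1)) Ψ (Function.update z (Fin.last (d + 1)) t) ≤ C * t)
    (hbd : ∀ z ∈ K, V z ≤ Ψ z ∨ ((z ∈ openHalf d → K ∈ 𝓝 z) ∧
      (xlast z = 0 → ∀ᶠ t in 𝓝[>] (0 : ℝ), Function.update z (Fin.last (d + 1)) t ∈ K))) :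
    ∀ z ∈ K, V z ≤ Ψ z := by
  by_contra! hcon
  obtain ⟨x₀, hx₀, hlt⟩ := hcon
  have hpc : Continuous fun z : Pt d => xlast z ^ (2 * s) :=
    continuous_xlast.rpow_const fun _ => Or.inr (by positivity)
  obtain ⟨Y, hY⟩ := hK.bddAbove_image hpc.continuousOn
  have hY' : ∀ z ∈ K, xlast z ^ (2 * s) ≤ Y := fun z hz => hY ⟨z, hz, rfl⟩
  have hYnn : 0 ≤ Y := (Real.rpow_nonneg (hKsub hx₀) _).trans (hY' _ hx₀)
  -- With `ε` this small, the perturbation cannot compensate the excess at `x₀`, so `V > Ψ` still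
  -- holds at the maximum point of the perturbed function.
  obtain ⟨ε, hε, hεY⟩ : ∃ ε : ℝ, 0 < ε ∧ ε * Y < V x₀ - Ψ x₀ := by
    refine ⟨(V x₀ - Ψ x₀) / (Y + 1), by apply div_pos <;> linarith, ?_⟩
    rw [div_mul_eq_mul_div, div_lt_iff₀ (by linarith)]
    nlinarith
  set φ : Pt d → ℝ := fun z => V z - Ψ z + ε * xlast z ^ (2 * s) with hφ
  have hφc : ContinuousOn φ (closedHalf d) :=
    (hV.continuousOn.sub hΨ.continuous.continuousOn).add
      (continuousOn_const.mul hpc.continuousOn)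
  obtain ⟨z, hzK, hzmax⟩ := hK.exists_isMaxOn ⟨x₀, hx₀⟩ (hφc.mono hKsub)
  have hzmax' : ∀ w ∈ K, φ w ≤ φ z := fun w hw => hzmax hw
  have hzlt : Ψ z < V z := by
    have h1 := hzmax' x₀ hx₀
    have h2 : 0 ≤ ε * xlast x₀ ^ (2 * s) := mul_nonneg hε.le (Real.rpow_nonneg (hKsub hx₀) _)
    have h3 := mul_le_mul_of_nonneg_left (hY' z hzK) hε.le
    simp only [hφ] at h1
    linarith
  obtain ⟨hint, hflat⟩ := (hbd z hzK).resolve_left (not_le.2 hzlt)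
  have hpcd : ∀ w ∈ openHalf d, ContDiffAt ℝ 2 (fun z : Pt d => xlast z ^ (2 * s)) w :=
    fun w hw => contDiff_xlast.contDiffAt.rpow_const_of_ne (ne_of_gt hw)
  rcases (show 0 ≤ xlast z from hKsub hzK).eq_or_lt with h0 | hpos
  · rcases le_or_gt (xn z) 0 with hn | hn
    · rw [hV.dirichlet z h0.symm hn] at hzlt
      exact absurd (hΨ0 z hzK) (not_le.2 hzlt)
    -- At a Neumann point the weighted slope of `V` tends to `0`, that of `Ψ` is at most `C t ^ (2 -
    -- 2s)`, and the perturbation contributes exactly `2sε`. Hence `φ` strictly increases into the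
    -- half-space, along a segment that stays in `K`, and `z` is not a maximum.
    · obtain ⟨C, hC⟩ := hN z
      have hVN := hV.neumann z h0.symm hn
      have hlim : Tendsto (fun t : ℝ => C * t ^ (2 - 2 * s)) (𝓝[>] 0) (𝓝 0) := by
        have h := (Real.continuousAt_rpow_const (0 : ℝ) (2 - 2 * s)
          (Or.inr (by linarith))).tendsto.const_mul C
        rw [Real.zero_rpow (by linarith), mul_zero] at h
        exact h.mono_left nhdsWithin_le_nhds
      have hlim2 := (hVN.sub hlim).add_const (ε * (2 * s))
      rw [sub_zero, zero_add] at hlim2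
      have hev := hlim2.eventually (lt_mem_nhds (show (0 : ℝ) < ε * (2 * s) by positivity))
      obtain ⟨δ, hδ, hδ'⟩ := mem_nhdsGT_iff_exists_Ioo_subset.1
        (inter_mem (inter_mem hev hC) (hflat h0.symm))
      set g : ℝ → ℝ := fun t => φ (Function.update z (Fin.last (d + 1)) t) with hg
      have hδ0 : (0 : ℝ) < δ := hδ
      have hgd : ∀ t ∈ Set.Ioo 0 δ, 0 < deriv g t := by
        intro t ht
        have hm := update_last_mem_openHalf z ht.1
        have c1 := hV.isAdmissible.contDiffAt hm
        have c2 := hΨ.contDiffAt (x := Function.update z (Fin.last (d + 1)) t)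
        have c3 := hpcd _ hm
        have d1 := hasDerivAt_slice (differentiableAt_of_contDiffAt c1)
        have d2 := hasDerivAt_slice (differentiableAt_of_contDiffAt c2)
        have d3 : HasDerivAt (fun r : ℝ => r ^ (2 * s)) (2 * s * t ^ (2 * s - 1)) t :=
          Real.hasDerivAt_rpow_const (Or.inl ht.1.ne')
        have d4 := (d1.fun_sub d2).fun_add (d3.const_mul ε)
        have e4 : g = fun r => V (Function.update z (Fin.last (d + 1)) r) -
            Ψ (Function.update z (Fin.last (d + 1)) r) + ε * r ^ (2 * s) := by
          funext r; simp only [hg, hφ, xlast_update_last]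
        rw [e4, d4.deriv]
        obtain ⟨⟨h1, h2⟩, _⟩ := hδ' ht
        simp only [Set.mem_ofPred_eq] at h1 h2
        have p1 : t ^ (2 - 2 * s) = t ^ (1 - 2 * s) * t := by
          rw [← Real.rpow_add_one ht.1.ne']; ring_nf
        have p2 : t ^ (1 - 2 * s) * t ^ (2 * s - 1) = 1 := by
          rw [← Real.rpow_add ht.1]; simp
        have p0 : 0 < t ^ (1 - 2 * s) := Real.rpow_pos_of_pos ht.1 _
        have p3 := mul_le_mul_of_nonneg_left h2 p0.le
        rw [p1] at h1
        refine pos_of_mul_pos_right (a := t ^ (1 - 2 * s)) ?_ p0.le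
        have : t ^ (1 - 2 * s) * (ε * (2 * s * t ^ (2 * s - 1))) = ε * (2 * s) := by
          linear_combination ε * (2 * s) * p2
        rw [mul_add, mul_sub, this]
        linarith
      have hgc : ContinuousOn g (Set.Icc 0 (δ / 2)) := by
        refine hφc.comp (fun t _ => (hasDerivAt_update z _ t).continuousAt.continuousWithinAt) ?_
        intro t ht
        change 0 ≤ xlast _
        rw [xlast_update_last]; exact ht.1
      have hmono := strictMonoOn_of_deriv_pos (convex_Icc 0 (δ / 2)) hgc (by
        rw [interior_Icc]
        intro t ht
        exact hgd t ⟨ht.1, by linarith [ht.2]⟩)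
      have hlt2 := hmono (Set.left_mem_Icc.2 (by linarith)) (Set.right_mem_Icc.2 (by linarith))
        (show (0 : ℝ) < δ / 2 by linarith)
      have hz0 : Function.update z (Fin.last (d + 1)) 0 = z := by
        rw [h0]; exact Function.update_eq_self _ z
      have hle := hzmax' _ (hδ' ⟨by linarith, by linarith⟩ : δ / 2 ∈ _).2
      simp only [hg, hz0] at hlt2
      linarith
  -- At a point of the open half-space `Lop φ = -Lop Ψ > 0`, which is incompatible with a local
  -- maximum.
  · have hz : z ∈ openHalf d := hpos
    have hloc : IsLocalMax φ z := by
      filter_upwards [hint hz] with w hw using hzmax' w hw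
    have c1 := hV.isAdmissible.contDiffAt hz
    have c2 := hΨ.contDiffAt (x := z)
    have c3 := hpcd z hz
    have h1 : Lop s φ z = -Lop s Ψ z := by
      rw [hφ, Lop_add (c1.sub c2) (contDiffAt_const.mul c3), Lop_sub c1 c2, Lop_const_mul c3,
        Lop_xlast_rpow hz, hV.Lop_eq_zero hz]
      ring
    have h2 := Lop_nonpos_of_isLocalMax (s := s) ((c1.sub c2).add (contDiffAt_const.mul c3)) hloc
    have h3 := hL z hzK hz
    rw [← hφ, h1] at h2
    linarith

/-! ### Tangential Lipschitz estimate -/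

lemma forall_coord {p : Fin (d + 2) → Prop} :
    (∀ j, p j) ↔ (∀ i : Fin d, p i.castSucc.castSucc) ∧ p (Fin.last d).castSucc ∧
      p (Fin.last (d + 1)) := by
  refine ⟨fun h => ⟨fun i => h _, h _, h _⟩, fun h j => ?_⟩
  refine Fin.lastCases h.2.2 (fun j => ?_) j
  exact Fin.lastCases h.2.1 (fun j => h.1 j) j

lemma mkPt_apply_tang (a : Fin d → ℝ) (p q : ℝ) (i : Fin d) :
    mkPt a p q i.castSucc.castSucc = a i := congrFun (tang_mkPt a p q) i

lemma mkPt_apply_xn (a : Fin d → ℝ) (p q : ℝ) : mkPt a p q (Fin.last d).castSucc = p :=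
  xn_mkPt a p q

lemma mkPt_apply_last (a : Fin d → ℝ) (p q : ℝ) : mkPt a p q (Fin.last (d + 1)) = q :=
  xlast_mkPt a p q

lemma mem_Icc_mkPt {a a' : Fin d → ℝ} {p p' q q' : ℝ} {z : Pt d} :
    z ∈ Set.Icc (mkPt a p q) (mkPt a' p' q') ↔
      (∀ i, a i ≤ tang z i ∧ tang z i ≤ a' i) ∧ (p ≤ xn z ∧ xn z ≤ p') ∧
        (q ≤ xlast z ∧ xlast z ≤ q') := by
  simp only [Set.mem_Icc, Pi.le_def]
  rw [← forall_and, forall_coord]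
  simp only [mkPt_apply_tang, mkPt_apply_xn, mkPt_apply_last]
  rfl

/-- Translation by `h` in the tangential direction `i`. -/
noncomputable def tshift (i : Fin d) (h : ℝ) (x : Pt d) : Pt d := diag 1 (Pi.single i h) x

@[simp] lemma xn_tshift (i : Fin d) (h : ℝ) (x : Pt d) : xn (tshift i h x) = xn x := xn_diag _ _ _

@[simp] lemma xlast_tshift (i : Fin d) (h : ℝ) (x : Pt d) : xlast (tshift i h x) = xlast x :=
  xlast_diag _ _ _

lemma tang_tshift (i : Fin d) (h : ℝ) (x : Pt d) :
    tang (tshift i h x) = tang x + Pi.single i h := by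
  funext j; simp [tshift, tang_diag]

/-- The barrier for the tangential Lipschitz estimate, centred at `x`. -/
noncomputable def barrier (x : Pt d) (i : Fin d) (a R : ℝ) (z : Pt d) : ℝ :=
  ∑ j : Fin d, (if j = i then ((d : ℝ) + 33) * (2 * R * (tang z j - a) - (tang z j - a) ^ 2)
    else (tang z j - tang x j) ^ 2) + (xn z - xn x) ^ 2 +
    (xlast z ^ 2 - xlast x ^ 2) ^ 2 / R ^ 2

lemma contDiff_barrier (x : Pt d) (i : Fin d) (a R : ℝ) : ContDiff ℝ 2 (barrier x i a R) := by
  have h : ∀ j : Fin d, ContDiff ℝ 2 fun z : Pt d => tang z j := fun j => contDiff_coord _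
  refine ((ContDiff.sum fun j _ => ?_).add ((contDiff_xn.sub contDiff_const).pow 2)).add
    ((((contDiff_xlast.pow 2).sub contDiff_const).pow 2).div_const _)
  by_cases hj : j = i
  · simp only [hj, if_true]
    exact contDiff_const.mul ((contDiff_const.mul ((h _).sub contDiff_const)).sub
      (((h _).sub contDiff_const).pow 2))
  · simp only [hj, if_false]
    exact ((h _).sub contDiff_const).pow 2

lemma Lop_tang_comp {s : ℝ} {G G' : ℝ → ℝ} {c : ℝ} {x : Pt d} (j : Fin d)
    (hc : ContDiff ℝ 2 G) (h1 : ∀ r, HasDerivAt G (G' r) r)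
    (h2 : HasDerivAt G' c (tang x j)) : Lop s (fun z : Pt d => G (tang z j)) x = c := by
  have h := Lop_coord_comp (s := s) (G'' := fun _ => c) (x := x) (j := j.castSucc.castSucc)
    hc.contDiffAt (Eventually.of_forall h1) h2
  rw [if_neg (Fin.castSucc_lt_last _).ne', mul_zero, add_zero] at h
  exact h

/-- The concave term contributes `-2 (d + 33)`, the other tangential squares at most `2d`, the `x_n`
square `2`, and the last term less than `64` because `x_{n+1} ≤ 2R`. The constant `33` is chosen so
that `2 · 33 = 2 + 64`. -/
lemma Lop_barrier_neg {s : ℝ} (hs0 : 0 < s) (hs1 : s < 1) {x z : Pt d} {i : Fin d} {a R : ℝ}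
    (hR : 0 < R) (hz : z ∈ openHalf d) (hzR : xlast z ≤ 2 * R) :
    Lop s (barrier x i a R) z < 0 := by
  have hy : 0 < xlast z := hz
  have hsub : ∀ c r : ℝ, HasDerivAt (fun r : ℝ => r - c) 1 r :=
    fun c r => (hasDerivAt_id' r).sub_const c
  have hsq : ∀ c r : ℝ, HasDerivAt (fun r : ℝ => (r - c) ^ 2) (2 * (r - c)) r := fun c r => by
    simpa using (hsub c r).fun_pow 2
  have hterm : ∀ j : Fin d, ContDiff ℝ 2 (fun w : Pt d =>
      if j = i then ((d : ℝ) + 33) * (2 * R * (tang w j - a) - (tang w j - a) ^ 2)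
        else (tang w j - tang x j) ^ 2) ∧ Lop s (fun w : Pt d =>
      if j = i then ((d : ℝ) + 33) * (2 * R * (tang w j - a) - (tang w j - a) ^ 2)
        else (tang w j - tang x j) ^ 2) z = if j = i then -2 * ((d : ℝ) + 33) else 2 := by
    intro j
    have hcj : ContDiff ℝ 2 fun w : Pt d => tang w j := contDiff_coord _
    by_cases hj : j = i
    · simp only [hj, if_true]
      have hc : ContDiff ℝ 2 fun r : ℝ => ((d : ℝ) + 33) * (2 * R * (r - a) - (r - a) ^ 2) := by
        fun_prop
      refine ⟨hc.comp (hj ▸ hcj), ?_⟩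
      refine Lop_tang_comp (G := fun r => ((d : ℝ) + 33) * (2 * R * (r - a) - (r - a) ^ 2))
        (G' := fun r => ((d : ℝ) + 33) * (2 * R * 1 - 2 * (r - a))) i hc
        (fun r => (((hsub a r).const_mul _).fun_sub (hsq a r)).const_mul _) ?_
      refine ((((hsub a _).const_mul 2).const_sub (2 * R * 1)).const_mul _).congr_deriv ?_
      ring
    · simp only [hj, if_false]
      have hc : ContDiff ℝ 2 fun r : ℝ => (r - tang x j) ^ 2 := by fun_prop
      refine ⟨hc.comp hcj, ?_⟩
      refine Lop_tang_comp (G := fun r => (r - tang x j) ^ 2)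
        (G' := fun r => 2 * (r - tang x j)) j hc (fun r => hsq _ r) ?_
      simpa using (hsub (tang x j) _).const_mul 2
  have hn : Lop s (fun w : Pt d => (xn w - xn x) ^ 2) z = 2 := by
    have h := Lop_coord_comp (s := s) (G := fun r => (r - xn x) ^ 2)
      (G' := fun r => 2 * (r - xn x)) (G'' := fun _ => 2) (x := z) (j := (Fin.last d).castSucc)
      (by fun_prop) (Eventually.of_forall fun r => hsq _ r)
      (by simpa using (hsub (xn x) _).const_mul 2)
    rw [if_neg (Fin.castSucc_lt_last _).ne', mul_zero, add_zero] at h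
    exact h
  have hl : Lop s (fun w : Pt d => (xlast w ^ 2 - xlast x ^ 2) ^ 2 / R ^ 2) z =
      ((16 - 8 * s) * xlast z ^ 2 - (8 - 8 * s) * xlast x ^ 2) / R ^ 2 := by
    have e1 : ∀ r : ℝ, HasDerivAt (fun r : ℝ => (r ^ 2 - xlast x ^ 2) ^ 2 / R ^ 2)
        (4 * r * (r ^ 2 - xlast x ^ 2) / R ^ 2) r := by
      intro r
      have h := ((((hasDerivAt_id' r).fun_pow 2).sub_const (xlast x ^ 2)).fun_pow 2).div_const
        (R ^ 2)
      refine h.congr_deriv ?_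
      norm_num; ring
    have e2 : ∀ r : ℝ, HasDerivAt (fun r : ℝ => 4 * r * (r ^ 2 - xlast x ^ 2) / R ^ 2)
        ((12 * r ^ 2 - 4 * xlast x ^ 2) / R ^ 2) r := by
      intro r
      have h := (((hasDerivAt_id' r).const_mul 4).fun_mul
        (((hasDerivAt_id' r).fun_pow 2).sub_const (xlast x ^ 2))).div_const (R ^ 2)
      refine h.congr_deriv ?_
      norm_num; ring
    have h := Lop_coord_comp (s := s) (x := z) (j := Fin.last (d + 1))
      (G'' := fun r => (12 * r ^ 2 - 4 * xlast x ^ 2) / R ^ 2)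
      (ContDiff.contDiffAt (by fun_prop)) (Eventually.of_forall e1) (e2 _)
    rw [if_pos rfl] at h
    refine h.trans ?_
    change (12 * xlast z ^ 2 - 4 * xlast x ^ 2) / R ^ 2 +
      4 * xlast z * (xlast z ^ 2 - xlast x ^ 2) / R ^ 2 * _ = _
    field_simp
    ring
  have hc1 : ContDiffAt ℝ 2 (fun w : Pt d => (xn w - xn x) ^ 2) z :=
    ((contDiff_xn.sub contDiff_const).pow 2).contDiffAt
  have hc2 : ContDiffAt ℝ 2 (fun w : Pt d => (xlast w ^ 2 - xlast x ^ 2) ^ 2 / R ^ 2) z :=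
    ((((contDiff_xlast.pow 2).sub contDiff_const).pow 2).div_const _).contDiffAt
  have hc3 := ContDiffAt.sum (𝕜 := ℝ) (n := 2) (x := z) (s := Finset.univ)
    fun (j : Fin d) _ => (hterm j).1.contDiffAt
  have hsum : ∑ j : Fin d, (if j = i then -2 * ((d : ℝ) + 33) else 2) ≤
      -2 * ((d : ℝ) + 33) + 2 * d := by
    have : ∀ j : Fin d, (if j = i then -2 * ((d : ℝ) + 33) else 2) ≤
        (if j = i then -2 * ((d : ℝ) + 33) else 0) + 2 := by
      intro j; split_ifs <;> linarith
    refine (Finset.sum_le_sum fun j _ => this j).trans (le_of_eq ?_)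
    rw [Finset.sum_add_distrib]
    simp; ring
  have hlast : ((16 - 8 * s) * xlast z ^ 2 - (8 - 8 * s) * xlast x ^ 2) / R ^ 2 < 64 := by
    rw [div_lt_iff₀ (by positivity)]
    have h1 : 0 ≤ (8 - 8 * s) * xlast x ^ 2 := mul_nonneg (by linarith) (sq_nonneg _)
    have h2 : xlast z ^ 2 ≤ (2 * R) ^ 2 := pow_le_pow_left₀ hy.le hzR 2
    have h3 : 0 < s * xlast z ^ 2 := by positivity
    nlinarith
  have hB : Lop s (barrier x i a R) z =
      ∑ j : Fin d, (if j = i then -2 * ((d : ℝ) + 33) else 2) + 2 +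
        ((16 - 8 * s) * xlast z ^ 2 - (8 - 8 * s) * xlast x ^ 2) / R ^ 2 := by
    rw [show barrier x i a R = fun w => _ from rfl]
    simp only [barrier]
    rw [Lop_add (hc3.add hc1) hc2, Lop_add hc3 hc1, Lop_sum _ fun j _ => (hterm j).1.contDiffAt, hn,
      hl, Finset.sum_congr rfl fun j _ => (hterm j).2]
  rw [hB]
  linarith

/-- The barrier involves `x_{n+1}` only through its square, so its normal derivative is `O(t)`, as
the comparison principle requires. A square centred at `xlast x` would violate this when `xlast x <
0` and would also make the singular first-order term of `Lop` unbounded. -/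
lemma pd_last_barrier_le (x z : Pt d) (i : Fin d) {c : ℝ} (hc : 0 ≤ c) (a R : ℝ) :
    ∃ C : ℝ, ∀ᶠ t in 𝓝[>] (0 : ℝ), pd (Fin.last (d + 1)) (fun w => c * barrier x i a R w)
      (Function.update z (Fin.last (d + 1)) t) ≤ C * t := by
  refine ⟨c * (4 / R ^ 2), ?_⟩
  have hmem : Set.Ioo (0 : ℝ) 1 ∈ 𝓝[>] (0 : ℝ) := Ioo_mem_nhdsGT one_pos
  filter_upwards [hmem] with t ht
  have e1 := hasDerivAt_slice (f := fun w => c * barrier x i a R w) (x := z)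
    (j := Fin.last (d + 1)) (t := t)
    ((contDiff_const.mul (contDiff_barrier x i a R)).differentiable (by norm_num) _)
  have h := ((((((hasDerivAt_id' t).fun_pow 2).sub_const (xlast x ^ 2)).fun_pow 2).div_const
    (R ^ 2)).const_add (∑ j : Fin d,
      (if j = i then ((d : ℝ) + 33) * (2 * R * (tang z j - a) - (tang z j - a) ^ 2)
      else (tang z j - tang x j) ^ 2) + (xn z - xn x) ^ 2)).const_mul c
  simp only [barrier, tang_update_last, xn_update_last, xlast_update_last] at e1
  simp only [barrier]
  rw [e1.unique h]
  have h1 : t ^ 2 ≤ 1 := pow_le_one₀ ht.1.le ht.2.le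
  have h2 : t ^ 2 - xlast x ^ 2 ≤ 1 := by nlinarith [sq_nonneg (xlast x)]
  have h3 : t * (t ^ 2 - xlast x ^ 2) ≤ t * 1 := mul_le_mul_of_nonneg_left h2 ht.1.le
  rw [mul_assoc c (4 / R ^ 2) t]
  refine mul_le_mul_of_nonneg_left ?_ hc
  rw [div_mul_eq_mul_div]
  refine div_le_div_of_nonneg_right ?_ (sq_nonneg R)
  norm_num
  nlinarith

/-- On every face of the comparison box other than the mirror `x_i = a` and the bottom, a single
term already reaches `R ^ 2`. At the top, `(2R)² - xlast x ² ≥ 3R²`. -/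
lemma barrier_ge {x z : Pt d} {i : Fin d} {a R : ℝ} (hR : 0 < R)
    (hi : 0 ≤ tang z i - a ∧ tang z i - a ≤ R) :
    0 ≤ barrier x i a R z ∧
    (∀ j, j ≠ i → |tang z j - tang x j| = R → R ^ 2 ≤ barrier x i a R z) ∧
    (tang z i - a = R → R ^ 2 ≤ barrier x i a R z) ∧
    (|xn z - xn x| = R → R ^ 2 ≤ barrier x i a R z) ∧
    (xlast z = 2 * R → 0 ≤ xlast x → xlast x ≤ R → R ^ 2 ≤ barrier x i a R z) := by
  set T : Fin d → ℝ := fun j =>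
    if j = i then ((d : ℝ) + 33) * (2 * R * (tang z j - a) - (tang z j - a) ^ 2)
      else (tang z j - tang x j) ^ 2 with hT
  have hT0 : ∀ j, 0 ≤ T j := by
    intro j
    by_cases hj : j = i
    · simp only [hT, hj, if_true]
      exact mul_nonneg (by positivity) (by nlinarith [hi.1, hi.2])
    · simp only [hT, hj, if_false]
      exact sq_nonneg _
  have hB : barrier x i a R z = ∑ j, T j + (xn z - xn x) ^ 2 +
    (xlast z ^ 2 - xlast x ^ 2) ^ 2 / R ^ 2 := rfl
  have h1 : 0 ≤ ∑ j, T j := Finset.sum_nonneg fun j _ => hT0 j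
  have h2 : 0 ≤ (xn z - xn x) ^ 2 := sq_nonneg _
  have h3 : 0 ≤ (xlast z ^ 2 - xlast x ^ 2) ^ 2 / R ^ 2 := by positivity
  have h4 : ∀ j, T j ≤ ∑ j, T j := fun j =>
    Finset.single_le_sum (fun j _ => hT0 j) (Finset.mem_univ j)
  rw [hB]
  refine ⟨by positivity, fun j hj hjR => ?_, fun hR' => ?_, fun hR' => ?_, fun hR' h5 h6 => ?_⟩
  · have e : T j = R ^ 2 := by simp only [hT, hj, if_false]; rw [← sq_abs, hjR]
    linarith [h4 j]
  · have e : T i = ((d : ℝ) + 33) * R ^ 2 := by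
      simp only [hT, if_true, hR']; ring
    have : R ^ 2 ≤ ((d : ℝ) + 33) * R ^ 2 := by
      have : 0 ≤ (d : ℝ) * R ^ 2 := by positivity
      nlinarith [sq_nonneg R]
    linarith [h4 i]
  · have : (xn z - xn x) ^ 2 = R ^ 2 := by rw [← sq_abs, hR']
    linarith
  · have : R ^ 2 ≤ (xlast z ^ 2 - xlast x ^ 2) ^ 2 / R ^ 2 := by
      rw [le_div_iff₀ (by positivity), hR', ← sq]
      refine pow_le_pow_left₀ (sq_nonneg R) ?_ 2
      nlinarith
    linarith

/-- Reflect in the hyperplane `x_i = a` halfway between `x` and its translate. The odd difference `u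
- u ∘ σ` is a solution vanishing on the mirror and bounded by `2A`, so it lies below a multiple of
the barrier, which vanishes linearly at the mirror. At the translate of `x`, whose mirror image is
`x`, this is the asserted bound. -/
lemma tang_lipschitz_aux {s : ℝ} (hs0 : 0 < s) (hs1 : s < 1) {u : Pt d → ℝ}
    (hu : IsMixedSolution s u) (i : Fin d) {x : Pt d} (hx : x ∈ closedHalf d) {h R A : ℝ}
    (hh : 0 < h) (hhR : h ≤ R) (hxR : xlast x ≤ R) (hA0 : 0 < A)
    (hA : ∀ z ∈ closedHalf d, (∀ j, |z j - x j| ≤ 2 * R) → |u z| ≤ A) :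
    u (tshift i h x) - u x ≤ 2 * A * (d + 33) * h / R := by
  have hR : 0 < R := hh.trans_le hhR
  have hx0 : 0 ≤ xlast x := hx
  set a : ℝ := tang x i + h / 2 with ha
  set e : Fin d → ℝ := fun j => if j = i then -1 else 1 with he
  set σ : Pt d → Pt d := diag e (Pi.single i (2 * a)) with hσ
  have hσi : ∀ z, tang (σ z) i = 2 * a - tang z i := by
    intro z; simp [hσ, tang_diag, he]; ring
  have hσj : ∀ z, ∀ j, j ≠ i → tang (σ z) j = tang z j := by
    intro z j hj; simp [hσ, tang_diag, he, hj]
  have hV : IsMixedSolution s fun z => u z - u (σ z) :=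
    hu.sub (hu.diag (fun j => by simp only [he]; split_ifs <;> norm_num) _)
  -- Normalised so that `c * barrier` is at least `2A`, the bound for the odd difference, wherever
  -- the barrier is at least `R ^ 2`.
  set c : ℝ := 2 * A / R ^ 2 with hc
  have hc0 : 0 < c := by positivity
  have hcR : ∀ b, R ^ 2 ≤ b → 2 * A ≤ c * b := by
    intro b hb
    have h1 := mul_le_mul_of_nonneg_left hb hc0.le
    have h2 : c * R ^ 2 = 2 * A := by rw [hc]; field_simp
    linarith
  set K : Set (Pt d) := Set.Icc
    (mkPt (fun j => if j = i then a else tang x j - R) (xn x - R) 0)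
    (mkPt (fun j => if j = i then a + R else tang x j + R) (xn x + R) (2 * R)) with hK
  have hKi : ∀ z ∈ K, (a ≤ tang z i ∧ tang z i ≤ a + R) ∧
      (∀ j, j ≠ i → tang x j - R ≤ tang z j ∧ tang z j ≤ tang x j + R) ∧
      (xn x - R ≤ xn z ∧ xn z ≤ xn x + R) ∧ (0 ≤ xlast z ∧ xlast z ≤ 2 * R) := by
    intro z hz
    obtain ⟨h1, h2, h3⟩ := mem_Icc_mkPt.1 hz
    refine ⟨by simpa using h1 i, fun j hj => by simpa [hj] using h1 j, h2, h3⟩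
  have hVA : ∀ z ∈ K, u z - u (σ z) ≤ 2 * A := by
    intro z hz
    obtain ⟨h1, h2, h3, h4⟩ := hKi z hz
    have b1 : |u z| ≤ A := by
      refine hA z h4.1 (forall_coord.2 ⟨fun j => ?_, ?_, ?_⟩)
      · change |tang z j - tang x j| ≤ _
        rw [abs_le]
        by_cases hj : j = i
        · subst hj; constructor <;> linarith [h1.1, h1.2]
        · constructor <;> linarith [(h2 j hj).1, (h2 j hj).2]
      · change |xn z - xn x| ≤ _
        rw [abs_le]; constructor <;> linarith [h3.1, h3.2]
      · change |xlast z - xlast x| ≤ _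
        rw [abs_le]; constructor <;> linarith [h4.1, h4.2]
    have b2 : |u (σ z)| ≤ A := by
      refine hA (σ z) (diag_mem_closedHalf h4.1) (forall_coord.2 ⟨fun j => ?_, ?_, ?_⟩)
      · change |tang (σ z) j - tang x j| ≤ _
        rw [abs_le]
        by_cases hj : j = i
        · subst hj; rw [hσi]; constructor <;> linarith [h1.1, h1.2]
        · rw [hσj z j hj]; constructor <;> linarith [(h2 j hj).1, (h2 j hj).2]
      · change |xn (σ z) - xn x| ≤ _
        rw [hσ, xn_diag, abs_le]; constructor <;> linarith [h3.1, h3.2]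
      · change |xlast (σ z) - xlast x| ≤ _
        rw [hσ, xlast_diag, abs_le]; constructor <;> linarith [h4.1, h4.2]
    linarith [(abs_le.1 b1).2, (abs_le.1 b2).1]
  have hBi : ∀ z ∈ K, _ := fun z hz => barrier_ge (x := x) (z := z) (i := i) (a := a) hR
    ⟨by linarith [(hKi z hz).1.1], by linarith [(hKi z hz).1.2]⟩
  have hmain := le_of_supersolution hs0 hs1 (Ψ := fun z => c * barrier x i a R z) (K := K) hV
    isCompact_Icc (fun z hz => (hKi z hz).2.2.2.1) (contDiff_const.mul (contDiff_barrier x i a R))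
    (fun z hz => mul_nonneg hc0.le (hBi z hz).1)
    (fun z hz hz' => by
      rw [Lop_const_mul (contDiff_barrier x i a R).contDiffAt]
      exact mul_neg_of_pos_of_neg hc0 (Lop_barrier_neg hs0 hs1 hR hz' (hKi z hz).2.2.2.2))
    (fun z => pd_last_barrier_le x z i hc0.le a R)
    -- On the mirror the odd difference is zero; on the remaining faces apart from the bottom it is
    -- at most `2A`. Away from these faces `K` is a neighbourhood of interior points and contains a
    -- vertical segment over bottom points.
    (fun z hz => by
      obtain ⟨h1, h2, h3, h4⟩ := hKi z hz
      obtain ⟨B0, B1, B2, B3, B4⟩ := hBi z hz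
      by_cases c1 : tang z i = a
      · left
        have : σ z = z := by
          refine pt_ext (funext fun j => ?_) (xn_diag _ _ _) (xlast_diag _ _ _)
          by_cases hj : j = i
          · subst hj; rw [hσi, c1]; ring
          · exact hσj z j hj
        simp only [this, sub_self]
        exact mul_nonneg hc0.le B0
      by_cases c2 : tang z i - a = R
      · exact Or.inl ((hVA z hz).trans (hcR _ (B2 c2)))
      by_cases c3 : |xn z - xn x| = R
      · exact Or.inl ((hVA z hz).trans (hcR _ (B3 c3)))
      by_cases c4 : xlast z = 2 * R
      · exact Or.inl ((hVA z hz).trans (hcR _ (B4 c4 hx0 hxR)))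
      by_cases c5 : ∃ j, j ≠ i ∧ |tang z j - tang x j| = R
      · obtain ⟨j, hj, hjR⟩ := c5
        exact Or.inl ((hVA z hz).trans (hcR _ (B1 j hj hjR)))
      push Not at c5
      right
      constructor
      · intro hz'
        have hz0 : 0 < xlast z := hz'
        refine pi_Icc_mem_nhds' ?_ ?_
        · refine forall_coord.2 ⟨fun j => ?_, ?_, ?_⟩
          · rw [mkPt_apply_tang]
            change _ < tang z j
            by_cases hj : j = i
            · subst hj; simpa using lt_of_le_of_ne h1.1 (Ne.symm c1)
            · simp only [hj, if_false]
              refine lt_of_le_of_ne (h2 j hj).1 fun hh' => c5 j hj ?_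
              rw [← hh']; simp [abs_of_pos hR]
          · rw [mkPt_apply_xn]
            change _ < xn z
            refine lt_of_le_of_ne h3.1 fun hh' => c3 ?_
            rw [← hh']; simp [abs_of_pos hR]
          · rw [mkPt_apply_last]; exact hz0
        · refine forall_coord.2 ⟨fun j => ?_, ?_, ?_⟩
          · rw [mkPt_apply_tang]
            change tang z j < _
            by_cases hj : j = i
            · subst hj
              simp only [if_true]
              exact lt_of_le_of_ne h1.2 fun hh' => c2 (by rw [hh']; ring)
            · simp only [hj, if_false]
              refine lt_of_le_of_ne (h2 j hj).2 fun hh' => c5 j hj ?_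
              rw [hh']; simp [abs_of_pos hR]
          · rw [mkPt_apply_xn]
            change xn z < _
            refine lt_of_le_of_ne h3.2 fun hh' => c3 ?_
            rw [hh']; simp [abs_of_pos hR]
          · rw [mkPt_apply_last]; exact lt_of_le_of_ne h4.2 c4
      · intro hz0
        filter_upwards [Ioo_mem_nhdsGT hR] with t ht
        obtain ⟨g1, g2, _⟩ := mem_Icc_mkPt.1 hz
        refine mem_Icc_mkPt.2 ?_
        rw [tang_update_last, xn_update_last, xlast_update_last]
        exact ⟨g1, g2, ht.1.le, by linarith [ht.2]⟩)
  have hpi : tang (tshift i h x) i - a = h / 2 := by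
    rw [tang_tshift, ha]; simp; ring
  have hpj : ∀ j, j ≠ i → tang (tshift i h x) j = tang x j := by
    intro j hj; rw [tang_tshift]; simp [hj]
  have hpK : tshift i h x ∈ K := by
    refine mem_Icc_mkPt.2 ⟨fun j => ?_, ?_, ?_⟩
    · by_cases hj : j = i
      · subst hj
        simp only [if_true]
        constructor <;> linarith
      · rw [hpj j hj]
        simp only [hj, if_false]
        constructor <;> linarith
    · rw [xn_tshift]; constructor <;> linarith
    · rw [xlast_tshift]; exact ⟨hx0, by linarith⟩
  have hσp : σ (tshift i h x) = x := by
    refine pt_ext (funext fun j => ?_) (by simp [hσ]) (by simp [hσ])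
    by_cases hj : j = i
    · subst hj; rw [hσi]; linarith
    · rw [hσj _ j hj, hpj j hj]
  have hfin := hmain _ hpK
  simp only [hσp] at hfin
  have hval : barrier x i a R (tshift i h x) = ((d : ℝ) + 33) * (R * h - (h / 2) ^ 2) := by
    rw [barrier, xn_tshift, xlast_tshift, Finset.sum_eq_single i]
    · rw [if_pos rfl, hpi]; ring
    · intro j _ hj
      rw [if_neg hj, hpj j hj]; ring
    · simp
  rw [hval] at hfin
  refine hfin.trans ?_
  rw [hc, div_mul_eq_mul_div, div_le_div_iff₀ (by positivity) hR]
  have : 0 ≤ A * ((d : ℝ) + 33) * (h / 2) ^ 2 * R := by positivity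
  nlinarith

lemma IsMixedSolution.neg {s : ℝ} {u : Pt d → ℝ} (hu : IsMixedSolution s u) :
    IsMixedSolution s fun x => -u x := by
  refine isMixedSolution_iff.2 ⟨?_, fun x hx => ?_⟩
  · simpa using hu.isAdmissible.const_mul (-1)
  · have h := Lop_const_mul (s := s) (hu.isAdmissible.contDiffAt hx) (-1)
    rw [hu.Lop_eq_zero hx] at h
    simpa using h

lemma tang_lipschitz {s : ℝ} (hs0 : 0 < s) (hs1 : s < 1) {u : Pt d → ℝ}
    (hu : IsMixedSolution s u) (i : Fin d) {x : Pt d} (hx : x ∈ closedHalf d) {h R A : ℝ}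
    (hh : 0 < h) (hhR : h ≤ R) (hxR : xlast x ≤ R) (hA0 : 0 < A)
    (hA : ∀ z ∈ closedHalf d, (∀ j, |z j - x j| ≤ 2 * R) → |u z| ≤ A) :
    |u (tshift i h x) - u x| ≤ 2 * A * (d + 33) * h / R := by
  have h1 := tang_lipschitz_aux hs0 hs1 hu i hx hh hhR hxR hA0 hA
  have h2 := tang_lipschitz_aux hs0 hs1 hu.neg i hx hh hhR hxR hA0 (by simpa using hA)
  rw [abs_le]
  constructor <;> linarith

/-! ### Functions with vanishing iterated differences -/

/-- Newton's forward difference formula, with the binomial coefficient of `n` written as a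
polynomial in `n * h`. -/
lemma exists_poly_of_fwdDiff_lattice {f : ℝ → ℝ} {N : ℕ} {y h : ℝ} (hh : 0 < h)
    (hf : ∀ k, N ≤ k → (fwdDiff h)^[k] f y = 0) :
    ∃ P : Polynomial ℝ, P.degree < N ∧ ∀ n : ℕ, f (y + n * h) = P.eval (n * h) := by
  open Polynomial in
  refine ⟨∑ k ∈ Finset.range N, C ((fwdDiff h)^[k] f y / k.factorial) *
    (descPochhammer ℝ k).comp (C h⁻¹ * X), ?_, fun n => ?_⟩
  · refine Polynomial.mem_degreeLT.1 (Submodule.sum_mem _ fun k hk => ?_)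
    rw [← Polynomial.smul_eq_C_mul]
    refine Submodule.smul_mem _ _ (Polynomial.mem_degreeLT.2 ?_)
    refine Polynomial.degree_le_natDegree.trans_lt ?_
    rw [Polynomial.natDegree_comp, descPochhammer_natDegree, Polynomial.natDegree_C_mul_X _
      (inv_ne_zero hh.ne'), mul_one]
    exact_mod_cast Finset.mem_range.1 hk
  · have h1 := shift_eq_sum_fwdDiff_iter h f n y
    rw [nsmul_eq_mul] at h1
    rw [h1, Polynomial.eval_finsetSum]
    have e : ∀ k, (n.choose k) • (fwdDiff h)^[k] f y =
        eval ((n : ℝ) * h) (C ((fwdDiff h)^[k] f y / k.factorial) *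
          (descPochhammer ℝ k).comp (C h⁻¹ * X)) := by
      intro k
      have hn : h⁻¹ * ((n : ℝ) * h) = n := by field_simp
      rw [eval_mul, eval_C, eval_comp, eval_mul, eval_C, eval_X, hn,
        descPochhammer_eval_eq_descFactorial, Nat.descFactorial_eq_factorial_mul_choose,
        nsmul_eq_mul]
      have : ((k.factorial : ℕ) : ℝ) ≠ 0 := by positivity
      push_cast
      field_simp
    simp only [← e]
    -- Newton's sum stops at `n`, the polynomial at `N - 1`. The surplus terms vanish either by the
    -- hypothesis on the differences or because the binomial coefficient is zero.
    rcases le_total N (n + 1) with hN | hN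
    · refine (Finset.sum_subset (Finset.range_subset_range.2 hN) fun k _ hk => ?_).symm
      rw [hf k (by simpa using hk), smul_zero]
    · refine Finset.sum_subset (Finset.range_subset_range.2 hN) fun k _ hk => ?_
      rw [Nat.choose_eq_zero_of_lt (by have := Finset.mem_range.not.1 hk; omega), zero_smul]

/-- The polynomials for the steps `1` and `1 / q` agree at all natural numbers and so coincide. One
polynomial thus represents `f` at all nonnegative rational offsets, and continuity extends this to
real ones. -/
lemma exists_poly_of_fwdDiff {f : ℝ → ℝ} (hc : Continuous f) {N : ℕ} {y : ℝ}
    (hf : ∀ h > 0, ∀ k, N ≤ k → (fwdDiff h)^[k] f y = 0) :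
    ∃ P : Polynomial ℝ, P.degree < N ∧ ∀ t, 0 ≤ t → f (y + t) = P.eval t := by
  obtain ⟨P, hP, hPe⟩ := exists_poly_of_fwdDiff_lattice one_pos (hf 1 one_pos)
  refine ⟨P, hP, ?_⟩
  have hrat : ∀ q : ℕ, 0 < q → ∀ n : ℕ, f (y + n / q) = P.eval ((n : ℝ) / q) := by
    intro q hq n
    have hq' : (0 : ℝ) < q := by exact_mod_cast hq
    obtain ⟨Q, _, hQe⟩ := exists_poly_of_fwdDiff_lattice (inv_pos.2 hq') (hf _ (inv_pos.2 hq'))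
    have hPQ : P = Q := by
      refine Polynomial.eq_of_infinite_eval_eq P Q ?_
      refine (Set.infinite_range_of_injective
        (f := fun m : ℕ => (m : ℝ)) Nat.cast_injective).mono ?_
      rintro _ ⟨m, rfl⟩
      have h1 := hPe m
      have h2 := hQe (m * q)
      push_cast at h2
      rw [mul_inv_cancel_right₀ hq'.ne'] at h2
      rw [mul_one] at h1
      exact h1.symm.trans h2
    rw [hPQ, div_eq_mul_inv]
    exact hQe n
  intro t ht
  have h1 : Tendsto (fun q : ℕ => (⌊t * (q : ℝ)⌋₊ : ℝ) / (q : ℝ)) atTop (𝓝 t) :=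
    (tendsto_nat_floor_mul_div_atTop ht).comp tendsto_natCast_atTop_atTop
  have h2 : Tendsto (fun q : ℕ => f (y + (⌊t * (q : ℝ)⌋₊ : ℝ) / (q : ℝ))) atTop (𝓝 (f (y + t))) :=
    (hc.tendsto _).comp (h1.const_add y)
  have h3 : Tendsto (fun q : ℕ => P.eval ((⌊t * (q : ℝ)⌋₊ : ℝ) / (q : ℝ))) atTop (𝓝 (P.eval t)) :=
    (P.continuous.tendsto _).comp h1
  refine tendsto_nhds_unique (h2.congr' ?_) h3
  filter_upwards [eventually_gt_atTop 0] with q hq using hrat q hq _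

/-- The Lagrange basis polynomials for the nodes `0, …, N - 1`. -/
noncomputable def lagr (N m : ℕ) : Polynomial ℝ :=
  Lagrange.basis (Finset.range N) (fun k : ℕ => (k : ℝ)) m

lemma lagrange_of_fwdDiff {f : ℝ → ℝ} (hc : Continuous f) {N : ℕ}
    (hf : ∀ h > 0, ∀ k, N ≤ k → ∀ y, (fwdDiff h)^[k] f y = 0) (t : ℝ) :
    f t = ∑ m ∈ Finset.range N, (lagr N m).eval t * f m := by
  -- The representation holds only to the right of its base point; `min t 0` lies to the left of `t`
  -- and of all the nodes.
  obtain ⟨P, hP, hPe⟩ := exists_poly_of_fwdDiff hc (y := min t 0) (fun h hh k hk => hf h hh k hk _)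
  have hQ : ∀ r, min t 0 ≤ r → (P.comp (Polynomial.X - Polynomial.C (min t 0))).eval r = f r := by
    intro r hr
    have := hPe (r - min t 0) (by linarith)
    rw [add_sub_cancel] at this
    simp [this]
  have hd : (P.comp (Polynomial.X - Polynomial.C (min t 0))).degree < (Finset.range N).card := by
    rw [Finset.card_range]
    by_cases h0 : P = 0
    · subst h0; simp
    · refine Polynomial.degree_le_natDegree.trans_lt ?_
      rw [Polynomial.natDegree_comp, Polynomial.natDegree_X_sub_C, mul_one]
      rwa [Polynomial.degree_eq_natDegree h0] at hP
  have h := Lagrange.eq_interpolate_of_eval_eq (r := fun m : ℕ => f m) (s := Finset.range N)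
    (v := fun k : ℕ => (k : ℝ)) (fun a _ b _ hab => Nat.cast_injective hab) hd
    (fun m _ => hQ m ((min_le_right _ _).trans (Nat.cast_nonneg m)))
  have h2 := hQ t (min_le_left _ _)
  rw [h, Lagrange.interpolate_apply, Polynomial.eval_finsetSum] at h2
  rw [← h2]
  refine Finset.sum_congr rfl fun m _ => ?_
  rw [Polynomial.eval_mul, Polynomial.eval_C, mul_comm]
  rfl

/-- Interpolation in several variables. -/
lemma exists_interpolation (d N : ℕ) :
    ∃ (ι : Type) (_ : Fintype ι) (Q : ι → MvPolynomial (Fin d) ℝ) (A : ι → Fin d → ℝ),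
      ∀ F : (Fin d → ℝ) → ℝ,
        (∀ a i t, F (Function.update a i t) =
          ∑ m ∈ Finset.range N, (lagr N m).eval t * F (Function.update a i m)) →
        ∀ x, F x = ∑ k, MvPolynomial.eval x (Q k) * F (A k) := by
  -- Interpolate one coordinate at a time, `S` being the set of coordinates already replaced by
  -- nodes. The data `Q`, `A` are fixed before `F`, so the same formula applies to `u` at every
  -- `(x_n, x_{n+1})`.
  have key : ∀ S : Finset (Fin d),
      ∃ (ι : Type) (_ : Fintype ι) (Q : ι → MvPolynomial (Fin d) ℝ) (A : ι → Fin d → ℝ),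
      ∀ F : (Fin d → ℝ) → ℝ,
        (∀ a i t, F (Function.update a i t) =
          ∑ m ∈ Finset.range N, (lagr N m).eval t * F (Function.update a i m)) →
        ∀ x, F x = ∑ k, MvPolynomial.eval x (Q k) * F fun i => if i ∈ S then A k i else x i := by
    intro S
    induction S using Finset.induction_on with
    | empty => exact ⟨Unit, inferInstance, fun _ => 1, fun _ => 0, fun F _ x => by simp⟩
    | insert i S hi ih =>
      obtain ⟨ι, hι, Q, A, h⟩ := ih
      refine ⟨ι × Fin N, inferInstance,
        fun p => Q p.1 * Polynomial.aeval (MvPolynomial.X i) (lagr N p.2),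
        fun p => Function.update (A p.1) i (p.2 : ℕ), fun F hF x => ?_⟩
      rw [h F hF x, Fintype.sum_prod_type]
      refine Finset.sum_congr rfl fun k _ => ?_
      have e1 : (fun j => if j ∈ S then A k j else x j) =
          Function.update (fun j => if j ∈ S then A k j else x j) i (x i) := by
        rw [eq_comm, Function.update_eq_self_iff]
        simp [hi]
      rw [e1, hF, Finset.sum_range, Finset.mul_sum]
      refine Finset.sum_congr rfl fun m _ => ?_
      have e2 : MvPolynomial.eval x (Polynomial.aeval (MvPolynomial.X i) (lagr N m)) =
          (lagr N m).eval (x i) := by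
        have := Polynomial.aeval_algHom_apply (MvPolynomial.aeval (R := ℝ) x)
          (MvPolynomial.X i) (lagr N m)
        rw [MvPolynomial.aeval_X, MvPolynomial.aeval_eq_eval] at this
        exact this.symm.trans (by simp)
      have e3 : Function.update (fun j => if j ∈ S then A k j else x j) i (m : ℝ) =
          fun j => if j ∈ insert i S then Function.update (A k) i (m : ℝ) j else x j := by
        funext j
        by_cases hj : j = i
        · subst hj; simp
        · simp [hj]
      rw [map_mul, e2, e3]
      ring
  obtain ⟨ι, hι, Q, A, h⟩ := key Finset.univ
  exact ⟨ι, hι, Q, A, fun F hF x => by simpa using h F hF x⟩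

/-! ### Growth and tangential polynomiality -/

/-- `u` is `O(R^κ)` on the half-boxes of size `R`. -/
def GrowthLE (κ : ℝ) (u : Pt d → ℝ) : Prop :=
  ∃ C > 0, ∃ R₀ > 0, ∀ R ≥ R₀, ∀ x ∈ closedHalf d, (∀ j, |x j| ≤ R) → |u x| ≤ C * R ^ κ

lemma GrowthLE.eq_zero {κ : ℝ} (hκ : κ < 0) {u : Pt d → ℝ} (hu : GrowthLE κ u) :
    ∀ x ∈ closedHalf d, u x = 0 := by
  obtain ⟨C, hC, R₀, hR₀, h⟩ := hu
  intro x hx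
  have hlim : Tendsto (fun R : ℝ => C * R ^ κ) atTop (𝓝 0) := by
    have := (tendsto_rpow_neg_atTop (neg_pos.2 hκ)).const_mul C
    simpa using this
  have hev : ∀ᶠ R : ℝ in atTop, |u x| ≤ C * R ^ κ := by
    filter_upwards [eventually_ge_atTop R₀, eventually_ge_atTop ‖x‖] with R h1 h2
    exact h R h1 x hx fun j => (norm_le_pi_norm x j).trans h2
  have := ge_of_tendsto hlim hev
  exact abs_eq_zero.1 (le_antisymm this (abs_nonneg _))

lemma growthLE_of_homogeneous {κ : ℝ} {u : Pt d → ℝ} (hc : ContinuousOn u (closedHalf d))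
    (hu : IsHomogeneousHalf κ u) : GrowthLE κ u := by
  have hcl : IsClosed (closedHalf d) := isClosed_le continuous_const continuous_xlast
  have hK : IsCompact (Metric.closedBall (0 : Pt d) 1 ∩ closedHalf d) :=
    (isCompact_closedBall _ _).inter_right hcl
  obtain ⟨C, hC⟩ := hK.exists_bound_of_continuousOn (hc.mono Set.inter_subset_right)
  refine ⟨|C| + 1, by positivity, 1, one_pos, fun R hR x hx hxR => ?_⟩
  have hR0 : (0 : ℝ) < R := by linarith
  have hy : R⁻¹ • x ∈ Metric.closedBall (0 : Pt d) 1 ∩ closedHalf d := by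
    constructor
    · rw [mem_closedBall_zero_iff, norm_smul, norm_inv, Real.norm_of_nonneg hR0.le,
        inv_mul_le_iff₀ hR0, mul_one]
      exact (pi_norm_le_iff_of_nonneg hR0.le).2 hxR
    · exact mul_nonneg (inv_nonneg.2 hR0.le) hx
  have h1 := hu _ hy.2 R hR0
  rw [smul_inv_smul₀ hR0.ne'] at h1
  have h2 := hC _ hy
  rw [Real.norm_eq_abs] at h2
  rw [h1, abs_mul, abs_of_pos (Real.rpow_pos_of_pos hR0 κ), mul_comm]
  refine mul_le_mul_of_nonneg_right ?_ (Real.rpow_nonneg hR0.le _)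
  linarith [le_abs_self C]

/-- The tangential difference operator. -/
noncomputable def tdiff (i : Fin d) (h : ℝ) (u : Pt d → ℝ) (x : Pt d) : ℝ := u (tshift i h x) - u x

lemma IsMixedSolution.tdiff {s : ℝ} {u : Pt d → ℝ} (hu : IsMixedSolution s u) (i : Fin d)
    (h : ℝ) : IsMixedSolution s (tdiff i h u) :=
  (hu.diag (e := 1) (fun _ => one_pow 2) _).sub hu

/-- Each tangential difference gains a factor `R⁻¹`: boxes of radius `2R` around points of size `R`
lie at size `3R`, where `u` is bounded by `C (3R)^κ`, and the Lipschitz estimate divides by `R`. -/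
lemma GrowthLE.tdiff {s : ℝ} (hs0 : 0 < s) (hs1 : s < 1) {κ : ℝ} {u : Pt d → ℝ}
    (hu : IsMixedSolution s u) (hg : GrowthLE κ u) (i : Fin d) {h : ℝ} (hh : 0 < h) :
    GrowthLE (κ - 1) (tdiff i h u) := by
  obtain ⟨C, hC, R₀, hR₀, hb⟩ := hg
  refine ⟨2 * (C * 3 ^ κ) * (d + 33) * h, by positivity, max R₀ h, lt_max_of_lt_left hR₀,
    fun R hR x hx hxR => ?_⟩
  have h1 : R₀ ≤ R := (le_max_left _ _).trans hR
  have h2 : h ≤ R := (le_max_right _ _).trans hR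
  have hR0 : 0 < R := hh.trans_le h2
  have hA : ∀ z ∈ closedHalf d, (∀ j, |z j - x j| ≤ 2 * R) → |u z| ≤ C * (3 * R) ^ κ := by
    intro z hz hzx
    refine hb (3 * R) (by linarith) z hz fun j => ?_
    have := abs_add_le (z j - x j) (x j)
    rw [sub_add_cancel] at this
    linarith [hzx j, hxR j]
  have hfin := tang_lipschitz hs0 hs1 hu i hx hh h2 ((le_abs_self _).trans (hxR _))
    (by positivity) hA
  refine hfin.trans (le_of_eq ?_)
  rw [Real.mul_rpow (by norm_num) hR0.le, Real.rpow_sub_one hR0.ne']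
  ring

lemma tdiff_iterate {s : ℝ} (hs0 : 0 < s) (hs1 : s < 1) {κ : ℝ} {u : Pt d → ℝ}
    (hu : IsMixedSolution s u) (hg : GrowthLE κ u) (i : Fin d) {h : ℝ} (hh : 0 < h) (k : ℕ) :
    IsMixedSolution s ((tdiff i h)^[k] u) ∧ GrowthLE (κ - k) ((tdiff i h)^[k] u) := by
  induction k with
  | zero => simpa using ⟨hu, hg⟩
  | succ k ih =>
    rw [Function.iterate_succ_apply']
    refine ⟨ih.1.tdiff i h, ?_⟩
    have := ih.2.tdiff hs0 hs1 ih.1 i hh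
    rwa [sub_sub, ← Nat.cast_succ] at this

lemma tshift_tshift (i : Fin d) (h t : ℝ) (x : Pt d) :
    tshift i h (tshift i t x) = tshift i (t + h) x := by
  refine pt_ext ?_ (by simp) (by simp)
  rw [tang_tshift, tang_tshift, tang_tshift, Pi.single_add, add_assoc]

lemma fwdDiff_iterate_eq (u : Pt d → ℝ) (i : Fin d) (h : ℝ) (x : Pt d) (k : ℕ) (t : ℝ) :
    (fwdDiff h)^[k] (fun t => u (tshift i t x)) t = (tdiff i h)^[k] u (tshift i t x) := by
  induction k generalizing t with
  | zero => rfl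
  | succ k ih =>
    rw [Function.iterate_succ_apply', Function.iterate_succ_apply']
    simp only [fwdDiff, tdiff, ih, tshift_tshift]

lemma continuous_tshift (i : Fin d) (x : Pt d) : Continuous fun t => tshift i t x := by
  have h : ∀ t, tshift i t x = mkPt (tang x + Pi.single i t) (xn x) (xlast x) := fun t =>
    pt_ext (by rw [tang_tshift, tang_mkPt]) (by simp) (by simp)
  simp only [h]
  refine continuous_pi (forall_coord.2 ⟨fun j => ?_, ?_, ?_⟩)
  · simp only [mkPt_apply_tang, Pi.add_apply]
    refine continuous_const.add ?_
    by_cases hj : j = i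
    · subst hj; simpa using continuous_id'
    · simpa [hj] using continuous_const
  · simp only [mkPt_apply_xn]; exact continuous_const
  · simp only [mkPt_apply_last]; exact continuous_const

/-- Differences of order `k ≥ N > κ` have growth exponent `κ - k < 0` and are therefore identically
zero. -/
lemma solution_lagrange {s : ℝ} (hs0 : 0 < s) (hs1 : s < 1) {κ : ℝ} {u : Pt d → ℝ}
    (hu : IsMixedSolution s u) (hg : GrowthLE κ u) {N : ℕ} (hN : κ < N) {x : Pt d}
    (hx : x ∈ closedHalf d) (i : Fin d) (t : ℝ) :
    u (tshift i t x) = ∑ m ∈ Finset.range N, (lagr N m).eval t * u (tshift i m x) := by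
  have hmem : ∀ t, tshift i t x ∈ closedHalf d := fun t => diag_mem_closedHalf hx
  refine lagrange_of_fwdDiff (f := fun t => u (tshift i t x)) ?_ ?_ t
  · exact hu.continuousOn.comp_continuous (continuous_tshift i x) hmem
  · intro h hh k hk y
    rw [fwdDiff_iterate_eq]
    refine (tdiff_iterate hs0 hs1 hu hg i hh k).2.eq_zero ?_ _ (hmem y)
    have : (N : ℝ) ≤ k := by exact_mod_cast hk
    linarith

/-- Solutions of polynomial growth are polynomials in the tangential variables. -/
theorem exists_tangential_expansion {s : ℝ} (hs0 : 0 < s) (hs1 : s < 1) {κ : ℝ} {u : Pt d → ℝ}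
    (hu : IsMixedSolution s u) (hg : GrowthLE κ u) :
    ∃ (ι : Type) (_ : Fintype ι) (Q : ι → MvPolynomial (Fin d) ℝ) (A : ι → Fin d → ℝ),
      ∀ x ∈ closedHalf d, u x = ∑ k, MvPolynomial.eval (tang x) (Q k) * u (diag 0 (A k) x) := by
  obtain ⟨N, hN⟩ := exists_nat_gt κ
  obtain ⟨ι, hι, Q, A, h⟩ := exists_interpolation d N
  refine ⟨ι, hι, Q, A, fun x hx => ?_⟩
  have hrepl : diag 0 (tang x) x = x := pt_ext (by simp [tang_diag]) (by simp) (by simp)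
  have h1 := h (fun a => u (diag 0 a x)) (fun a i t => ?_) (tang x)
  · simpa only [hrepl] using h1
  · have e : ∀ r : ℝ, diag 0 (Function.update a i r) x =
        tshift i r (diag 0 (Function.update a i 0) x) := by
      intro r
      refine pt_ext ?_ (by simp) (by simp)
      rw [tang_tshift]
      funext j
      by_cases hj : j = i
      · subst hj; simp [tang_diag]
      · simp [tang_diag, hj]
    have hb : diag 0 (Function.update a i 0) x ∈ closedHalf d := diag_mem_closedHalf hx
    generalize diag 0 (Function.update a i 0) x = b at e hb
    simp only [e]
    exact solution_lagrange hs0 hs1 hu hg hN hb i t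

section AngularClassification

/-! ### The angular eigenvalue problem -/

/-- The angular equation with a Dirichlet condition at `0` and a Neumann condition at `1`. -/
structure IsAngular (s lam : ℝ) (G : ℝ → ℝ) : Prop where
  continuousOn : ContinuousOn G (Set.Icc 0 1)
  contDiffAt : ∀ z ∈ Set.Ioo (0 : ℝ) 1, ContDiffAt ℝ 2 G z
  zero : G 0 = 0
  ode : ∀ z ∈ Set.Ioo (0 : ℝ) 1, z * (1 - z) * deriv (deriv G) z +
    (1 - s) * (1 - 2 * z) * deriv G z + lam * G z = 0
  neumann : Tendsto (fun z => (z * (1 - z)) ^ (1 - s) * deriv G z) (𝓝[<] 1) (𝓝 0)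

variable {s lam : ℝ} {G H : ℝ → ℝ}

lemma differentiableAt_deriv {z : ℝ} (h : ContDiffAt ℝ 2 G z) : DifferentiableAt ℝ (deriv G) z := by
  have h1 : ContDiffAt ℝ 1 (fun r => fderiv ℝ G r 1) z :=
    (h.fderiv_right (m := 1) (by norm_num)).clm_apply contDiffAt_const
  simp only [fderiv_apply_one_eq_deriv] at h1
  exact h1.differentiableAt (by norm_num)

lemma IsAngular.hasDerivAt (hG : IsAngular s lam G) {z : ℝ} (hz : z ∈ Set.Ioo (0 : ℝ) 1) :
    HasDerivAt G (deriv G z) z :=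
  ((hG.contDiffAt z hz).differentiableAt (by norm_num)).hasDerivAt

lemma IsAngular.hasDerivAt_deriv (hG : IsAngular s lam G) {z : ℝ} (hz : z ∈ Set.Ioo (0 : ℝ) 1) :
    HasDerivAt (deriv G) (deriv (deriv G) z) z :=
  (differentiableAt_deriv (hG.contDiffAt z hz)).hasDerivAt

lemma IsAngular.sub_mul (hG : IsAngular s lam G) (hH : IsAngular s lam H) (c : ℝ) :
    IsAngular s lam fun z => G z - c * H z := by
  have hd : ∀ z ∈ Set.Ioo (0 : ℝ) 1,
      deriv (fun z => G z - c * H z) z = deriv G z - c * deriv H z := fun z hz =>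
    ((hG.hasDerivAt hz).fun_sub ((hH.hasDerivAt hz).const_mul c)).deriv
  refine ⟨hG.continuousOn.sub (continuousOn_const.mul hH.continuousOn),
    fun z hz => (hG.contDiffAt z hz).sub (contDiffAt_const.mul (hH.contDiffAt z hz)),
    by simp [hG.zero, hH.zero], fun z hz => ?_, ?_⟩
  · have he : deriv (fun z => G z - c * H z) =ᶠ[𝓝 z] fun z => deriv G z - c * deriv H z := by
      filter_upwards [isOpen_Ioo.mem_nhds hz] with w hw using hd w hw
    rw [he.deriv_eq, hd z hz,
      ((hG.hasDerivAt_deriv hz).fun_sub ((hH.hasDerivAt_deriv hz).const_mul c)).deriv]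
    linear_combination hG.ode z hz - c * hH.ode z hz
  · have h := hG.neumann.sub (hH.neumann.const_mul c)
    rw [mul_zero, sub_zero] at h
    refine h.congr' ?_
    filter_upwards [Ioo_mem_nhdsLT (zero_lt_one' ℝ)] with z hz
    rw [hd z hz]; ring

/-- In divergence form the flux `(z(1-z))^(1-s) G'` has derivative `-lam (z(1-z))^(-s) G`, which
near `0` is dominated by the integrable `M z^(-s)`. Adding and subtracting the primitive of this
majorant gives monotone functions, which bound the flux up to `0`. -/
lemma IsAngular.exists_bound (hs0 : 0 < s) (hs1 : s < 1) (hG : IsAngular s lam G) :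
    ∃ B, ∀ z ∈ Set.Ioo (0 : ℝ) (1 / 2), |(z * (1 - z)) ^ (1 - s) * deriv G z| ≤ B := by
  obtain ⟨g, hg⟩ := isCompact_Icc.exists_bound_of_continuousOn hG.continuousOn
  have hg0 : 0 ≤ g := (norm_nonneg _).trans (hg 0 (by simp))
  set M : ℝ := |lam| * ((1 / 2 : ℝ) ^ (-s) * g) with hM
  have hM0 : 0 ≤ M := by positivity
  set F : ℝ → ℝ := fun z => (z * (1 - z)) ^ (1 - s) * deriv G z with hF
  set k : ℝ → ℝ := fun z => M * (z ^ (1 - s) / (1 - s)) with hk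
  have hFd : ∀ z ∈ Set.Ioo (0 : ℝ) 1, HasDerivAt F (-lam * ((z * (1 - z)) ^ (-s) * G z)) z := by
    intro z hz
    have hq : 0 < z * (1 - z) := mul_pos hz.1 (by linarith [hz.2])
    have h1 : HasDerivAt (fun z : ℝ => z * (1 - z)) (1 * (1 - z) + z * (-1)) z :=
      (hasDerivAt_id' z).fun_mul ((hasDerivAt_id' z).const_sub 1)
    have h2 := (h1.rpow_const (p := 1 - s) (Or.inl hq.ne')).fun_mul (hG.hasDerivAt_deriv hz)
    refine h2.congr_deriv ?_
    have e1 : (z * (1 - z)) ^ (1 - s) = (z * (1 - z)) ^ (-s) * (z * (1 - z)) := by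
      rw [← Real.rpow_add_one hq.ne']; ring_nf
    rw [e1, show 1 - s - 1 = -s by ring]
    linear_combination (z * (1 - z)) ^ (-s) * hG.ode z hz
  have hkd : ∀ z ∈ Set.Ioo (0 : ℝ) 1, HasDerivAt k (M * z ^ (-s)) z := by
    intro z hz
    have h2 := ((Real.hasDerivAt_rpow_const (p := 1 - s) (Or.inl hz.1.ne')).div_const
      (1 - s)).const_mul M
    refine h2.congr_deriv ?_
    have : 1 - s ≠ 0 := by linarith
    rw [show 1 - s - 1 = -s by ring]
    field_simp
  have hbound : ∀ z ∈ Set.Ioo (0 : ℝ) (1 / 2),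
      |(-lam * ((z * (1 - z)) ^ (-s) * G z))| ≤ M * z ^ (-s) := by
    intro z hz
    have h1 : (z * (1 - z)) ^ (-s) = z ^ (-s) * (1 - z) ^ (-s) :=
      Real.mul_rpow hz.1.le (by linarith [hz.2])
    have h2 : (1 - z) ^ (-s) ≤ (1 / 2 : ℝ) ^ (-s) :=
      Real.rpow_le_rpow_of_nonpos (by norm_num) (by linarith [hz.2]) (by linarith)
    have h3 : |G z| ≤ g := hg z ⟨hz.1.le, by linarith [hz.2]⟩
    have h4 : 0 ≤ z ^ (-s) := Real.rpow_nonneg hz.1.le _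
    have h5 : 0 ≤ (1 - z) ^ (-s) := Real.rpow_nonneg (by linarith [hz.2]) _
    rw [abs_mul, abs_neg, abs_mul, h1, abs_of_nonneg (mul_nonneg h4 h5), hM]
    calc |lam| * (z ^ (-s) * (1 - z) ^ (-s) * |G z|)
        = |lam| * (z ^ (-s) * ((1 - z) ^ (-s) * |G z|)) := by ring
      _ ≤ |lam| * (z ^ (-s) * ((1 / 2 : ℝ) ^ (-s) * g)) := by gcongr
      _ = _ := by ring
  have hcont : ∀ f f' : ℝ → ℝ, (∀ z ∈ Set.Ioo (0 : ℝ) 1, HasDerivAt f (f' z) z) →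
      ContinuousOn f (Set.Ioc 0 (1 / 2)) := fun f f' h z hz =>
    (h z ⟨hz.1, by linarith [hz.2]⟩).continuousAt.continuousWithinAt
  have hIoo : ∀ z ∈ Set.Ioo (0 : ℝ) (1 / 2), z ∈ Set.Ioo (0 : ℝ) 1 :=
    fun z hz => ⟨hz.1, by linarith [hz.2]⟩
  have hmono : MonotoneOn (fun z => F z + k z) (Set.Ioc 0 (1 / 2)) := by
    refine monotoneOn_of_deriv_nonneg (convex_Ioc _ _)
      ((hcont F _ hFd).add (hcont k _ hkd)) ?_ ?_ <;> rw [interior_Ioc]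
    · exact fun z hz => ((hFd z (hIoo z hz)).fun_add
        (hkd z (hIoo z hz))).differentiableAt.differentiableWithinAt
    · intro z hz
      rw [((hFd z (hIoo z hz)).fun_add (hkd z (hIoo z hz))).deriv]
      linarith [(abs_le.1 (hbound z hz)).1]
  have hanti : AntitoneOn (fun z => F z - k z) (Set.Ioc 0 (1 / 2)) := by
    refine antitoneOn_of_deriv_nonpos (convex_Ioc _ _)
      ((hcont F _ hFd).sub (hcont k _ hkd)) ?_ ?_ <;> rw [interior_Ioc]
    · exact fun z hz => ((hFd z (hIoo z hz)).fun_sub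
        (hkd z (hIoo z hz))).differentiableAt.differentiableWithinAt
    · intro z hz
      rw [((hFd z (hIoo z hz)).fun_sub (hkd z (hIoo z hz))).deriv]
      linarith [(abs_le.1 (hbound z hz)).2]
  refine ⟨|F (1 / 2)| + k (1 / 2), fun z hz => ?_⟩
  have hz' : z ∈ Set.Ioc (0 : ℝ) (1 / 2) := ⟨hz.1, hz.2.le⟩
  have hm : (1 / 2 : ℝ) ∈ Set.Ioc (0 : ℝ) (1 / 2) := ⟨by norm_num, le_rfl⟩
  have h1 : F z + k z ≤ F (1 / 2) + k (1 / 2) := hmono hz' hm hz.2.le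
  have h2 : F (1 / 2) - k (1 / 2) ≤ F z - k z := hanti hz' hm hz.2.le
  have hkz : 0 ≤ k z := mul_nonneg hM0 (div_nonneg (Real.rpow_nonneg hz.1.le _) (by linarith))
  change |F z| ≤ _
  rw [abs_le]
  constructor <;> linarith [neg_abs_le (F (1 / 2)), le_abs_self (F (1 / 2))]

/-- The bounded flux is multiplied by `z^s (1-z)^(s-1)`, which tends to `0`. -/
lemma IsAngular.tendsto_zero (hs0 : 0 < s) (hs1 : s < 1) (hG : IsAngular s lam G) :
    Tendsto (fun z => z * deriv G z) (𝓝[>] 0) (𝓝 0) := by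
  obtain ⟨B, hB⟩ := hG.exists_bound hs0 hs1
  have h1 : Tendsto (fun z : ℝ => z ^ s * (1 - z) ^ (s - 1)) (𝓝[>] 0) (𝓝 0) := by
    have e1 : ContinuousAt (fun z : ℝ => z ^ s) 0 :=
      Real.continuousAt_rpow_const _ _ (Or.inr hs0.le)
    have e2 : ContinuousAt (fun z : ℝ => (1 - z) ^ (s - 1)) 0 :=
      (continuousAt_const.sub continuousAt_id).rpow_const (Or.inl (by norm_num))
    have := (e1.fun_mul e2).tendsto
    simp only [Real.zero_rpow hs0.ne', zero_mul] at this
    exact this.mono_left nhdsWithin_le_nhds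
  have h2 := (h1.mul_const B)
  rw [zero_mul] at h2
  refine squeeze_zero_norm' ?_ h2
  filter_upwards [Ioo_mem_nhdsGT (show (0 : ℝ) < 1 / 2 by norm_num)] with z hz
  have hz1 : 0 < 1 - z := by linarith [hz.2]
  have e : z * deriv G z = z ^ s * (1 - z) ^ (s - 1) *
      ((z * (1 - z)) ^ (1 - s) * deriv G z) := by
    have e1 : z ^ s * z ^ (1 - s) = z := by
      rw [← Real.rpow_add hz.1]; simp
    have e2 : (1 - z) ^ (s - 1) * (1 - z) ^ (1 - s) = 1 := by
      rw [← Real.rpow_add hz1]; simp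
    rw [Real.mul_rpow hz.1.le hz1.le]
    linear_combination (-(z ^ s * z ^ (1 - s)) * deriv G z) * e2 - deriv G z * e1
  have hp : 0 ≤ z ^ s * (1 - z) ^ (s - 1) :=
    mul_nonneg (Real.rpow_nonneg hz.1.le _) (Real.rpow_nonneg hz1.le _)
  rw [e, norm_mul, Real.norm_of_nonneg hp]
  exact mul_le_mul_of_nonneg_left (hB z hz) hp

/-! ### Weighted moments of angular functions. -/

lemma intervalIntegrable_weight (hs1 : s < 1) :
    IntervalIntegrable (fun z : ℝ => (1 - z) ^ (-s)) MeasureTheory.volume 0 1 := by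
  have h := (intervalIntegral.intervalIntegrable_rpow' (r := -s) (by linarith)
    (a := 1) (b := 0)).comp_sub_left 1
  simpa using h

lemma intervalIntegrable_weight_mul (hs1 : s < 1) {f : ℝ → ℝ}
    (hf : ContinuousOn f (Set.Icc 0 1)) :
    IntervalIntegrable (fun z : ℝ => (1 - z) ^ (-s) * f z) MeasureTheory.volume 0 1 :=
  (intervalIntegrable_weight hs1).mul_continuousOn (by rwa [Set.uIcc_of_le zero_le_one])

/-- The weighted moments of `G`. -/
noncomputable def moment (s : ℝ) (G : ℝ → ℝ) (j : ℕ) : ℝ :=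
  ∫ z in (0 : ℝ)..1, (1 - z) ^ (-s) * (G z * z ^ j)

/-- Test the equation, in its self-adjoint weight `(z(1-z))^(-s)`, against `z^(s+j)`: the angular
operator maps this power to `-(s+j)(j+1-s) z^(s+j) + j(s+j) z^(s+j-1)`. The function differentiated
in `hW` is the corresponding Wronskian flux. It vanishes at `0` by the Dirichlet condition and
`IsAngular.tendsto_zero`, and at `1` by the Neumann condition. For `j = 0` the truncated index `j -
1` is harmless, its coefficient being zero. -/
lemma IsAngular.moment_rec (hs0 : 0 < s) (hs1 : s < 1) (hG : IsAngular s lam G) (j : ℕ) :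
    ((s + j) * (j + 1 - s) - lam) * moment s G j = j * (s + j) * moment s G (j - 1) := by
  have hcj : ∀ j : ℕ, ContinuousOn (fun z => G z * z ^ j) (Set.Icc 0 1) := fun j =>
    hG.continuousOn.fun_mul (continuous_pow j).continuousOn
  have hint := fun j => intervalIntegrable_weight_mul hs1 (hcj j)
  have hW : ∀ z ∈ Set.Ioo (0 : ℝ) 1, HasDerivAt
      (fun z => (1 - z) ^ (1 - s) * (z ^ (j + 1) * deriv G z - (s + j) * (z ^ j * G z)))
      (((s + j) * (j + 1 - s) - lam) * ((1 - z) ^ (-s) * (G z * z ^ j)) -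
        j * (s + j) * ((1 - z) ^ (-s) * (G z * z ^ (j - 1)))) z := by
    intro z hz
    have hz1 : 0 < 1 - z := by linarith [hz.2]
    have h1 := ((hasDerivAt_id' z).const_sub 1).rpow_const (p := 1 - s) (Or.inl hz1.ne')
    have h2 := ((hasDerivAt_pow (j + 1) z).fun_mul (hG.hasDerivAt_deriv hz)).fun_sub
      (((hasDerivAt_pow j z).fun_mul (hG.hasDerivAt hz)).const_mul (s + j))
    refine (h1.fun_mul h2).congr_deriv ?_
    have e1 : (1 - z) ^ (1 - s) = (1 - z) ^ (-s) * (1 - z) := by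
      rw [← Real.rpow_add_one hz1.ne']; ring_nf
    have e2 : (j : ℝ) * z ^ j = j * z ^ (j - 1) * z := by
      rcases j with _ | j
      · simp
      · simp [pow_succ]; ring
    rw [e1, show 1 - s - 1 = -s by ring]
    push_cast
    linear_combination (1 - z) ^ (-s) * z ^ j * hG.ode z hz -
      (1 - z) ^ (-s) * (s + j) * G z * e2
  have h0 : Tendsto
      (fun z => (1 - z) ^ (1 - s) * (z ^ (j + 1) * deriv G z - (s + j) * (z ^ j * G z)))
      (𝓝[>] 0) (𝓝 0) := by
    have a1 : Tendsto (fun z : ℝ => (1 - z) ^ (1 - s)) (𝓝[>] 0) (𝓝 ((1 - 0) ^ (1 - s))) :=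
      ((continuousAt_const.sub continuousAt_id).rpow_const
        (Or.inl (by norm_num))).tendsto.mono_left nhdsWithin_le_nhds
    have a2 : Tendsto (fun z : ℝ => z ^ j) (𝓝[>] 0) (𝓝 (0 ^ j)) :=
      ((continuous_pow j).tendsto 0).mono_left nhdsWithin_le_nhds
    have a3 := hG.tendsto_zero hs0 hs1
    have a4 : Tendsto G (𝓝[>] 0) (𝓝 0) := by
      have := hG.continuousOn 0 (by simp)
      rw [ContinuousWithinAt, hG.zero] at this
      refine this.mono_left ?_
      rw [← nhdsWithin_Ioo_eq_nhdsGT (zero_lt_one' ℝ)]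
      exact nhdsWithin_mono _ Set.Ioo_subset_Icc_self
    have a5 := a1.mul ((a2.mul a3).sub ((a2.mul a4).const_mul (s + j)))
    simp only [mul_zero, sub_zero] at a5
    refine a5.congr fun z => ?_
    ring
  have h1 : Tendsto
      (fun z => (1 - z) ^ (1 - s) * (z ^ (j + 1) * deriv G z - (s + j) * (z ^ j * G z)))
      (𝓝[<] 1) (𝓝 0) := by
    have a1 : Tendsto (fun z : ℝ => (1 - z) ^ (1 - s)) (𝓝[<] 1) (𝓝 ((1 - 1) ^ (1 - s))) :=
      ((continuousAt_const.sub continuousAt_id).rpow_const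
        (Or.inr (by linarith))).tendsto.mono_left nhdsWithin_le_nhds
    rw [sub_self, Real.zero_rpow (by linarith)] at a1
    have a2 : ∀ j : ℕ, Tendsto (fun z : ℝ => z ^ j) (𝓝[<] 1) (𝓝 (1 ^ j)) := fun j =>
      ((continuous_pow j).tendsto 1).mono_left nhdsWithin_le_nhds
    have a3 : Tendsto (fun z : ℝ => z ^ (s - 1)) (𝓝[<] 1) (𝓝 (1 ^ (s - 1))) :=
      (Real.continuousAt_rpow_const _ _ (Or.inl one_ne_zero)).tendsto.mono_left
        nhdsWithin_le_nhds
    have a4 : Tendsto G (𝓝[<] 1) (𝓝 (G 1)) := by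
      have := hG.continuousOn 1 (by simp)
      refine Tendsto.mono_left this ?_
      rw [← nhdsWithin_Ioo_eq_nhdsLT (zero_lt_one' ℝ)]
      exact nhdsWithin_mono _ Set.Ioo_subset_Icc_self
    have a5 := ((a2 (j + 1)).mul (a3.mul hG.neumann)).sub
      ((a1.mul ((a2 j).mul a4)).const_mul (s + j))
    simp only [mul_zero, zero_mul, sub_zero] at a5
    refine a5.congr' ?_
    filter_upwards [Ioo_mem_nhdsLT (zero_lt_one' ℝ)] with z hz
    have hz1 : 0 < 1 - z := by linarith [hz.2]
    have e : z ^ (s - 1) * z ^ (1 - s) = 1 := by rw [← Real.rpow_add hz.1]; simp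
    rw [Real.mul_rpow hz.1.le hz1.le]
    linear_combination z ^ (j + 1) * (1 - z) ^ (1 - s) * deriv G z * e
  have h := intervalIntegral.integral_eq_sub_of_hasDerivAt_of_tendsto zero_lt_one hW
    (((hint j).const_mul _).sub ((hint (j - 1)).const_mul _)) h0 h1
  rw [intervalIntegral.integral_sub ((hint j).const_mul _) ((hint (j - 1)).const_mul _),
    intervalIntegral.integral_const_mul, intervalIntegral.integral_const_mul, sub_zero] at h
  simp only [moment]
  linarith

lemma integral_weight_mul_poly (hs1 : s < 1) (hG : ContinuousOn G (Set.Icc 0 1))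
    (hm : ∀ j, moment s G j = 0) (p : Polynomial ℝ) :
    ∫ z in (0 : ℝ)..1, (1 - z) ^ (-s) * (G z * p.eval z) = 0 := by
  have e : ∀ z : ℝ, (1 - z) ^ (-s) * (G z * p.eval z) = ∑ j ∈ Finset.range (p.natDegree + 1),
      p.coeff j * ((1 - z) ^ (-s) * (G z * z ^ j)) := by
    intro z
    rw [Polynomial.eval_eq_sum_range, Finset.mul_sum, Finset.mul_sum]
    exact Finset.sum_congr rfl fun j _ => by ring
  simp only [e]
  rw [intervalIntegral.integral_finsetSum]
  · refine Finset.sum_eq_zero fun j _ => ?_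
    rw [intervalIntegral.integral_const_mul]
    exact mul_eq_zero_of_right _ (hm j)
  · exact fun j _ => (intervalIntegrable_weight_mul hs1
      (hG.fun_mul (continuous_pow j).continuousOn)).const_mul _

/-- A continuous function with vanishing weighted moments is zero. -/
lemma eq_zero_of_moments (hs1 : s < 1) (hG : ContinuousOn G (Set.Icc 0 1))
    (hm : ∀ j, moment s G j = 0) : ∀ z ∈ Set.Icc (0 : ℝ) 1, G z = 0 := by
  have hint := intervalIntegrable_weight_mul hs1 (hG.fun_mul hG)
  have hintabs := intervalIntegrable_weight_mul hs1 hG.abs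
  have hw : ∀ z ∈ Set.Icc (0 : ℝ) 1, 0 ≤ (1 - z) ^ (-s) := fun z hz =>
    Real.rpow_nonneg (by linarith [hz.2]) _
  set I : ℝ := ∫ z in (0 : ℝ)..1, (1 - z) ^ (-s) * |G z| with hI
  have hI0 : 0 ≤ I := intervalIntegral.integral_nonneg zero_le_one fun z hz =>
    mul_nonneg (hw z hz) (abs_nonneg _)
  -- `G` is orthogonal to all polynomials, so its weighted square integral equals that of `G (G -
  -- p)`, which is small once `p` approximates `G` uniformly.
  have hle : ∫ z in (0 : ℝ)..1, (1 - z) ^ (-s) * (G z * G z) ≤ 0 := by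
    refine le_of_forall_pos_le_add fun ε hε => ?_
    obtain ⟨p, hp⟩ := exists_polynomial_near_of_continuousOn 0 1 G hG (ε / (I + 1))
      (by positivity)
    have hintp := intervalIntegrable_weight_mul hs1 (hG.fun_mul p.continuous.continuousOn)
    have h1 : ∫ z in (0 : ℝ)..1, (1 - z) ^ (-s) * (G z * G z) =
        ∫ z in (0 : ℝ)..1,
          ((1 - z) ^ (-s) * (G z * G z) - (1 - z) ^ (-s) * (G z * p.eval z)) := by
      rw [intervalIntegral.integral_sub hint hintp, integral_weight_mul_poly hs1 hG hm, sub_zero]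
    have h2 : ∫ z in (0 : ℝ)..1,
          ((1 - z) ^ (-s) * (G z * G z) - (1 - z) ^ (-s) * (G z * p.eval z)) ≤
        ∫ z in (0 : ℝ)..1, ε / (I + 1) * ((1 - z) ^ (-s) * |G z|) := by
      refine intervalIntegral.integral_mono_on zero_le_one (hint.sub hintp)
        (hintabs.const_mul _) fun z hz => ?_
      have h3 : G z * (G z - p.eval z) ≤ |G z| * (ε / (I + 1)) := by
        refine (le_abs_self _).trans ?_
        rw [abs_mul, abs_sub_comm]
        exact mul_le_mul_of_nonneg_left (hp z hz).le (abs_nonneg _)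
      have h4 := mul_le_mul_of_nonneg_left h3 (hw z hz)
      calc _ = (1 - z) ^ (-s) * (G z * (G z - p.eval z)) := by ring
        _ ≤ _ := h4
        _ = _ := by ring
    rw [intervalIntegral.integral_const_mul, ← hI] at h2
    rw [h1, zero_add]
    refine h2.trans ?_
    rw [div_mul_eq_mul_div, div_le_iff₀ (by positivity)]
    nlinarith
  have hge : 0 ≤ ∫ z in (0 : ℝ)..1, (1 - z) ^ (-s) * (G z * G z) :=
    intervalIntegral.integral_nonneg zero_le_one fun z hz =>
      mul_nonneg (hw z hz) (mul_self_nonneg _)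
  have hzero := le_antisymm hle hge
  rw [intervalIntegral.integral_of_le zero_le_one, MeasureTheory.integral_Ioc_eq_integral_Ioo,
    MeasureTheory.setIntegral_eq_zero_iff_of_nonneg_ae] at hzero
  · have hae : G =ᵐ[MeasureTheory.volume.restrict (Set.Ioo (0 : ℝ) 1)] fun _ => 0 := by
      filter_upwards [hzero, MeasureTheory.ae_restrict_mem measurableSet_Ioo] with z h1 hz
      have hp : 0 < (1 - z) ^ (-s) := Real.rpow_pos_of_pos (by linarith [hz.2]) _
      exact mul_self_eq_zero.1 ((mul_eq_zero.1 h1).resolve_left hp.ne')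
    have h1 := MeasureTheory.Measure.eqOn_open_of_ae_eq hae isOpen_Ioo
      (hG.mono Set.Ioo_subset_Icc_self) continuousOn_const
    have h2 : Set.EqOn G (fun _ => 0) (Set.Icc 0 1) :=
      h1.of_subset_closure hG continuousOn_const Set.Ioo_subset_Icc_self
        (by rw [closure_Ioo zero_ne_one])
    exact h2
  · filter_upwards [MeasureTheory.ae_restrict_mem measurableSet_Ioo] with z hz
    exact mul_nonneg (hw z (Set.Ioo_subset_Icc_self hz)) (mul_self_nonneg _)
  · rw [← intervalIntegrable_iff_integrableOn_Ioo_of_le zero_le_one]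
    exact hint

lemma isAngular_angFun (hs0 : 0 < s) (hs1 : s < 1) (m : ℕ) :
    IsAngular s ((s + m) * (m + 1 - s)) (angFun s m) where
  continuousOn := ((Real.continuous_rpow_const hs0.le).mul
    (hyperPoly s m).continuous).continuousOn
  contDiffAt z hz := contDiffAt_angFun s m hz.1
  zero := by simp [angFun, Real.zero_rpow hs0.ne']
  ode z hz := angFun_ode hs0 m hz.1
  neumann := by
    have h1 : ContinuousAt (deriv (angFun s m)) 1 :=
      (differentiableAt_deriv (contDiffAt_angFun s m one_pos)).continuousAt
    have h2 : ContinuousAt (fun z : ℝ => (z * (1 - z)) ^ (1 - s)) 1 :=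
      (continuousAt_id.mul (continuousAt_const.sub continuousAt_id)).rpow_const
        (Or.inr (by linarith))
    have h := (h2.fun_mul h1).tendsto
    simp only [sub_self, mul_zero, Real.zero_rpow (show 1 - s ≠ 0 by linarith), zero_mul] at h
    exact h.mono_left nhdsWithin_le_nhds

lemma moment_sub_mul (hs1 : s < 1) (hG : ContinuousOn G (Set.Icc 0 1))
    (hH : ContinuousOn H (Set.Icc 0 1)) (c : ℝ) (j : ℕ) :
    moment s (fun z => G z - c * H z) j = moment s G j - c * moment s H j := by
  have h1 := intervalIntegrable_weight_mul hs1 (hG.fun_mul (continuous_pow j).continuousOn)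
  have h2 := intervalIntegrable_weight_mul hs1 (hH.fun_mul (continuous_pow j).continuousOn)
  rw [moment, moment, moment, ← intervalIntegral.integral_const_mul,
    ← intervalIntegral.integral_sub h1 (h2.const_mul c)]
  congr 1
  funext z
  ring

/-- The moments before a resonance vanish, and so do those after it once the resonant one does. -/
lemma IsAngular.moments_eq_zero (hs0 : 0 < s) (hs1 : s < 1) (hG : IsAngular s lam G)
    (h : ∀ j : ℕ, (s + j) * (j + 1 - s) = lam → moment s G j = 0) : ∀ j, moment s G j = 0 := by
  intro j
  induction j with
  | zero =>
    by_cases hj : (s + (0 : ℕ)) * ((0 : ℕ) + 1 - s) = lam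
    · exact h 0 hj
    · have hr := hG.moment_rec hs0 hs1 0
      rw [Nat.cast_zero, zero_mul, zero_mul] at hr
      exact (mul_eq_zero.1 hr).resolve_left (sub_ne_zero.2 (by simpa using hj))
  | succ j ih =>
    by_cases hj : (s + (j + 1 : ℕ)) * ((j + 1 : ℕ) + 1 - s) = lam
    · exact h _ hj
    · have hr := hG.moment_rec hs0 hs1 (j + 1)
      rw [Nat.add_sub_cancel, ih, mul_zero] at hr
      exact (mul_eq_zero.1 hr).resolve_left (sub_ne_zero.2 hj)

lemma eigenvalue_injective {i j : ℕ}
    (h : (s + i) * ((i : ℝ) + 1 - s) = (s + j) * (j + 1 - s)) : i = j := by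
  have h1 : ((i : ℝ) - j) * (i + j + 1) = 0 := by linarith
  have h2 := (mul_eq_zero.1 h1).resolve_right (by positivity)
  exact_mod_cast sub_eq_zero.1 h2

/-- Classification of the angular functions. -/
theorem IsAngular.classification (hs0 : 0 < s) (hs1 : s < 1) {μ : ℝ} (hμ : 0 < μ)
    (hG : IsAngular s (μ * (μ + 1 - 2 * s)) G) :
    (∀ z ∈ Set.Icc (0 : ℝ) 1, G z = 0) ∨
      ∃ m : ℕ, μ = s + m ∧ ∃ a : ℝ, ∀ z ∈ Set.Icc (0 : ℝ) 1, G z = a * angFun s m z := by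
  by_cases hex : ∃ m : ℕ, (s + m) * ((m : ℝ) + 1 - s) = μ * (μ + 1 - 2 * s)
  · right
    obtain ⟨m, hm⟩ := hex
    refine ⟨m, ?_, ?_⟩
    -- The difference of the two parameters factors, and the second factor is positive because `μ >
    -- 0` and `s < 1`.
    · have h1 : (μ - (s + m)) * (μ + m + 1 - s) = 0 := by linarith
      have h2 : μ + m + 1 - s ≠ 0 := by
        have : (0 : ℝ) ≤ m := Nat.cast_nonneg m
        linarith
      exact sub_eq_zero.1 ((mul_eq_zero.1 h1).resolve_right h2)
    · have hA := isAngular_angFun hs0 hs1 m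
      -- If its resonant moment vanished, so would all its moments and hence `angFun` itself; but
      -- near `0` it is `z^s` times a factor close to `1`.
      have hA0 : moment s (angFun s m) m ≠ 0 := by
        intro h0
        have h1 := hA.moments_eq_zero hs0 hs1 fun j hj => by
          rw [eigenvalue_injective hj]; exact h0
        have h2 := eq_zero_of_moments hs1 hA.continuousOn h1
        have h3 : ∀ᶠ z in 𝓝[>] (0 : ℝ), (hyperPoly s m).eval z ≠ 0 := by
          have := (hyperPoly s m).continuous.tendsto 0
          rw [hyperPoly_eval_zero] at this
          exact (this.mono_left nhdsWithin_le_nhds).eventually_ne one_ne_zero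
        obtain ⟨z, hz, hz'⟩ := (h3.and (Ioo_mem_nhdsGT (zero_lt_one' ℝ))).exists
        have h4 := h2 z (Set.Ioo_subset_Icc_self hz')
        exact hz ((mul_eq_zero.1 h4).resolve_left (Real.rpow_pos_of_pos hz'.1 _).ne')
      rw [← hm] at hG
      -- This multiple kills the only moment of the difference that the recursion leaves
      -- undetermined.
      refine ⟨moment s G m / moment s (angFun s m) m, ?_⟩
      have hD := hG.sub_mul hA (moment s G m / moment s (angFun s m) m)
      have h1 := hD.moments_eq_zero hs0 hs1 fun j hj => by
        rw [eigenvalue_injective hj, moment_sub_mul hs1 hG.continuousOn hA.continuousOn]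
        field_simp
        ring
      intro z hz
      exact sub_eq_zero.1 (eq_zero_of_moments hs1 hD.continuousOn h1 z hz)
  · left
    exact eq_zero_of_moments hs1 hG.continuousOn
      (hG.moments_eq_zero hs0 hs1 fun j hj => absurd ⟨j, hj⟩ hex)

end AngularClassification

/-! ### Solutions independent of the tangential variables -/

/-- Along a ray towards the origin the absolute value does not decrease, while continuity and the
Dirichlet condition force the limit `0`. -/
lemma eq_zero_of_homogeneous_nonpos {s μ : ℝ} (hμ : μ ≤ 0) {c : Pt d → ℝ}
    (hc : IsAdmissible s c) (hh : IsHomogeneousHalf μ c) : ∀ x ∈ closedHalf d, c x = 0 := by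
  intro x hx
  have h0 : c 0 = 0 := hc.dirichlet 0 rfl le_rfl
  have hm : (0 : Pt d) ∈ closedHalf d := le_refl (0 : ℝ)
  have hsm : Tendsto (fun r : ℝ => r • x) (𝓝[>] 0) (𝓝[closedHalf d] 0) := by
    refine tendsto_nhdsWithin_iff.2 ⟨?_, ?_⟩
    · have : Tendsto (fun r : ℝ => r • x) (𝓝 0) (𝓝 ((0 : ℝ) • x)) :=
        (continuous_id.smul continuous_const).tendsto 0
      rw [zero_smul] at this
      exact this.mono_left nhdsWithin_le_nhds
    · filter_upwards [self_mem_nhdsWithin] with r hr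
      exact mul_nonneg (le_of_lt hr) (show 0 ≤ xlast x from hx)
  have h1 : Tendsto (fun r : ℝ => |c (r • x)|) (𝓝[>] 0) (𝓝 |c 0|) :=
    ((hc.continuousOn 0 hm).tendsto.comp hsm).abs
  rw [h0, abs_zero] at h1
  have h2 : ∀ᶠ r : ℝ in 𝓝[>] 0, |c x| ≤ |c (r • x)| := by
    filter_upwards [Ioo_mem_nhdsGT (zero_lt_one' ℝ)] with r hr
    rw [hh x hx r hr.1, abs_mul, abs_of_pos (Real.rpow_pos_of_pos hr.1 _)]
    exact le_mul_of_one_le_left (abs_nonneg _)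
      (Real.one_le_rpow_of_pos_of_le_one_of_nonpos hr.1 hr.2.le hμ)
  exact abs_eq_zero.1 (le_antisymm (ge_of_tendsto h1 h2) (abs_nonneg _))

/-! ### Reduction of planar solutions to the angular problem. -/

/-- The unit half-circle, parametrised by the angular variable. -/
noncomputable def arc (d : ℕ) (z : ℝ) : Pt d := mkPt 0 (2 * z - 1) (2 * Real.sqrt (z * (1 - z)))

lemma rad_arc {z : ℝ} (hz : z ∈ Set.Icc (0 : ℝ) 1) : rad (arc d z) = 1 := by
  have h : 0 ≤ z * (1 - z) := mul_nonneg hz.1 (by linarith [hz.2])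
  rw [rad, arc, xn_mkPt, xlast_mkPt, mul_pow, Real.sq_sqrt h, Real.sqrt_eq_one]
  ring

lemma ang_arc {z : ℝ} (hz : z ∈ Set.Icc (0 : ℝ) 1) : ang (arc d z) = z := by
  rw [ang, rad_arc hz, arc, xn_mkPt]; ring

lemma arc_mem_closedHalf (z : ℝ) : arc d z ∈ closedHalf d := by
  change 0 ≤ xlast _
  rw [arc, xlast_mkPt]; positivity

lemma arc_mem_openHalf {z : ℝ} (hz : z ∈ Set.Ioo (0 : ℝ) 1) : arc d z ∈ openHalf d := by
  change 0 < xlast _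
  rw [arc, xlast_mkPt]
  have : 0 < z * (1 - z) := mul_pos hz.1 (by linarith [hz.2])
  positivity

lemma continuous_arc : Continuous (arc d) := by
  refine continuous_pi (forall_coord.2 ⟨fun j => ?_, ?_, ?_⟩)
  · simp only [arc, mkPt_apply_tang]; exact continuous_const
  · simp only [arc, mkPt_apply_xn]; fun_prop
  · simp only [arc, mkPt_apply_last]; fun_prop

lemma contDiffAt_arc {z : ℝ} (hz : z ∈ Set.Ioo (0 : ℝ) 1) : ContDiffAt ℝ 2 (arc d) z := by
  have : z * (1 - z) ≠ 0 := (mul_pos hz.1 (by linarith [hz.2])).ne'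
  refine contDiffAt_pi.2 (forall_coord.2 ⟨fun j => ?_, ?_, ?_⟩)
  · simp only [arc, mkPt_apply_tang]; exact contDiffAt_const
  · simp only [arc, mkPt_apply_xn]; fun_prop
  · simp only [arc, mkPt_apply_last]
    exact contDiffAt_const.mul ((contDiffAt_id.mul (contDiffAt_const.sub contDiffAt_id)).sqrt this)

lemma ang_mem_Icc {x : Pt d} (hx : 0 < rad x) : ang x ∈ Set.Icc (0 : ℝ) 1 := by
  have h1 : -1 ≤ xn x / rad x := by rw [le_div_iff₀ hx]; linarith [neg_xn_le_rad x]
  have h2 : xn x / rad x ≤ 1 := by rw [div_le_iff₀ hx]; linarith [xn_le_rad x]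
  constructor <;> simp only [ang] <;> linarith

lemma TangIndep.eq_polar {μ : ℝ} {c : Pt d → ℝ} (hi : TangIndep c) (hh : IsHomogeneousHalf μ c)
    {x : Pt d} (hx : x ∈ closedHalf d) (hr : 0 < rad x) :
    c x = rad x ^ μ * c (arc d (ang x)) := by
  have hy : 0 ≤ xlast x := hx
  rw [← hh _ (arc_mem_closedHalf _) _ hr]
  refine hi _ _ ?_ ?_
  · rw [xn_smul, arc, xn_mkPt, ang]; field_simp; ring
  · have e : ang x * (1 - ang x) = (xlast x / (2 * rad x)) ^ 2 := by
      have := rad_sq x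
      rw [ang]; field_simp; nlinarith
    rw [xlast_smul, arc, xlast_mkPt, e, Real.sqrt_sq (by positivity)]
    field_simp

lemma eq_zero_of_rad_eq_zero {s : ℝ} {c : Pt d → ℝ} (hc : IsAdmissible s c) {x : Pt d}
    (hx : rad x = 0) : c x = 0 := by
  have h := rad_sq x
  rw [hx] at h
  refine hc.dirichlet x ?_ ?_
  · nlinarith [sq_nonneg (xn x), sq_nonneg (xlast x)]
  · nlinarith [sq_nonneg (xn x), sq_nonneg (xlast x)]

/-- The Neumann condition concerns vertical lines, the angular one the unit circle. On the vertical
line over `x_n = 1` homogeneity gives `c = ψ^μ G(Z)`, so the vertical derivative is the angular one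
up to smooth nonvanishing factors and a radial term with an extra factor `t`. -/
lemma tendsto_neumann_arc {s μ : ℝ} (hs1 : s < 1) {c : Pt d → ℝ}
    (hc : IsAdmissible s c) (hi : TangIndep c) (hh : IsHomogeneousHalf μ c)
    (hG : ∀ z ∈ Set.Ioo (0 : ℝ) 1, DifferentiableAt ℝ (fun z => c (arc d z)) z) :
    Tendsto (fun z => (z * (1 - z)) ^ (1 - s) * deriv (fun z => c (arc d z)) z)
      (𝓝[<] 1) (𝓝 0) := by
  set G : ℝ → ℝ := fun z => c (arc d z) with hGdef
  set x : Pt d := mkPt 0 1 0 with hx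
  set ψ : ℝ → ℝ := fun t => Real.sqrt (1 + t ^ 2) with hψ
  set Z : ℝ → ℝ := fun t => (1 / ψ t + 1) / 2 with hZ
  set D : ℝ → ℝ := fun t =>
    pd (Fin.last (d + 1)) c (Function.update x (Fin.last (d + 1)) t) with hD
  have hψpos : ∀ t, 0 < ψ t := fun t => Real.sqrt_pos.2 (by positivity)
  have hψsq : ∀ t, ψ t ^ 2 = 1 + t ^ 2 := fun t => Real.sq_sqrt (by positivity)
  have hψc : Continuous ψ := by simp only [hψ]; fun_prop
  have hradx : ∀ t, rad (Function.update x (Fin.last (d + 1)) t) = ψ t := by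
    intro t; simp [rad, hψ, hx]
  have hangx : ∀ t, ang (Function.update x (Fin.last (d + 1)) t) = Z t := by
    intro t; rw [ang, hradx, xn_update_last, hx, xn_mkPt]
  have hmem : ∀ t, 0 ≤ t → Function.update x (Fin.last (d + 1)) t ∈ closedHalf d := by
    intro t ht
    change 0 ≤ xlast _
    rwa [xlast_update_last]
  have hcx : ∀ t, 0 ≤ t → c (Function.update x (Fin.last (d + 1)) t) = ψ t ^ μ * G (Z t) := by
    intro t ht
    rw [hi.eq_polar hh (hmem t ht) (by rw [hradx]; exact hψpos t), hradx, hangx]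
  have hZmem : ∀ t, 0 < t → Z t ∈ Set.Ioo (0 : ℝ) 1 := by
    intro t ht
    rw [← hangx]
    exact ang_mem_Ioo (update_last_mem_openHalf x ht)
  have hψd : ∀ t, HasDerivAt ψ (t / ψ t) t := by
    intro t
    have h := (((hasDerivAt_id' t).fun_pow 2).const_add 1).sqrt (by positivity)
    refine h.congr_deriv ?_
    have := (hψpos t).ne'
    simp only [hψ] at this ⊢
    field_simp
    norm_num
  have hDt : ∀ t, 0 < t → D t = μ * ψ t ^ (μ - 1) * (t / ψ t) * G (Z t) +
      ψ t ^ μ * (deriv G (Z t) * (-(t / ψ t) / ψ t ^ 2 / 2)) := by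
    intro t ht
    have e1 := hasDerivAt_slice (f := c) (x := x) (j := Fin.last (d + 1)) (t := t)
      (differentiableAt_of_contDiffAt (hc.contDiffAt (update_last_mem_openHalf x ht)))
    have hZd : HasDerivAt Z (-(t / ψ t) / ψ t ^ 2 / 2) t := by
      have h := (((hψd t).fun_inv (hψpos t).ne').add_const 1).div_const 2
      simpa only [hZ, one_div] using h
    have e2 := ((hψd t).rpow_const (p := μ) (Or.inl (hψpos t).ne')).fun_mul
      ((hG _ (hZmem t ht)).hasDerivAt.comp t hZd)
    have e3 : (fun r => c (Function.update x (Fin.last (d + 1)) r)) =ᶠ[𝓝 t]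
        fun r => ψ r ^ μ * (G ∘ Z) r := by
      filter_upwards [isOpen_Ioi.mem_nhds ht] with r hr using hcx r (le_of_lt hr)
    rw [hD]
    refine (e1.congr_of_eventuallyEq e3.symm).unique (e2.congr_deriv ?_)
    simp only [Function.comp]
    ring
  have hZq : ∀ t, Z t * (1 - Z t) = (t / (2 * ψ t)) ^ 2 := by
    intro t
    have h1 := hψsq t
    have h2 := (hψpos t).ne'
    simp only [hZ]
    field_simp
    nlinarith
  -- This solves `hDt` for `G'`, using `Z (1 - Z) = (t / (2ψ))²`. The radial correction carries `t ^
  -- (2 - 2s)`, which tends to `0`.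
  have hkey : ∀ t, 0 < t → (Z t * (1 - Z t)) ^ (1 - s) * deriv G (Z t) =
      (2 * ψ t) ^ (2 * s - 2) * (-2 * ψ t ^ (3 - μ)) *
        (t ^ (1 - 2 * s) * D t - t ^ (2 - 2 * s) *
          (μ * ψ t ^ (-2 : ℝ) * c (Function.update x (Fin.last (d + 1)) t))) := by
    intro t ht
    have hp := hψpos t
    have q1 : (Z t * (1 - Z t)) ^ (1 - s) = t ^ (2 - 2 * s) * (2 * ψ t) ^ (2 * s - 2) := by
      rw [hZq, ← Real.rpow_natCast, ← Real.rpow_mul (by positivity),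
        show ((2 : ℕ) : ℝ) * (1 - s) = 2 - 2 * s by push_cast; ring,
        Real.div_rpow ht.le (by positivity), div_eq_mul_inv, ← Real.rpow_neg (by positivity)]
      ring_nf
    have q2 : t ^ (2 - 2 * s) = t ^ (1 - 2 * s) * t := by
      rw [← Real.rpow_add_one ht.ne']; ring_nf
    have q3 : ψ t ^ (3 - μ) * ψ t ^ μ = ψ t ^ 3 := by
      rw [← Real.rpow_add hp, ← Real.rpow_natCast]; norm_num
    have q4 : ψ t ^ (μ - 1) = ψ t ^ μ / ψ t := by rw [Real.rpow_sub_one hp.ne']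
    have q5 : ψ t ^ (-2 : ℝ) = (ψ t ^ 2)⁻¹ := by
      rw [Real.rpow_neg hp.le]; norm_num
    rw [q1, q2, hDt t ht, hcx t ht.le, q4, q5]
    field_simp
    linear_combination (-deriv G (Z t)) * q3
  have hlim : Tendsto (fun t => (Z t * (1 - Z t)) ^ (1 - s) * deriv G (Z t)) (𝓝[>] 0) (𝓝 0) := by
    have l1 : ContinuousAt (fun t => (2 * ψ t) ^ (2 * s - 2) * (-2 * ψ t ^ (3 - μ))) 0 := by
      have hp := hψpos 0
      exact ((continuousAt_const.mul hψc.continuousAt).rpow_const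
        (Or.inl (mul_pos two_pos hp).ne')).mul (continuousAt_const.mul
          (hψc.continuousAt.rpow_const (Or.inl hp.ne')))
    have l2 : ContinuousAt (fun t => μ * ψ t ^ (-2 : ℝ)) 0 :=
      continuousAt_const.mul (hψc.continuousAt.rpow_const (Or.inl (hψpos 0).ne'))
    have l3 : Tendsto (fun t => c (Function.update x (Fin.last (d + 1)) t)) (𝓝[>] 0)
        (𝓝 (c (Function.update x (Fin.last (d + 1)) 0))) := by
      refine (hc.continuousOn _ (hmem 0 le_rfl)).tendsto.comp (tendsto_nhdsWithin_iff.2 ⟨?_, ?_⟩)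
      · exact (hasDerivAt_update x (Fin.last (d + 1)) 0).continuousAt.tendsto.mono_left
          nhdsWithin_le_nhds
      · filter_upwards [self_mem_nhdsWithin] with t ht using hmem t (le_of_lt ht)
    have l4 : Tendsto (fun t : ℝ => t ^ (2 - 2 * s)) (𝓝[>] 0) (𝓝 0) := by
      have := (Real.continuousAt_rpow_const (0 : ℝ) (2 - 2 * s) (Or.inr (by linarith))).tendsto
      rw [Real.zero_rpow (by linarith)] at this
      exact this.mono_left nhdsWithin_le_nhds
    have l5 := hc.neumann x (by simp [hx]) (by simp [hx])
    have h := (l1.tendsto.mono_left nhdsWithin_le_nhds).mul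
      (l5.sub (l4.mul ((l2.tendsto.mono_left nhdsWithin_le_nhds).mul l3)))
    simp only [zero_mul, sub_zero, mul_zero] at h
    refine h.congr' ?_
    filter_upwards [self_mem_nhdsWithin] with t ht using (hkey t ht).symm
  -- The inverse of `Z`: the height of the arc point with parameter `z` after scaling it to `x_n =
  -- 1`. It turns the limit `t → 0+` into `z → 1-`.
  set τ : ℝ → ℝ := fun z => 2 * Real.sqrt (z * (1 - z)) / (2 * z - 1) with hτ
  have hτpos : ∀ z ∈ Set.Ioo (1 / 2 : ℝ) 1, 0 < τ z := by
    intro z hz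
    have h1 : 0 < z * (1 - z) := mul_pos (by linarith [hz.1]) (by linarith [hz.2])
    have h2 : 0 < 2 * z - 1 := by linarith [hz.1]
    simp only [hτ]; positivity
  have hτ0 : Tendsto τ (𝓝[<] 1) (𝓝[>] 0) := by
    refine tendsto_nhdsWithin_iff.2 ⟨?_, ?_⟩
    · have : ContinuousAt τ 1 := by
        refine ContinuousAt.div (by fun_prop) (by fun_prop) (by norm_num)
      have h := this.tendsto
      simp only [hτ, sub_self, mul_zero, Real.sqrt_zero, zero_div] at h
      exact h.mono_left nhdsWithin_le_nhds
    · filter_upwards [Ioo_mem_nhdsLT (show (1 / 2 : ℝ) < 1 by norm_num)] with z hz using hτpos z hz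
  have hZτ : ∀ z ∈ Set.Ioo (1 / 2 : ℝ) 1, Z (τ z) = z := by
    intro z hz
    have h1 : 0 < z * (1 - z) := mul_pos (by linarith [hz.1]) (by linarith [hz.2])
    have h2 : 0 < 2 * z - 1 := by linarith [hz.1]
    have h3 : ψ (τ z) = 1 / (2 * z - 1) := by
      have : 1 + τ z ^ 2 = (1 / (2 * z - 1)) ^ 2 := by
        simp only [hτ]
        rw [div_pow, mul_pow, Real.sq_sqrt h1.le]
        field_simp
        ring
      simp only [hψ]
      rw [this, Real.sqrt_sq (by positivity)]
    simp only [hZ, h3]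
    field_simp
    ring
  refine (hlim.comp hτ0).congr' ?_
  filter_upwards [Ioo_mem_nhdsLT (show (1 / 2 : ℝ) < 1 by norm_num)] with z hz
  simp only [Function.comp, hZτ z hz]

lemma isAngular_arc {s μ : ℝ} (hs1 : s < 1) {c : Pt d → ℝ}
    (hc : IsMixedSolution s c) (hi : TangIndep c) (hh : IsHomogeneousHalf μ c) :
    IsAngular s (μ * (μ + 1 - 2 * s)) fun z => c (arc d z) := by
  have hcd : ∀ z ∈ Set.Ioo (0 : ℝ) 1, ContDiffAt ℝ 2 (fun z => c (arc d z)) z := fun z hz =>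
    (hc.isAdmissible.contDiffAt (arc_mem_openHalf hz)).comp z (contDiffAt_arc hz)
  refine ⟨?_, hcd, ?_, fun z hz => ?_, ?_⟩
  · exact (hc.continuousOn.comp_continuous continuous_arc arc_mem_closedHalf).continuousOn
  · exact hc.dirichlet _ (by simp [arc]) (by simp [arc])
  · have hz' := Set.Ioo_subset_Icc_self hz
    have hx := arc_mem_openHalf (d := d) hz
    have he : c =ᶠ[𝓝 (arc d z)] fun w => rad w ^ μ * (fun z => c (arc d z)) (ang w) := by
      filter_upwards [isOpen_openHalf.mem_nhds hx] with w hw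
        using hi.eq_polar hh (openHalf_subset_closedHalf hw) (rad_pos hw)
    have h := hc.Lop_eq_zero hx
    rw [Lop_congr he, Lop_polar (G := fun z => c (arc d z)) hx (by rw [ang_arc hz']; exact hcd z hz), ang_arc hz',
      rad_arc hz', Real.one_rpow, one_mul] at h
    exact h
  · exact tendsto_neumann_arc hs1 hc.isAdmissible hi hh
      fun z hz => (hcd z hz).differentiableAt (by norm_num)

/-- Homogeneous solutions that do not depend on the tangential variables. -/
theorem planar_classification {s μ : ℝ} (hs0 : 0 < s) (hs1 : s < 1) {c : Pt d → ℝ}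
    (hc : IsMixedSolution s c) (hi : TangIndep c) (hh : IsHomogeneousHalf μ c) :
    (∀ x ∈ closedHalf d, c x = 0) ∨
      ∃ m : ℕ, μ = s + m ∧ ∃ a : ℝ, ∀ x ∈ closedHalf d, c x = a * um s m x := by
  rcases le_or_gt μ 0 with hμ | hμ
  · exact Or.inl (eq_zero_of_homogeneous_nonpos hμ hc.isAdmissible hh)
  rcases (isAngular_arc hs1 hc hi hh).classification hs0 hs1 hμ with h | ⟨m, hm, a, h⟩
  · left
    intro x hx
    rcases (rad_nonneg x).eq_or_lt with h0 | h0
    · exact eq_zero_of_rad_eq_zero hc.isAdmissible h0.symm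
    · rw [hi.eq_polar hh hx h0, h _ (ang_mem_Icc h0), mul_zero]
  · right
    refine ⟨m, hm, a, fun x hx => ?_⟩
    rcases (rad_nonneg x).eq_or_lt with h0 | h0
    · rw [eq_zero_of_rad_eq_zero hc.isAdmissible h0.symm]
      have h1 : xn x = 0 := by linarith [xn_le_rad x, neg_xn_le_rad x]
      rw [um_eq, ← h0, h1]
      simp [Real.zero_rpow hs0.ne']
    · rw [hi.eq_polar hh hx h0, h _ (ang_mem_Icc h0), um_polar s m h0, hm, add_comm s]
      ring

/-! ### Tangential expansions of homogeneous solutions -/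

/-- `u = ∑ x''^β c_β(x_n, x_{n+1})` with admissible coefficients. -/
structure HasExpansion (s : ℝ) (u : Pt d → ℝ) (B : Finset (Fin d →₀ ℕ))
    (c : (Fin d →₀ ℕ) → Pt d → ℝ) : Prop where
  isAdmissible : ∀ β, IsAdmissible s (c β)
  tangIndep : ∀ β, TangIndep (c β)
  support : ∀ β, β ∉ B → ∀ x, c β x = 0
  eq_sum : ∀ x ∈ closedHalf d,
    u x = ∑ β ∈ B, MvPolynomial.eval (tang x) (MvPolynomial.monomial β 1) * c β x

lemma eval_eq_sum_monomial (P : MvPolynomial (Fin d) ℝ) {B : Finset (Fin d →₀ ℕ)}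
    (hB : P.support ⊆ B) (a : Fin d → ℝ) :
    MvPolynomial.eval a P =
      ∑ β ∈ B, MvPolynomial.eval a (MvPolynomial.monomial β 1) * P.coeff β := by
  conv_lhs => rw [P.as_sum]
  rw [map_sum]
  refine Finset.sum_subset_zero_on_sdiff hB ?_ ?_
  · intro β hβ
    rw [MvPolynomial.notMem_support_iff.1 (Finset.mem_sdiff.1 hβ).2, mul_zero]
  · intro β _
    simp only [MvPolynomial.eval_monomial]
    ring

/-- Each coefficient is a fixed linear combination of copies of `u` with `x''` frozen at
interpolation nodes, so regularity and boundary conditions are inherited directly. -/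
lemma exists_expansion {s : ℝ} (hs0 : 0 < s) (hs1 : s < 1) {κ : ℝ} {u : Pt d → ℝ}
    (hu : IsMixedSolution s u) (hh : IsHomogeneousHalf κ u) :
    ∃ B c, HasExpansion s u B c := by
  classical
  obtain ⟨ι, hι, Q, A, h⟩ := exists_tangential_expansion hs0 hs1 hu
    (growthLE_of_homogeneous hu.continuousOn hh)
  refine ⟨Finset.univ.biUnion fun k => (Q k).support,
    fun β x => ∑ k, (Q k).coeff β * u (diag 0 (A k) x), ?_, ?_, ?_, ?_⟩
  · exact fun β => IsAdmissible.sum _ fun k _ => (hu.isAdmissible.diag 0 (A k)).const_mul _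
  · intro β x y h1 h2
    refine Finset.sum_congr rfl fun k _ => ?_
    congr 2
    exact pt_ext (by simp [tang_diag]) (by simpa) (by simpa)
  · intro β hβ x
    refine Finset.sum_eq_zero fun k _ => ?_
    have : β ∉ (Q k).support := fun h => hβ (Finset.mem_biUnion.2 ⟨k, Finset.mem_univ k, h⟩)
    rw [MvPolynomial.notMem_support_iff.1 this, zero_mul]
  · intro x hx
    rw [h x hx]
    simp only [Finset.mul_sum]
    rw [Finset.sum_comm]
    refine Finset.sum_congr rfl fun k _ => ?_
    rw [eval_eq_sum_monomial (Q k)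
      (Finset.subset_biUnion_of_mem (fun k => (Q k).support) (Finset.mem_univ k)), Finset.sum_mul]
    exact Finset.sum_congr rfl fun β _ => by ring

lemma coeff_eq_of_eval_eq {B : Finset (Fin d →₀ ℕ)} {f g : (Fin d →₀ ℕ) → ℝ}
    (h : ∀ a : Fin d → ℝ, ∑ β ∈ B, MvPolynomial.eval a (MvPolynomial.monomial β 1) * f β =
      ∑ β ∈ B, MvPolynomial.eval a (MvPolynomial.monomial β 1) * g β) :
    ∀ β ∈ B, f β = g β := by
  classical
  have h1 : ∑ β ∈ B, MvPolynomial.monomial β (f β) = ∑ β ∈ B, MvPolynomial.monomial β (g β) := by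
    refine MvPolynomial.funext fun a => ?_
    have := h a
    simp only [MvPolynomial.eval_monomial, one_mul] at this
    simp only [map_sum, MvPolynomial.eval_monomial]
    simpa only [mul_comm] using this
  intro β hβ
  have h2 := congrArg (MvPolynomial.coeff β) h1
  simpa [MvPolynomial.coeff_sum, MvPolynomial.coeff_monomial, hβ] using h2

lemma HasExpansion.eq_sum_diag {s : ℝ} {u : Pt d → ℝ} {B : Finset (Fin d →₀ ℕ)}
    {c : (Fin d →₀ ℕ) → Pt d → ℝ} (he : HasExpansion s u B c) {x : Pt d} (hx : x ∈ closedHalf d)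
    (a : Fin d → ℝ) :
    u (diag 0 a x) = ∑ β ∈ B, MvPolynomial.eval a (MvPolynomial.monomial β 1) * c β x := by
  rw [he.eq_sum _ (diag_mem_closedHalf hx)]
  have ht : tang (diag 0 a x) = a := by simp [tang_diag]
  rw [ht]
  refine Finset.sum_congr rfl fun β _ => ?_
  rw [he.tangIndep β (diag 0 a x) x (by simp) (by simp)]

/-- For fixed `(x_n, x_{n+1})` both sides of the homogeneity relation are polynomials in the frozen
tangential position `a`. Comparing coefficients, the monomial at `r • a` accounts for the factor `r
^ |β|`. -/
lemma HasExpansion.isHomogeneousHalf {s κ : ℝ} {u : Pt d → ℝ} {B : Finset (Fin d →₀ ℕ)}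
    {c : (Fin d →₀ ℕ) → Pt d → ℝ} (he : HasExpansion s u B c) (hh : IsHomogeneousHalf κ u)
    (β : Fin d →₀ ℕ) : IsHomogeneousHalf (κ - β.degree) (c β) := by
  intro x hx r hr
  by_cases hβ : β ∈ B
  · have hrx : r • x ∈ closedHalf d := mul_nonneg hr.le (show 0 ≤ xlast x from hx)
    have key := coeff_eq_of_eval_eq (B := B) (f := fun β => r ^ β.degree * c β (r • x))
      (g := fun β => r ^ κ * c β x) (fun a => ?_) β hβ
    · rw [Real.rpow_sub hr, Real.rpow_natCast]
      have : r ^ β.degree ≠ 0 := pow_ne_zero _ hr.ne'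
      field_simp
      linarith
    · have h1 := he.eq_sum_diag hrx (r • a)
      have h2 := he.eq_sum_diag hx a
      have h3 : diag 0 (r • a) (r • x) = r • diag 0 a x :=
        pt_ext (by simp [tang_diag]; rfl) (by simp) (by simp)
      rw [h3, hh _ (diag_mem_closedHalf hx) r hr, h2, Finset.mul_sum] at h1
      rw [Finset.sum_congr rfl fun β _ => show
        MvPolynomial.eval a (MvPolynomial.monomial β 1) * (r ^ κ * c β x) =
          r ^ κ * (MvPolynomial.eval a (MvPolynomial.monomial β 1) * c β x) by ring, h1]
      refine Finset.sum_congr rfl fun β _ => ?_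
      rw [eval_smul_of_isHomogeneous (MvPolynomial.isHomogeneous_monomial 1 rfl)]
      ring
  · rw [he.support β hβ, he.support β hβ, mul_zero]

lemma TangIndep.Lop_diag {s : ℝ} {c : Pt d → ℝ} (hi : TangIndep c) {x : Pt d}
    (a : Fin d → ℝ) (hc : ContDiffAt ℝ 2 c (diag 0 a x)) :
    Lop s c (diag 0 a x) = Lop s c x := by
  have h1 : diag 1 (a - tang x) x = diag 0 a x :=
    pt_ext (by funext i; simp [tang_diag]) (by simp) (by simp)
  have h2 : (fun z => c (diag 1 (a - tang x) z)) = c := by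
    funext z; exact hi _ _ (by simp) (by simp)
  have h3 := MixedDN.Lop_diag (s := s) (u := c) (e := 1) (c := a - tang x) (x := x)
    (fun _ => one_pow 2) (by rwa [h1])
  rw [h2, h1] at h3
  exact h3.symm

/-- The top coefficients of a solution are solutions. -/
lemma HasExpansion.isMixedSolution_top {s : ℝ} {u : Pt d → ℝ} {B : Finset (Fin d →₀ ℕ)}
    {c : (Fin d →₀ ℕ) → Pt d → ℝ} (he : HasExpansion s u B c) (hu : IsMixedSolution s u) {D : ℕ}
    (hD : ∀ β : Fin d →₀ ℕ, D < β.degree → ∀ x ∈ closedHalf d, c β x = 0)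
    {β₀ : Fin d →₀ ℕ} (hβ₀ : β₀.degree = D) : IsMixedSolution s (c β₀) := by
  classical
  refine isMixedSolution_iff.2 ⟨he.isAdmissible β₀, fun x hx => ?_⟩
  by_cases hB : β₀ ∈ B
  -- For fixed `(x_n, x_{n+1})`, `Lop u` is a polynomial in the tangential position, hence the zero
  -- polynomial. Its coefficient at `β₀` is `Lop c_{β₀}` plus multiples of coefficients of degree `D
  -- + 2`, which vanish by `hD`.
  · have h1 : ∑ β ∈ B, (MvPolynomial.monomial β (Lop s (c β) x) +
        MvPolynomial.C (c β x) * polyLaplacian (MvPolynomial.monomial β 1)) = 0 := by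
      refine MvPolynomial.funext fun a => ?_
      have hy : diag 0 a x ∈ openHalf d := diag_mem_openHalf hx
      have hcd : ∀ β, ContDiffAt ℝ 2 (c β) (diag 0 a x) := fun β =>
        (he.isAdmissible β).contDiffAt hy
      have hev : u =ᶠ[𝓝 (diag 0 a x)] fun z =>
          ∑ β ∈ B, MvPolynomial.eval (tang z) (MvPolynomial.monomial β 1) * c β z := by
        filter_upwards [isOpen_openHalf.mem_nhds hy] with z hz
          using he.eq_sum z (openHalf_subset_closedHalf hz)
      have h2 := hu.Lop_eq_zero hy
      rw [Lop_congr hev, Lop_sum _ fun β _ => (contDiff_tang_eval _).contDiffAt.mul (hcd β)] at h2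
      rw [map_sum, map_zero, ← h2]
      refine Finset.sum_congr rfl fun β _ => ?_
      have ht : tang (diag 0 a x) = a := by simp [tang_diag]
      rw [Lop_tang_mul _ (he.tangIndep β) (hcd β), (he.tangIndep β).Lop_diag a (hcd β), ht,
        he.tangIndep β (diag 0 a x) x (by simp) (by simp)]
      simp only [map_add, map_mul, MvPolynomial.eval_C, MvPolynomial.eval_monomial]
      ring
    have h2 := congrArg (MvPolynomial.coeff β₀) h1
    have h3 : ∀ β, c β x * MvPolynomial.coeff β₀ (polyLaplacian (MvPolynomial.monomial β 1)) = 0 := by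
      intro β
      have hm := MvPolynomial.isHomogeneous_monomial (σ := Fin d) (R := ℝ) (d := β) 1 rfl
      rcases lt_or_ge β.degree 2 with hlt | hge
      · rw [polyLaplacian_eq_zero hm hlt, MvPolynomial.coeff_zero, mul_zero]
      · by_cases hdeg : β₀.degree = β.degree - 2
        · rw [hD β (by omega) x (openHalf_subset_closedHalf hx), zero_mul]
        · rw [(polyLaplacian_isHomogeneous hm).coeff_eq_zero hdeg, mul_zero]
    simpa [MvPolynomial.coeff_sum, MvPolynomial.coeff_C_mul, MvPolynomial.coeff_monomial, hB, h3]
      using h2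
  · have : c β₀ = fun _ => 0 := funext fun x => he.support β₀ hB x
    rw [this, Lop_const]

/-! ### The polynomial recursion -/

/-- The polynomials generated from the leading one by the recursion. -/
noncomputable def recPoly (m : ℕ) (T : MvPolynomial (Fin d) ℝ) : ℕ → MvPolynomial (Fin d) ℝ
  | 0 => T
  | k + 1 => MvPolynomial.C (-(((2 * k + 2) * (2 * m + 2 * k + 3) : ℕ) : ℝ)⁻¹) *
      polyLaplacian (recPoly m T k)

lemma recPoly_rec (m : ℕ) (T : MvPolynomial (Fin d) ℝ) (k : ℕ) :
    polyLaplacian (recPoly m T k) +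
      MvPolynomial.C (((2 * k + 2) * (2 * m + 2 * k + 3) : ℕ) : ℝ) * recPoly m T (k + 1) = 0 := by
  have h : (((2 * k + 2) * (2 * m + 2 * k + 3) : ℕ) : ℝ) ≠ 0 := by positivity
  rw [recPoly, ← mul_assoc, ← map_mul, mul_neg, mul_inv_cancel₀ h]
  simp

lemma recPoly_isHomogeneous (m : ℕ) {T : MvPolynomial (Fin d) ℝ} {n : ℕ} (hT : T.IsHomogeneous n)
    (k : ℕ) : (recPoly m T k).IsHomogeneous (n - 2 * k) := by
  induction k with
  | zero => simpa [recPoly] using hT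
  | succ k ih =>
    have h := (polyLaplacian_isHomogeneous ih).C_mul
      (-(((2 * k + 2) * (2 * m + 2 * k + 3) : ℕ) : ℝ)⁻¹)
    rwa [show n - 2 * k - 2 = n - 2 * (k + 1) by omega] at h

lemma HasExpansion.sub_stack {s : ℝ} (hs0 : 0 < s) (hs1 : s < 1) {u : Pt d → ℝ}
    {B : Finset (Fin d →₀ ℕ)} {c : (Fin d →₀ ℕ) → Pt d → ℝ} (he : HasExpansion s u B c)
    (m N : ℕ) (P : ℕ → MvPolynomial (Fin d) ℝ) :
    ∃ B', HasExpansion s (fun x => u x - stack s m N P x) B'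
      fun β x => c β x - ∑ k ∈ Finset.range (N + 1), (P k).coeff β * blk s m k x := by
  classical
  refine ⟨B ∪ (Finset.range (N + 1)).biUnion fun k => (P k).support, ?_, ?_, ?_, ?_⟩
  · exact fun β => (he.isAdmissible β).sub
      (IsAdmissible.sum _ fun k _ => (isAdmissible_blk hs0 hs1 m k).const_mul _)
  · intro β x y h1 h2
    simp only [he.tangIndep β x y h1 h2, tangIndep_blk s m _ x y h1 h2]
  · intro β hβ x
    rw [Finset.mem_union, not_or] at hβ
    rw [he.support β hβ.1, zero_sub, neg_eq_zero]
    refine Finset.sum_eq_zero fun k hk => ?_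
    have : β ∉ (P k).support := fun h => hβ.2 (Finset.mem_biUnion.2 ⟨k, hk, h⟩)
    rw [MvPolynomial.notMem_support_iff.1 this, zero_mul]
  · intro x hx
    simp only [mul_sub, Finset.sum_sub_distrib]
    congr 1
    · rw [he.eq_sum x hx]
      refine Finset.sum_subset Finset.subset_union_left fun β _ hβ => ?_
      rw [he.support β hβ, mul_zero]
    · simp only [Finset.mul_sum]
      rw [Finset.sum_comm, stack]
      refine Finset.sum_congr rfl fun k hk => ?_
      rw [eval_eq_sum_monomial (P k) ((Finset.subset_biUnion_of_mem
        (fun k => (P k).support) hk).trans Finset.subset_union_right), Finset.sum_mul]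
      exact Finset.sum_congr rfl fun β _ => by ring

/-! ### Representation of homogeneous solutions -/

/-- The conditions on the polynomials `P_{m,k}`. -/
def IsFamily (l : ℕ) (P : ℕ → ℕ → MvPolynomial (Fin d) ℝ) : Prop :=
  (∀ m k : ℕ, m + 2 * k ≤ l → (P m k).IsHomogeneous (l - m - 2 * k)) ∧
    ∀ m k : ℕ, m + 2 * (k + 1) ≤ l → polyLaplacian (P m k) +
      MvPolynomial.C (((2 * k + 2) * (2 * m + 2 * k + 3) : ℕ) : ℝ) * P m (k + 1) = 0

lemma polyLaplacian_add (P Q : MvPolynomial (Fin d) ℝ) :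
    polyLaplacian (P + Q) = polyLaplacian P + polyLaplacian Q := by
  simp [polyLaplacian, Finset.sum_add_distrib]

lemma IsHomogeneousHalf.sub {κ : ℝ} {u v : Pt d → ℝ} (hu : IsHomogeneousHalf κ u)
    (hv : IsHomogeneousHalf κ v) : IsHomogeneousHalf κ fun x => u x - v x := by
  intro x hx c hc
  simp only [hu x hx c hc, hv x hx c hc, mul_sub]

/-- Induction on a strict bound for the tangential degree. The coefficients of degree `D` are planar
solutions of order `s + l - D`, hence multiples of `u_{l-D}`. Together they form `T(x'') u_{l-D}`,
and subtracting the solution generated by `T` leaves only lower degrees. -/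
lemma exists_family_of_degree_lt {s : ℝ} (hs0 : 0 < s) (hs1 : s < 1) (l D : ℕ) :
    ∀ (u : Pt d → ℝ) (B : Finset (Fin d →₀ ℕ)) (c : (Fin d →₀ ℕ) → Pt d → ℝ),
      IsMixedSolution s u → IsHomogeneousHalf (s + l) u → HasExpansion s u B c →
      (∀ β : Fin d →₀ ℕ, D ≤ β.degree → ∀ x ∈ closedHalf d, c β x = 0) →
      ∃ P : ℕ → ℕ → MvPolynomial (Fin d) ℝ, IsFamily l P ∧ ∀ x ∈ closedHalf d,
        u x = ∑ m ∈ Finset.range (l + 1), stack s m ((l - m) / 2) (P m) x := by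
  classical
  induction D with
  | zero =>
    intro u B c _ _ he hc
    refine ⟨fun _ _ => 0, ⟨fun m k _ => MvPolynomial.isHomogeneous_zero _ _ _,
      fun m k _ => by simp [polyLaplacian]⟩, fun x hx => ?_⟩
    rw [he.eq_sum x hx]
    simp [stack, hc _ (Nat.zero_le _) x hx]
  | succ D ih =>
    intro u B c hu hh he hc
    have htop : ∀ β : Fin d →₀ ℕ, β.degree = D → (∀ x ∈ closedHalf d, c β x = 0) ∨
        ∃ m : ℕ, s + l - D = s + m ∧ ∃ a : ℝ, ∀ x ∈ closedHalf d, c β x = a * um s m x := by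
      intro β hβ
      have := he.isHomogeneousHalf hh β
      rw [hβ] at this
      exact planar_classification hs0 hs1 (he.isMixedSolution_top hu
        (fun β hβ => hc β hβ) hβ) (he.tangIndep β) this
    -- For `D > l` the order `s + l - D` is not of the form `s + m`, so the top coefficients already
    -- vanish.
    rcases lt_or_ge l D with hlD | hDl
    · refine ih u B c hu hh he fun β hβ => ?_
      rcases hβ.eq_or_lt with h | h
      · refine (htop β h.symm).resolve_right ?_
        rintro ⟨m, hm, _⟩
        have h1 : (l : ℝ) = m + D := by linarith
        have h2 : l = m + D := by exact_mod_cast h1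
        omega
      · exact hc β h
    · set m := l - D with hmdef
      have hml : m ≤ l := Nat.sub_le _ _
      have hlm : l - m = D := by omega
      have ha : ∀ β : Fin d →₀ ℕ, ∃ a : ℝ, β.degree = D → ∀ x ∈ closedHalf d,
          c β x = a * um s m x := by
        intro β
        by_cases hβ : β.degree = D
        · rcases htop β hβ with h | ⟨m', hm', a, h⟩
          · exact ⟨0, fun _ x hx => by rw [h x hx, zero_mul]⟩
          · have h1 : (l : ℝ) = m' + D := by linarith
            have h2 : l = m' + D := by exact_mod_cast h1
            have h3 : m' = m := by omega
            subst h3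
            exact ⟨a, fun _ => h⟩
        · exact ⟨0, fun h => absurd h hβ⟩
      choose a ha using ha
      set T : MvPolynomial (Fin d) ℝ :=
        ∑ β ∈ B.filter fun β => β.degree = D, MvPolynomial.monomial β (a β) with hT
      have hThom : T.IsHomogeneous D := MvPolynomial.IsHomogeneous.sum _ _ _ fun β hβ =>
        MvPolynomial.isHomogeneous_monomial _ (Finset.mem_filter.1 hβ).2
      have hTcoeff : ∀ β : Fin d →₀ ℕ, β ∈ B → β.degree = D → T.coeff β = a β := by
        intro β h1 h2
        simp [hT, MvPolynomial.coeff_sum, MvPolynomial.coeff_monomial, h1, h2]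
      have hTcoeff' : ∀ β : Fin d →₀ ℕ, β ∉ B → T.coeff β = 0 := by
        intro β h1
        simp [hT, MvPolynomial.coeff_sum, MvPolynomial.coeff_monomial, h1]
      set Q := recPoly m T with hQ
      have hQhom : ∀ k, m + 2 * k ≤ l → (Q k).IsHomogeneous (l - m - 2 * k) := by
        intro k _
        rw [hlm]
        exact recPoly_isHomogeneous m hThom k
      have hQrec := recPoly_rec m T
      obtain ⟨B', he'⟩ := he.sub_stack hs0 hs1 m ((l - m) / 2) Q
      obtain ⟨P, ⟨hP1, hP2⟩, hP3⟩ := ih _ B' _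
        (hu.sub (isMixedSolution_stack hs0 hs1 hml Q hQhom fun k _ => hQrec k))
        (hh.sub (isHomogeneousHalf_stack hml Q hQhom)) he' (by
          intro β hβ x hx
          -- The later terms of the subtracted solution have tangential degree `D - 2k < D`, so only
          -- `k = 0` affects degrees at least `D`.
          have hk : ∀ k ∈ Finset.range ((l - m) / 2 + 1), k ≠ 0 → (Q k).coeff β * blk s m k x = 0 := by
            intro k hk hk0
            have hk' := Finset.mem_range.1 hk
            rw [(recPoly_isHomogeneous m hThom k).coeff_eq_zero (by omega), zero_mul]
          rw [Finset.sum_eq_single 0 (fun k hk' hk0 => hk k hk' hk0) (by simp)]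
          have hQ0 : Q 0 = T := rfl
          have hb : blk s m 0 x = um s m x := by simp [blk]
          rw [hQ0, hb]
          rcases hβ.eq_or_lt with h | h
          · by_cases hB : β ∈ B
            · rw [hTcoeff β hB h.symm, ha β h.symm x hx, sub_self]
            · rw [he.support β hB, hTcoeff' β hB]; ring
          · rw [hc β h x hx, hThom.coeff_eq_zero (by omega)]; ring)
      refine ⟨fun m' k => if m' = m then P m' k + Q k else P m' k, ⟨?_, ?_⟩, fun x hx => ?_⟩
      · intro m' k h
        by_cases hm : m' = m
        · simp only [hm, if_true]
          rw [hm] at h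
          exact (hP1 m k h).add (hQhom k h)
        · simp only [hm, if_false]
          exact hP1 m' k h
      · intro m' k h
        by_cases hm : m' = m
        · simp only [hm, if_true]
          rw [hm] at h
          rw [polyLaplacian_add, mul_add]
          linear_combination hP2 m k h + hQrec k
        · simp only [hm, if_false]
          exact hP2 m' k h
      · have h1 : ∀ m', stack s m' ((l - m') / 2)
            (fun k => if m' = m then P m' k + Q k else P m' k) x =
            stack s m' ((l - m') / 2) (P m') x +
              if m' = m then stack s m ((l - m) / 2) Q x else 0 := by
          intro m'
          by_cases hm : m' = m
          · subst hm
            simp only [if_true, stack, ← Finset.sum_add_distrib]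
            refine Finset.sum_congr rfl fun k _ => ?_
            rw [map_add]; ring
          · simp [hm, stack]
        have h2 := hP3 x hx
        rw [sub_eq_iff_eq_add] at h2
        rw [h2]
        simp only [h1, Finset.sum_add_distrib]
        rw [Finset.sum_ite_eq', if_pos (Finset.mem_range.2 (by omega))]

/-- Every homogeneous solution is a sum of explicit ones. -/
theorem exists_family {s : ℝ} (hs0 : 0 < s) (hs1 : s < 1) {l : ℕ} {u : Pt d → ℝ}
    (hu : IsMixedSolution s u) (hh : IsHomogeneousHalf (s + l) u) :
    ∃ P : ℕ → ℕ → MvPolynomial (Fin d) ℝ, IsFamily l P ∧ ∀ x ∈ closedHalf d,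
      u x = ∑ m ∈ Finset.range (l + 1), stack s m ((l - m) / 2) (P m) x := by
  obtain ⟨B, c, he⟩ := exists_expansion hs0 hs1 hu hh
  refine exists_family_of_degree_lt hs0 hs1 l (B.sup Finsupp.degree + 1) u B c hu hh he ?_
  intro β hβ x _
  refine he.support β (fun hB => ?_) x
  have := Finset.le_sup (f := Finsupp.degree) hB
  omega

/-- The homogeneity of a nontrivial homogeneous solution. -/
theorem exists_homogeneity {s : ℝ} (hs0 : 0 < s) (hs1 : s < 1) {κ : ℝ} {u : Pt d → ℝ}
    (hu : IsMixedSolution s u) (hh : IsHomogeneousHalf κ u) (hne : ∃ x ∈ closedHalf d, u x ≠ 0) :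
    ∃ l : ℕ, κ = s + l := by
  classical
  obtain ⟨B, c, he⟩ := exists_expansion hs0 hs1 hu hh
  obtain ⟨x₀, hx₀, hux⟩ := hne
  set S := B.filter fun β => ∃ x ∈ closedHalf d, c β x ≠ 0 with hS
  have hSne : S.Nonempty := by
    by_contra hcon
    rw [Finset.not_nonempty_iff_eq_empty, hS, Finset.filter_eq_empty_iff] at hcon
    push Not at hcon
    refine hux ?_
    rw [he.eq_sum x₀ hx₀]
    exact Finset.sum_eq_zero fun β hβ => by rw [hcon hβ x₀ hx₀, mul_zero]
  -- A nonzero coefficient of maximal degree is a planar solution of order `κ - |β|`, which must be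
  -- `s + m`.
  obtain ⟨β, hβ, hmax⟩ := S.exists_max_image Finsupp.degree hSne
  obtain ⟨_, x₁, hx₁, hne⟩ := Finset.mem_filter.1 hβ
  have hD : ∀ γ : Fin d →₀ ℕ, β.degree < γ.degree → ∀ x ∈ closedHalf d, c γ x = 0 := by
    intro γ hγ x hx
    by_contra hcon
    have hB : γ ∈ B := by
      by_contra hB
      exact hcon (he.support γ hB x)
    exact absurd (hmax γ (Finset.mem_filter.2 ⟨hB, x, hx, hcon⟩)) (not_le.2 hγ)
  rcases planar_classification hs0 hs1 (he.isMixedSolution_top hu hD rfl) (he.tangIndep β)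
    (he.isHomogeneousHalf hh β) with h | ⟨m, hm, _⟩
  · exact absurd (h x₁ hx₁) hne
  · exact ⟨m + β.degree, by push_cast; linarith⟩

lemma isMixedSolution_of_family {s : ℝ} (hs0 : 0 < s) (hs1 : s < 1) {l : ℕ} {u : Pt d → ℝ}
    {P : ℕ → ℕ → MvPolynomial (Fin d) ℝ} (hP : IsFamily l P) (hu : ∀ x ∈ closedHalf d,
      u x = ∑ m ∈ Finset.range (l + 1), stack s m ((l - m) / 2) (P m) x) :
    IsMixedSolution s u ∧ IsHomogeneousHalf (s + l) u := by
  have hm : ∀ m ∈ Finset.range (l + 1), m ≤ l := fun m hm => by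
    have := Finset.mem_range.1 hm; omega
  have hsol : ∀ m ∈ Finset.range (l + 1),
      IsMixedSolution s (stack s m ((l - m) / 2) (P m)) := fun m h =>
    isMixedSolution_stack hs0 hs1 (hm m h) (P m) (hP.1 m) (hP.2 m)
  constructor
  · refine isMixedSolution_iff.2 ⟨(IsAdmissible.sum _ fun m h =>
      (hsol m h).isAdmissible).congr hu, fun x hx => ?_⟩
    have hev : u =ᶠ[𝓝 x] fun z =>
        ∑ m ∈ Finset.range (l + 1), stack s m ((l - m) / 2) (P m) z := by
      filter_upwards [isOpen_openHalf.mem_nhds hx] with z hz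
        using hu z (openHalf_subset_closedHalf hz)
    rw [Lop_congr hev, Lop_sum _ fun m h => (hsol m h).isAdmissible.contDiffAt hx]
    exact Finset.sum_eq_zero fun m h => (hsol m h).Lop_eq_zero hx
  · intro x hx c hc
    have hcx : c • x ∈ closedHalf d := mul_nonneg hc.le (show 0 ≤ xlast x from hx)
    rw [hu x hx, hu _ hcx, Finset.mul_sum]
    exact Finset.sum_congr rfl fun m h =>
      isHomogeneousHalf_stack (hm m h) (P m) (hP.1 m) x hx c hc

lemma sum_stack_eq (s : ℝ) (l : ℕ) (P : ℕ → ℕ → MvPolynomial (Fin d) ℝ) (x : Pt d) :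
    ∑ m ∈ Finset.range (l + 1), stack s m ((l - m) / 2) (P m) x =
      ∑ m ∈ Finset.range (l + 1), ∑ k ∈ Finset.range ((l - m) / 2 + 1),
        rad x ^ (2 * k) * MvPolynomial.eval (tang x) (P m k) * um s m x :=
  Finset.sum_congr rfl fun m _ => Finset.sum_congr rfl fun k _ => by rw [blk]; ring

/-- The new outer index `m + 2k` is the degree of `ρ^(2k) p_m` in `(x_n, ρ)`. -/
lemma sum_reindex (l : ℕ) (f : ℕ → ℕ → ℝ) :
    ∑ m ∈ Finset.range (l + 1), ∑ k ∈ Finset.range ((l - m) / 2 + 1), f m k =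
      ∑ k ∈ Finset.range (l + 1), ∑ j ∈ Finset.range (k / 2 + 1), f (k - 2 * j) j := by
  rw [Finset.sum_sigma', Finset.sum_sigma']
  refine Finset.sum_bij' (fun p _ => ⟨p.1 + 2 * p.2, p.2⟩) (fun p _ => ⟨p.1 - 2 * p.2, p.2⟩)
    ?_ ?_ ?_ ?_ ?_
  · rintro ⟨m, k⟩ h
    simp only [Finset.mem_sigma, Finset.mem_range] at h ⊢
    omega
  · rintro ⟨m, k⟩ h
    simp only [Finset.mem_sigma, Finset.mem_range] at h ⊢
    omega
  · rintro ⟨m, k⟩ _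
    simp
  · rintro ⟨m, k⟩ h
    simp only [Finset.mem_sigma, Finset.mem_range] at h
    have : m - 2 * k + 2 * k = m := by omega
    simp [this]
  · rintro ⟨m, k⟩ _
    simp

end MixedDN

/-! ### The classification theorem. -/

theorem propositionA7 (d : ℕ) (s : ℝ) (hs0 : 0 < s) (hs1 : s < 1) :
    -- the possible homogeneities
    (∀ (κ : ℝ) (u : MixedDN.Pt d → ℝ), 0 ≤ κ →
      MixedDN.IsMixedSolution s u → MixedDN.IsHomogeneousHalf κ u →
      (∃ x ∈ MixedDN.closedHalf d, u x ≠ 0) → ∃ l : ℕ, κ = s + l) ∧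
    -- the corresponding homogeneous solutions
    (∀ (l : ℕ) (u : MixedDN.Pt d → ℝ),
      (MixedDN.IsMixedSolution s u ∧ MixedDN.IsHomogeneousHalf (s + l) u) ↔
      ∃ P : ℕ → ℕ → MvPolynomial (Fin d) ℝ,
        (∀ m k : ℕ, m + 2 * k ≤ l → (P m k).IsHomogeneous (l - m - 2 * k)) ∧
        (∀ m k : ℕ, m + 2 * (k + 1) ≤ l →
          MixedDN.polyLaplacian (P m k) +
            MvPolynomial.C (((2 * k + 2) * (2 * m + 2 * k + 3) : ℕ) : ℝ) * P m (k + 1) = 0) ∧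
        ∀ x ∈ MixedDN.closedHalf d,
          u x = ∑ m ∈ Finset.range (l + 1), ∑ k ∈ Finset.range ((l - m) / 2 + 1),
            MixedDN.rad x ^ (2 * k) * MvPolynomial.eval (MixedDN.tang x) (P m k) *
              MixedDN.um s m x) ∧
    -- the representation through `w_{0,s}` and homogeneous polynomials
    (∃ p : ℕ → MvPolynomial (Fin 2) ℝ,
      (∀ m : ℕ, (p m).IsHomogeneous m ∧ ∀ x ∈ MixedDN.closedHalf d,
        MixedDN.um s m x =
          MixedDN.w0 s x * MvPolynomial.eval ![MixedDN.xn x, MixedDN.rad x] (p m)) ∧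
      ∀ (l : ℕ) (u : MixedDN.Pt d → ℝ),
        MixedDN.IsMixedSolution s u → MixedDN.IsHomogeneousHalf (s + l) u →
        ∃ R : ℕ → ℕ → MvPolynomial (Fin d) ℝ,
          (∀ k j : ℕ, k ≤ l → 2 * j ≤ k → (R k j).IsHomogeneous (l - k)) ∧
          ∀ x ∈ MixedDN.closedHalf d,
            u x = ∑ k ∈ Finset.range (l + 1), ∑ j ∈ Finset.range (k / 2 + 1),
              MixedDN.w0 s x *
                (MixedDN.rad x ^ (2 * j) *
                  MvPolynomial.eval ![MixedDN.xn x, MixedDN.rad x] (p (k - 2 * j))) *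
                MvPolynomial.eval (MixedDN.tang x) (R k j)) := by
  refine ⟨fun κ u _ hu hh hne => MixedDN.exists_homogeneity hs0 hs1 hu hh hne,
    fun l u => ⟨?_, ?_⟩, MixedDN.profPoly s, fun m => ⟨MixedDN.profPoly_isHomogeneous s m,
      fun x _ => MixedDN.um_eq_w0_mul hs0 m x⟩, fun l u hu hh => ?_⟩
  · rintro ⟨hu, hh⟩
    obtain ⟨P, hP, hPu⟩ := MixedDN.exists_family hs0 hs1 hu hh
    exact ⟨P, hP.1, hP.2, fun x hx => by rw [hPu x hx, MixedDN.sum_stack_eq]⟩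
  · rintro ⟨P, hP1, hP2, hPu⟩
    exact MixedDN.isMixedSolution_of_family hs0 hs1 ⟨hP1, hP2⟩
      fun x hx => by rw [hPu x hx, MixedDN.sum_stack_eq]
  · obtain ⟨P, hP, hPu⟩ := MixedDN.exists_family hs0 hs1 hu hh
    -- The representation is that of part two, regrouped by the degree `k` in `(x_n, ρ)`: the row
    -- index is `m = k - 2j`, and `l - (k - 2j) - 2j = l - k`.
    refine ⟨fun k j => P (k - 2 * j) j, fun k j hk hj => ?_, fun x hx => ?_⟩
    · have h := hP.1 (k - 2 * j) j (by omega)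
      rwa [show l - (k - 2 * j) - 2 * j = l - k by omega] at h
    · rw [hPu x hx, MixedDN.sum_stack_eq, MixedDN.sum_reindex l fun m k =>
        MixedDN.rad x ^ (2 * k) * MvPolynomial.eval (MixedDN.tang x) (P m k) * MixedDN.um s m x]
      refine Finset.sum_congr rfl fun k _ => Finset.sum_congr rfl fun j _ => ?_
      rw [MixedDN.um_eq_w0_mul hs0]
      ring
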